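/- Let $e_1,e_2,e_3$ be nonzero integers with $e_1+e_2+e_3=0$. For a positive integer $m$ let $E^{(m)}: y^2=x(x-e_1m)(x+e_2m)$ over $\mathbb Q$, and $E=E^{(1)}$. Identify the $2$-Selmer group $\mathrm{Sel}_2(E^{(m)}/\mathbb Q)$ with the subgroup of $(\mathbb Q^\times/\mathbb Q^{\times2})^3$ of all classes of triples $\Lambda=(d_1,d_2,d_3)$ such that $d_1d_2d_3$ is a square and the projective curve $$D_\Lambda:\quad e_1mt^2+d_2u_2^2-d_3u_3^2=0,\quad e_2mt^2+d_3u_3^2-d_1u_1^2=0,\quad e_3mt^2+d_1u_1^2-d_2u_2^2=0$$ has points over $\mathbb R$ and over $\mathbb Q_p$ for every prime $p$. The map $(x,y)\mapsto(x+e_2m,\,x-e_1m,\,x)$ on points that are not $2$-torsion, $O\mapsto(1,1,1)$, $(e_1m,0)\mapsto(-e_3m,-e_1e_3,e_1m)$, $(-e_2m,0)\mapsto(-e_2e_3,e_3m,-e_2m)$, $(0,0)\mapsto(e_2m,-e_1m,-e_1e_2)$ embeds $E^{(m)}(\mathbb Q)/2E^{(m)}(\mathbb Q)$ in it; the pure $2$-Selmer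 group is $\mathrm{Sel}_2'(E^{(m)})=\mathrm{Sel}_2(E^{(m)}/\mathbb Q)\big/\bigl(E^{(m)}(\mathbb Q)_{\mathrm{tors}}/2E^{(m)}(\mathbb Q)_{\mathrm{tors}}\bigr)$. Let $n=p_1\cdots p_k$ ($p_i$ prime) be an odd positive square-free integer coprime to $e_1e_2e_3$, such that every $p_i$ is $\equiv1\bmod 8$ and is a quadratic residue modulo every odd prime factor of $e_1e_2e_3$. Assume that neither $E$ nor $E^{(n)}$ has a rational point of order $4$ and that $\mathrm{Sel}_2(E/\mathbb Q)\cong(\mathbb Z/2\mathbb Z)^2$. Then every element of $\mathrm{Sel}_2'(E^{(n)})$ is represented by exactly one triple $(d_1,d_2,d_3)$ of positive divisors of $n$, and the map $$(d_1,d_2,d_3)\longmapsto\begin{pmatrix}\mathbf x\\ \mathbf y\end{pmatrix},\qquad x_i=v_{p_i}(d_1),\quad y_i=v_{p_i}(d_2)\in\mathbb F_2,$$ on these representatives induces a group isomorphism $$\mathrm{Sel}_2'(E^{(n)})\;\xrightarrow{\ \sim\ }\;\ker\begin{pmatrix}\mathbf A_n&0\\0&\mathbf A_n\end{pmatrix}\subseteq\mathbb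 F_2^{2k},\qquad \mathbf A_n=\bigl([p_j,-n]_{p_i}\bigr)_{1\le i,j\le k}\in M_k(\mathbb F_2),$$ where $[a,b]_p\in\mathbb F_2$ is the additive Hilbert symbol: $[a,b]_p=0$ if $z^2=ax^2+by^2$ has a nontrivial solution in $\mathbb Q_p$, and $[a,b]_p=1$ otherwise. -/

import Mathlib

open WeierstrassCurve

/-! ### Square classes -/

/-- The group `Kˣ / (Kˣ)²` of square classes of a field. -/
def SqClass (K : Type*) [Field K] : Type _ :=
  Kˣ ⧸ (powMonoidHom 2 : Kˣ →* Kˣ).range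

noncomputable instance (K : Type*) [Field K] : CommGroup (SqClass K) :=
  inferInstanceAs (CommGroup (Kˣ ⧸ (powMonoidHom 2 : Kˣ →* Kˣ).range))

/-- The projection `Kˣ → Kˣ / (Kˣ)²`. -/
def SqClass.mk {K : Type*} [Field K] : Kˣ →* SqClass K :=
  QuotientGroup.mk' (powMonoidHom 2 : Kˣ →* Kˣ).range

theorem SqClass.mk_eq_one_iff {K : Type*} [Field K] (u : Kˣ) :
    SqClass.mk u = 1 ↔ ∃ v : Kˣ, v ^ 2 = u :=
  (QuotientGroup.eq_one_iff (N := (powMonoidHom 2 : Kˣ →* Kˣ).range) u).trans Iff.rfl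

theorem SqClass.mul_self {K : Type*} [Field K] (c : SqClass K) : c * c = 1 := by
  obtain ⟨u, rfl⟩ : ∃ u, SqClass.mk u = c := QuotientGroup.mk_surjective c
  rw [← map_mul, SqClass.mk_eq_one_iff]
  exact ⟨u, pow_two u⟩

/-- Triples of square classes. -/
abbrev SqTriple (K : Type*) [Field K] : Type _ :=
  SqClass K × SqClass K × SqClass K

open Classical in
/-- The square class of a nonzero element `a` of `K` (with value `1` at the meaningless `a = 0`). -/
noncomputable def sqClass {K : Type*} [Field K] (a : K) : SqClass K :=
  if h : a = 0 then 1 else SqClass.mk (Units.mk0 a h)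

theorem sqClass_of_ne {K : Type*} [Field K] {a : K} (h : a ≠ 0) :
    sqClass a = SqClass.mk (Units.mk0 a h) := by
  simp [sqClass, h]

theorem sqClass_one {K : Type*} [Field K] : sqClass (1 : K) = 1 := by
  rw [sqClass_of_ne one_ne_zero, Units.mk0_one, map_one]

theorem sqClass_mul {K : Type*} [Field K] {a b : K} (ha : a ≠ 0) (hb : b ≠ 0) :
    sqClass (a * b) = sqClass a * sqClass b := by
  rw [sqClass_of_ne ha, sqClass_of_ne hb, sqClass_of_ne (mul_ne_zero ha hb), Units.mk0_mul, map_mul]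

theorem sqClass_eq_one_iff {K : Type*} [Field K] {a : K} (ha : a ≠ 0) :
    sqClass a = 1 ↔ ∃ c : K, a = c ^ 2 := by
  rw [sqClass_of_ne ha, SqClass.mk_eq_one_iff]
  constructor
  · rintro ⟨u, hu⟩
    refine ⟨u, ?_⟩
    have := congrArg (Units.val) hu
    simpa using this.symm
  · rintro ⟨c, rfl⟩
    have hc : c ≠ 0 := fun h => ha (by simp [h])
    exact ⟨Units.mk0 c hc, by ext; simp⟩

theorem sqClass_eq_iff {K : Type*} [Field K] {a b : K} (ha : a ≠ 0) (hb : b ≠ 0) :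
    sqClass a = sqClass b ↔ ∃ c : K, a = b * c ^ 2 := by
  constructor
  · intro h
    have h1 : sqClass (a * b) = 1 := by rw [sqClass_mul ha hb, h, SqClass.mul_self]
    obtain ⟨c, hc⟩ := (sqClass_eq_one_iff (mul_ne_zero ha hb)).1 h1
    refine ⟨c / b, ?_⟩
    field_simp
    linear_combination hc
  · rintro ⟨c, rfl⟩
    have hc : c ^ 2 ≠ 0 := fun h => ha (by simp [h])
    rw [sqClass_mul hb hc, (sqClass_eq_one_iff hc).2 ⟨c, rfl⟩, mul_one]

/-! ### The curve, its twists and its homogeneous spaces -/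

/-- Nonzero integers `e₁, e₂, e₃` with `e₁ + e₂ + e₃ = 0`: the parameters of the elliptic curve
`E : y² = x (x - e₁) (x + e₂)` over `ℚ` with full rational `2`-torsion. -/
structure TwoTorsionTriple where
  e₁ : ℤ
  e₂ : ℤ
  e₃ : ℤ
  ne₁ : e₁ ≠ 0
  ne₂ : e₂ ≠ 0
  ne₃ : e₃ ≠ 0
  sum_eq_zero : e₁ + e₂ + e₃ = 0

namespace TwoTorsionTriple

/-- The Weierstrass curve `y² = x (x - e₁) (x + e₂) = x³ + (e₂ - e₁) x² - e₁ e₂ x`, over any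
field `K`. -/
def curve (E : TwoTorsionTriple) (K : Type*) [Field K] : WeierstrassCurve K where
  a₁ := 0
  a₂ := (E.e₂ : K) - E.e₁
  a₃ := 0
  a₄ := -(E.e₁ * E.e₂ : K)
  a₆ := 0

/-- The quadratic twist `E⁽ⁿ⁾ : y² = x (x - e₁ n) (x + e₂ n)`. -/
def twist (E : TwoTorsionTriple) (n : ℕ) (hn : n ≠ 0) : TwoTorsionTriple where
  e₁ := E.e₁ * n
  e₂ := E.e₂ * n
  e₃ := E.e₃ * n
  ne₁ := mul_ne_zero E.ne₁ (by exact_mod_cast hn)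
  ne₂ := mul_ne_zero E.ne₂ (by exact_mod_cast hn)
  ne₃ := mul_ne_zero E.ne₃ (by exact_mod_cast hn)
  sum_eq_zero := by rw [← add_mul, ← add_mul, E.sum_eq_zero, zero_mul]

/-- `D_Λ(K) ≠ ∅` for `Λ = (d₁, d₂, d₃)`: the curve `D_Λ` in projective `3`-space with coordinates
`(t : u₁ : u₂ : u₃)`, cut out by the three quadrics below, has a `K`-rational point. -/
def HasPoint (E : TwoTorsionTriple) {K : Type*} [Field K] (d₁ d₂ d₃ : K) : Prop :=
  ∃ t u₁ u₂ u₃ : K, ¬ (t = 0 ∧ u₁ = 0 ∧ u₂ = 0 ∧ u₃ = 0) ∧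
    E.e₁ * t ^ 2 + d₂ * u₂ ^ 2 - d₃ * u₃ ^ 2 = 0 ∧
    E.e₂ * t ^ 2 + d₃ * u₃ ^ 2 - d₁ * u₁ ^ 2 = 0 ∧
    E.e₃ * t ^ 2 + d₁ * u₁ ^ 2 - d₂ * u₂ ^ 2 = 0

end TwoTorsionTriple

/-! ### The Kummer map -/

/-- The component of the Kummer map `E(K) → (Kˣ/(Kˣ)²)³` at the root `α` of the cubic
`(x - α) (x - β) (x - γ)`: `(x, y) ↦ x - α`, with `O ↦ 1` and `(α, 0) ↦ (α - β) (α - γ)`. -/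
noncomputable def kummerComponent {K : Type*} [Field K] [DecidableEq K] (W : WeierstrassCurve K) (α β γ : K) :
    W.toAffine.Point → SqClass K
  | .zero => 1
  | .some x _ _ => if x = α then sqClass ((α - β) * (α - γ)) else sqClass (x - α)

theorem kummerComponent_zero {K : Type*} [Field K] [DecidableEq K] (W : WeierstrassCurve K)
    (α β γ : K) : kummerComponent W α β γ 0 = 1 :=
  rfl

theorem kummer_line_aux {K : Type*} [Field K] [DecidableEq K] {α β γ l m x₁ x₂ x₃ : K}
    (h2 : l ^ 2 + α + β + γ = x₁ + x₂ + x₃)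
    (h1 : α * β + β * γ + γ * α - 2 * l * m = x₁ * x₂ + x₁ * x₃ + x₂ * x₃)
    (h0 : α * β * γ + m ^ 2 = x₁ * x₂ * x₃) (hβ : α ≠ β) (hγ : α ≠ γ) (hx : x₁ = α) :
    sqClass ((α - β) * (α - γ)) *
      (if x₂ = α then sqClass ((α - β) * (α - γ)) else sqClass (x₂ - α)) *
      (if x₃ = α then sqClass ((α - β) * (α - γ)) else sqClass (x₃ - α)) = 1 := by
  subst hx
  have hm : l * x₁ + m = 0 := by
    have : (l * x₁ + m) ^ 2 = 0 := by
      linear_combination x₁ ^ 2 * h2 - x₁ * h1 + h0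
    exact pow_eq_zero_iff (two_ne_zero) |>.1 this
  have hk : (x₁ - β) * (x₁ - γ) = (x₂ - x₁) * (x₃ - x₁) := by
    linear_combination h1 - 2 * x₁ * h2 + 2 * l * hm
  have hne : (x₁ - β) * (x₁ - γ) ≠ 0 := mul_ne_zero (sub_ne_zero.2 hβ) (sub_ne_zero.2 hγ)
  have hne' := hne
  rw [hk] at hne'
  have n2 : x₂ - x₁ ≠ 0 := left_ne_zero_of_mul hne'
  have n3 : x₃ - x₁ ≠ 0 := right_ne_zero_of_mul hne'
  rw [if_neg (sub_ne_zero.1 n2), if_neg (sub_ne_zero.1 n3), mul_assoc, ← sqClass_mul n2 n3, hk,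
    SqClass.mul_self]

theorem kummer_line {K : Type*} [Field K] [DecidableEq K] {α β γ l m x₁ x₂ x₃ : K}
    (h2 : l ^ 2 + α + β + γ = x₁ + x₂ + x₃)
    (h1 : α * β + β * γ + γ * α - 2 * l * m = x₁ * x₂ + x₁ * x₃ + x₂ * x₃)
    (h0 : α * β * γ + m ^ 2 = x₁ * x₂ * x₃) (hβ : α ≠ β) (hγ : α ≠ γ) :
    (if x₁ = α then sqClass ((α - β) * (α - γ)) else sqClass (x₁ - α)) *
      (if x₂ = α then sqClass ((α - β) * (α - γ)) else sqClass (x₂ - α)) *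
      (if x₃ = α then sqClass ((α - β) * (α - γ)) else sqClass (x₃ - α)) = 1 := by
  by_cases c1 : x₁ = α
  · rw [if_pos c1]
    exact kummer_line_aux h2 h1 h0 hβ hγ c1
  by_cases c2 : x₂ = α
  · rw [if_pos c2, mul_comm (if x₁ = α then _ else _) (sqClass ((α - β) * (α - γ)))]
    exact kummer_line_aux (m := m) (l := l) (x₁ := x₂) (x₂ := x₁) (x₃ := x₃)
      (by linear_combination h2) (by linear_combination h1) (by linear_combination h0) hβ hγ c2
  by_cases c3 : x₃ = α
  · rw [if_pos c3, mul_comm _ (sqClass ((α - β) * (α - γ))), ← mul_assoc]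
    exact kummer_line_aux (m := m) (l := l) (x₁ := x₃) (x₂ := x₁) (x₃ := x₂)
      (by linear_combination h2) (by linear_combination h1) (by linear_combination h0) hβ hγ c3
  rw [if_neg c1, if_neg c2, if_neg c3]
  have n1 := sub_ne_zero.2 c1
  have n2 := sub_ne_zero.2 c2
  have n3 := sub_ne_zero.2 c3
  rw [← sqClass_mul n1 n2, ← sqClass_mul (mul_ne_zero n1 n2) n3,
    sqClass_eq_one_iff (mul_ne_zero (mul_ne_zero n1 n2) n3)]
  exact ⟨l * α + m, by linear_combination α * h1 - α ^ 2 * h2 - h0⟩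

theorem kummerComponent_add {K : Type*} [Field K] [DecidableEq K] (W : WeierstrassCurve K)
    {α β γ : K} (ha₁ : W.a₁ = 0) (ha₂ : W.a₂ = -(α + β + γ)) (ha₃ : W.a₃ = 0)
    (ha₄ : W.a₄ = α * β + β * γ + γ * α) (ha₆ : W.a₆ = -(α * β * γ)) (hβ : α ≠ β) (hγ : α ≠ γ)
    (P Q : W.toAffine.Point) :
    kummerComponent W α β γ (P + Q) = kummerComponent W α β γ P * kummerComponent W α β γ Q := by
  rcases P with _ | ⟨x₁, y₁, p₁⟩
  · change kummerComponent W α β γ (0 + Q) = 1 * _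
    rw [zero_add, one_mul]
  rcases Q with _ | ⟨x₂, y₂, p₂⟩
  · change kummerComponent W α β γ (_ + 0) = _ * 1
    rw [add_zero, mul_one]
  by_cases hxy : x₁ = x₂ ∧ y₁ = W.toAffine.negY x₂ y₂
  · rw [Affine.Point.add_of_Y_eq hxy.1 hxy.2]
    rw [kummerComponent_zero]
    simp only [kummerComponent]
    rw [← hxy.1, SqClass.mul_self]
  · rw [Affine.Point.add_some hxy]
    have key := Affine.addPolynomial_slope p₁.1 p₂.1 hxy
    simp only [kummerComponent]
    generalize W.toAffine.slope x₁ x₂ y₁ y₂ = l at *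
    generalize W.toAffine.addX x₁ x₂ l = x₃ at *
    rw [Affine.addPolynomial_eq, neg_inj, Cubic.prod_X_sub_C_eq, Cubic.toPoly_injective] at key
    simp only [Cubic.mk.injEq, ha₁, ha₂, ha₃, ha₄, ha₆] at key
    obtain ⟨-, k2, k1, k0⟩ := key
    have := kummer_line (α := α) (β := β) (γ := γ) (l := l) (m := y₁ - l * x₁) (x₁ := x₁)
      (x₂ := x₂) (x₃ := x₃) (by linear_combination -k2) (by linear_combination k1)
      (by linear_combination -k0) hβ hγ
    have h3 := SqClass.mul_self (if x₃ = α then sqClass ((α - β) * (α - γ)) else sqClass (x₃ - α))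
    exact mul_right_cancel (h3.trans this.symm)

/-- `kummerComponent` at the point with first coordinate `x` equals the class of `d`,
when `x - α = d v²` and the analogous relations hold at the other two roots. -/
theorem kummer_eq_aux {K : Type*} [Field K] [DecidableEq K] {α β γ x d d' d'' v v' v'' s : K}
    (hβ : α ≠ β) (hγ : α ≠ γ) (hd : d ≠ 0) (h : x - α = d * v ^ 2) (h' : x - β = d' * v' ^ 2)
    (h'' : x - γ = d'' * v'' ^ 2) (hs : d * d' * d'' = s ^ 2) :
    (if x = α then sqClass ((α - β) * (α - γ)) else sqClass (x - α)) = sqClass d := by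
  split_ifs with hx
  · subst hx
    rw [sqClass_eq_iff (mul_ne_zero (sub_ne_zero.2 hβ) (sub_ne_zero.2 hγ)) hd]
    refine ⟨s * v' * v'' / d, ?_⟩
    rw [h', h'']
    field_simp
    linear_combination v' ^ 2 * v'' ^ 2 * hs
  · rw [sqClass_eq_iff (sub_ne_zero.2 hx) hd]
    exact ⟨v, h⟩

theorem kummer_eq_aux' {K : Type*} [Field K] [DecidableEq K] {α c x d : K} (hd : d ≠ 0)
    (h : (if x = α then c else x - α) ≠ 0 →
      (if x = α then sqClass c else sqClass (x - α)) = sqClass d) : ∃ v : K, x - α = d * v ^ 2 := by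
  by_cases hx : x = α
  · exact ⟨0, by simp [hx]⟩
  · rw [if_neg hx, if_neg hx] at h
    exact (sqClass_eq_iff (sub_ne_zero.2 hx) hd).1 (h (sub_ne_zero.2 hx))

namespace TwoTorsionTriple

theorem cast_facts (E : TwoTorsionTriple) (K : Type*) [Field K] [CharZero K] :
    (E.e₁ : K) ≠ 0 ∧ (E.e₂ : K) ≠ 0 ∧ (E.e₃ : K) ≠ 0 ∧ (E.e₁ : K) + E.e₂ + E.e₃ = 0 :=
  ⟨Int.cast_ne_zero.2 E.ne₁, Int.cast_ne_zero.2 E.ne₂, Int.cast_ne_zero.2 E.ne₃,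
    by exact_mod_cast congrArg (Int.cast : ℤ → K) E.sum_eq_zero⟩

theorem roots_ne (E : TwoTorsionTriple) (K : Type*) [Field K] [CharZero K] :
    -(E.e₂ : K) ≠ E.e₁ ∧ -(E.e₂ : K) ≠ 0 ∧ (E.e₁ : K) ≠ 0 := by
  obtain ⟨h1, h2, h3, h⟩ := E.cast_facts K
  exact ⟨fun h' => h3 (by linear_combination h + h'), neg_ne_zero.2 h2, h1⟩

/-- The Kummer map `E(K) → (Kˣ/(Kˣ)²)³`, given by `(x, y) ↦ (x + e₂, x - e₁, x)` away from the
`2`-torsion. -/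
noncomputable def kummer (E : TwoTorsionTriple) (K : Type*) [Field K] [CharZero K]
    [DecidableEq K] : Multiplicative (E.curve K).toAffine.Point →* SqTriple K :=
  MonoidHom.mk'
    (fun P => (kummerComponent (E.curve K) (-(E.e₂ : K)) E.e₁ 0 P.toAdd,
      kummerComponent (E.curve K) (E.e₁ : K) (-(E.e₂ : K)) 0 P.toAdd,
      kummerComponent (E.curve K) (0 : K) E.e₁ (-(E.e₂ : K)) P.toAdd))
    (by
      intro P Q
      obtain ⟨r1, r2, r3⟩ := E.roots_ne K
      refine Prod.ext ?_ (Prod.ext ?_ ?_)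
      · exact kummerComponent_add _ rfl (by simp only [curve]; ring) rfl
          (by simp only [curve]; ring) (by simp only [curve]; ring) r1 r2 _ _
      · exact kummerComponent_add _ rfl (by simp only [curve]; ring) rfl
          (by simp only [curve]; ring) (by simp only [curve]; ring) r1.symm r3 _ _
      · exact kummerComponent_add _ rfl (by simp only [curve]; ring) rfl
          (by simp only [curve]; ring) (by simp only [curve]; ring) r3.symm r2.symm _ _)

theorem nonsingular (E : TwoTorsionTriple) {K : Type*} [Field K] [CharZero K] {x y : K}
    (h : y ^ 2 = x * (x - E.e₁) * (x + E.e₂)) : (E.curve K).toAffine.Nonsingular x y := by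
  obtain ⟨h1, h2, h3, hs⟩ := E.cast_facts K
  refine (Affine.equation_iff_nonsingular_of_Δ_ne_zero ?_).1 ?_
  · have : (E.curve K).Δ = 16 * (E.e₁ : K) ^ 2 * (E.e₂ : K) ^ 2 * (E.e₃ : K) ^ 2 := by
      have h3' : (E.e₃ : K) = -(E.e₁ + E.e₂) := by linear_combination hs
      rw [h3']
      simp only [WeierstrassCurve.Δ, WeierstrassCurve.b₂, WeierstrassCurve.b₄,
        WeierstrassCurve.b₆, WeierstrassCurve.b₈, curve]
      ring
    rw [this]
    exact mul_ne_zero (mul_ne_zero (mul_ne_zero (by norm_num) (pow_ne_zero _ h1))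
      (pow_ne_zero _ h2)) (pow_ne_zero _ h3)
  · rw [Affine.equation_iff]
    simp only [curve]
    linear_combination h

/-- `D_Λ` has a `K`-point if and only if `Λ` lies in the image of the Kummer map. -/
theorem hasPoint_iff (E : TwoTorsionTriple) {K : Type*} [Field K] [CharZero K] [DecidableEq K]
    {d₁ d₂ d₃ : K} (h₁ : d₁ ≠ 0) (h₂ : d₂ ≠ 0) (h₃ : d₃ ≠ 0) (hd : IsSquare (d₁ * d₂ * d₃)) :
    E.HasPoint d₁ d₂ d₃ ↔ (sqClass d₁, sqClass d₂, sqClass d₃) ∈ (E.kummer K).range := by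
  obtain ⟨n1, n2, n3, hsum⟩ := E.cast_facts K
  obtain ⟨r1, r2, r3⟩ := E.roots_ne K
  obtain ⟨s, hs⟩ := hd
  constructor
  · rintro ⟨t, u₁, u₂, u₃, hne, H1, H2, H3⟩
    by_cases ht : t = 0
    · subst ht
      have e12 : d₁ * u₁ ^ 2 = d₂ * u₂ ^ 2 := by linear_combination H3
      have e23 : d₂ * u₂ ^ 2 = d₃ * u₃ ^ 2 := by linear_combination H1
      have hu1 : u₁ ≠ 0 := by
        rintro rfl
        have z2 : u₂ = 0 := by simpa [h₂] using e12.symm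
        subst z2
        have z3 : u₃ = 0 := by simpa [h₃] using e23.symm
        exact hne ⟨rfl, rfl, rfl, z3⟩
      have hu2 : u₂ ≠ 0 := by
        rintro rfl
        exact hu1 (by simpa [h₁] using e12)
      have hu3 : u₃ ≠ 0 := by
        rintro rfl
        exact hu2 (by simpa [h₂] using e23)
      have q12 : sqClass d₁ = sqClass d₂ := by
        rw [sqClass_eq_iff h₁ h₂]
        exact ⟨u₂ / u₁, by field_simp; linear_combination e12⟩
      have q23 : sqClass d₂ = sqClass d₃ := by
        rw [sqClass_eq_iff h₂ h₃]
        exact ⟨u₃ / u₂, by field_simp; linear_combination e23⟩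
      have q : sqClass d₁ * sqClass d₂ * sqClass d₃ = 1 := by
        rw [← sqClass_mul h₁ h₂, ← sqClass_mul (mul_ne_zero h₁ h₂) h₃,
          sqClass_eq_one_iff (mul_ne_zero (mul_ne_zero h₁ h₂) h₃)]
        exact ⟨s, by rw [hs, pow_two]⟩
      have q3 : sqClass d₃ = 1 := by
        rw [q12, SqClass.mul_self, one_mul] at q
        exact q
      rw [q12, q23, q3]
      exact one_mem _
    · have A1 : d₃ * u₃ ^ 2 / t ^ 2 - -(E.e₂ : K) = d₁ * (u₁ / t) ^ 2 := by
        field_simp; linear_combination H2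
      have A2 : d₃ * u₃ ^ 2 / t ^ 2 - (E.e₁ : K) = d₂ * (u₂ / t) ^ 2 := by
        field_simp; linear_combination -H1
      have A3 : d₃ * u₃ ^ 2 / t ^ 2 - 0 = d₃ * (u₃ / t) ^ 2 := by
        field_simp; ring
      have hxy : (s * u₁ * u₂ * u₃ / t ^ 3) ^ 2 = (d₃ * u₃ ^ 2 / t ^ 2) *
          (d₃ * u₃ ^ 2 / t ^ 2 - E.e₁) * (d₃ * u₃ ^ 2 / t ^ 2 + E.e₂) := by
        rw [← sub_neg_eq_add (d₃ * u₃ ^ 2 / t ^ 2) (E.e₂ : K), A1, A2]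
        field_simp
        linear_combination -(u₁ ^ 2 * u₂ ^ 2 * u₃ ^ 2 * hs)
      refine ⟨Multiplicative.ofAdd (Affine.Point.some _ _ (E.nonsingular hxy)), ?_⟩
      refine Prod.ext ?_ (Prod.ext ?_ ?_)
      · exact kummer_eq_aux r1 r2 h₁ A1 A2 A3 (s := s) (by linear_combination hs)
      · exact kummer_eq_aux r1.symm r3 h₂ A2 A1 A3 (s := s) (by linear_combination hs)
      · exact kummer_eq_aux r3.symm r2.symm h₃ A3 A2 A1 (s := s) (by linear_combination hs)
  · rintro ⟨P, hP⟩
    have hP1 := congrArg Prod.fst hP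
    have hP2 := congrArg (fun z => z.2.1) hP
    have hP3 := congrArg (fun z => z.2.2) hP
    obtain ⟨P, rfl⟩ := Multiplicative.ofAdd.surjective P
    rcases P with _ | ⟨x, y, hp⟩
    · obtain ⟨a, ha⟩ := (sqClass_eq_one_iff h₁).1 hP1.symm
      obtain ⟨b, hb⟩ := (sqClass_eq_one_iff h₂).1 hP2.symm
      obtain ⟨c, hc⟩ := (sqClass_eq_one_iff h₃).1 hP3.symm
      have ha0 : a ≠ 0 := by rintro rfl; simp at ha; exact h₁ ha
      have hb0 : b ≠ 0 := by rintro rfl; simp at hb; exact h₂ hb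
      have hc0 : c ≠ 0 := by rintro rfl; simp at hc; exact h₃ hc
      refine ⟨0, 1 / a, 1 / b, 1 / c, by simp [ha0], ?_, ?_, ?_⟩ <;>
      · subst ha hb hc
        field_simp
        ring
    · obtain ⟨v₁, w₁⟩ := kummer_eq_aux' (x := x) (α := -(E.e₂ : K)) h₁ (fun _ => hP1)
      obtain ⟨v₂, w₂⟩ := kummer_eq_aux' (x := x) (α := (E.e₁ : K)) h₂ (fun _ => hP2)
      obtain ⟨v₃, w₃⟩ := kummer_eq_aux' (x := x) (α := (0 : K)) h₃ (fun _ => hP3)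
      refine ⟨1, v₁, v₂, v₃, by simp, ?_, ?_, ?_⟩
      · linear_combination w₃ - w₂
      · linear_combination w₁ - w₃
      · linear_combination w₂ - w₁ + hsum

theorem HasPoint.mul {E : TwoTorsionTriple} {K : Type*} [Field K] [CharZero K]
    {d₁ d₂ d₃ d₁' d₂' d₃' : K} (h₁ : d₁ ≠ 0) (h₂ : d₂ ≠ 0) (h₃ : d₃ ≠ 0)
    (hd : IsSquare (d₁ * d₂ * d₃)) (h₁' : d₁' ≠ 0) (h₂' : d₂' ≠ 0) (h₃' : d₃' ≠ 0)
    (hd' : IsSquare (d₁' * d₂' * d₃')) (H : E.HasPoint d₁ d₂ d₃) (H' : E.HasPoint d₁' d₂' d₃') :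
    E.HasPoint (d₁ * d₁') (d₂ * d₂') (d₃ * d₃') := by
  classical
  rw [hasPoint_iff E h₁ h₂ h₃ hd] at H
  rw [hasPoint_iff E h₁' h₂' h₃' hd'] at H'
  rw [hasPoint_iff E (mul_ne_zero h₁ h₁') (mul_ne_zero h₂ h₂') (mul_ne_zero h₃ h₃')
    (by rw [show d₁ * d₁' * (d₂ * d₂') * (d₃ * d₃') = d₁ * d₂ * d₃ * (d₁' * d₂' * d₃') by ring]
        exact hd.mul hd'), sqClass_mul h₁ h₁', sqClass_mul h₂ h₂',
    sqClass_mul h₃ h₃']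
  exact mul_mem H H'

theorem HasPoint.map {E : TwoTorsionTriple} {K L : Type*} [Field K] [Field L] (f : K →+* L)
    {d₁ d₂ d₃ : K} (H : E.HasPoint d₁ d₂ d₃) : E.HasPoint (f d₁) (f d₂) (f d₃) := by
  obtain ⟨t, u₁, u₂, u₃, hne, H1, H2, H3⟩ := H
  refine ⟨f t, f u₁, f u₂, f u₃, by simpa using hne, ?_, ?_, ?_⟩
  · simpa using congrArg f H1
  · simpa using congrArg f H2
  · simpa using congrArg f H3

/-! ### Selmer groups -/

/-- `D_Λ(𝔸_ℚ) ≠ ∅`: the projective curve `D_Λ` has points over `ℝ` and over `ℚ_p` for all `p`. -/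
def EverywhereLocallySolvable (E : TwoTorsionTriple) (d₁ d₂ d₃ : ℚ) : Prop :=
  E.HasPoint (d₁ : ℝ) (d₂ : ℝ) (d₃ : ℝ) ∧
    ∀ (p : ℕ) [Fact p.Prime], E.HasPoint (d₁ : ℚ_[p]) (d₂ : ℚ_[p]) (d₃ : ℚ_[p])

/-- The `2`-Selmer group `Sel₂(E/ℚ)`, as a subgroup of `(ℚˣ/(ℚˣ)²)³`: the classes of the triples
`(d₁, d₂, d₃)` with square product whose homogeneous space is everywhere locally solvable. -/
noncomputable def selmer (E : TwoTorsionTriple) : Subgroup (SqTriple ℚ) where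
  carrier := {Λ | ∃ d₁ d₂ d₃ : ℚ, d₁ ≠ 0 ∧ d₂ ≠ 0 ∧ d₃ ≠ 0 ∧
    Λ = (sqClass d₁, sqClass d₂, sqClass d₃) ∧ IsSquare (d₁ * d₂ * d₃) ∧
    E.EverywhereLocallySolvable d₁ d₂ d₃}
  one_mem' := by
    have h : E.HasPoint (1 : ℚ) 1 1 := ⟨0, 1, 1, 1, by simp, by simp, by simp, by simp⟩
    refine ⟨1, 1, 1, one_ne_zero, one_ne_zero, one_ne_zero, ?_, by simp, ?_, ?_⟩
    · rw [sqClass_one]; rfl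
    · simpa using h.map (Rat.castHom ℝ)
    · intro p _
      simpa using h.map (Rat.castHom ℚ_[p])
  mul_mem' := by
    rintro _ _ ⟨a, b, c, ha, hb, hc, rfl, hs, hR, hp⟩ ⟨a', b', c', ha', hb', hc', rfl, hs', hR', hp'⟩
    refine ⟨a * a', b * b', c * c', mul_ne_zero ha ha', mul_ne_zero hb hb', mul_ne_zero hc hc',
      ?_, ?_, ?_, ?_⟩
    · rw [sqClass_mul ha ha', sqClass_mul hb hb', sqClass_mul hc hc']; rfl
    · rw [show a * a' * (b * b') * (c * c') = a * b * c * (a' * b' * c') by ring]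
      exact hs.mul hs'
    · push_cast
      refine HasPoint.mul (by exact_mod_cast ha) (by exact_mod_cast hb) (by exact_mod_cast hc) ?_
        (by exact_mod_cast ha') (by exact_mod_cast hb') (by exact_mod_cast hc') ?_ hR hR'
      · simpa using hs.map (Rat.castHom ℝ)
      · simpa using hs'.map (Rat.castHom ℝ)
    · intro p _
      push_cast
      refine HasPoint.mul (by exact_mod_cast ha) (by exact_mod_cast hb) (by exact_mod_cast hc) ?_
        (by exact_mod_cast ha') (by exact_mod_cast hb') (by exact_mod_cast hc') ?_ (hp p) (hp' p)
      · simpa using hs.map (Rat.castHom ℚ_[p])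
      · simpa using hs'.map (Rat.castHom ℚ_[p])
  inv_mem' := by
    intro Λ h
    have : Λ⁻¹ = Λ := by
      rw [inv_eq_iff_mul_eq_one]
      exact Prod.ext (SqClass.mul_self _) (Prod.ext (SqClass.mul_self _) (SqClass.mul_self _))
    rwa [this]

theorem exists_rep_of_mem_range_kummer (E : TwoTorsionTriple) (P : (E.curve ℚ).toAffine.Point) :
    ∃ d₁ d₂ d₃ : ℚ, d₁ ≠ 0 ∧ d₂ ≠ 0 ∧ d₃ ≠ 0 ∧
      E.kummer ℚ (Multiplicative.ofAdd P) = (sqClass d₁, sqClass d₂, sqClass d₃) ∧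
      IsSquare (d₁ * d₂ * d₃) := by
  obtain ⟨r1, r2, r3⟩ := E.roots_ne ℚ
  rcases P with _ | ⟨x, y, hp⟩
  · refine ⟨1, 1, 1, one_ne_zero, one_ne_zero, one_ne_zero, ?_, by simp⟩
    rw [sqClass_one]; rfl
  · have hE := (Affine.equation_iff _ _).1 hp.1
    simp only [curve] at hE
    by_cases c1 : x = -(E.e₂ : ℚ)
    · have c2 : x ≠ E.e₁ := c1 ▸ r1
      have c3 : x ≠ 0 := c1 ▸ r2
      refine ⟨(x - E.e₁) * (x - 0), x - E.e₁, x - 0,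
        mul_ne_zero (sub_ne_zero.2 c2) (sub_ne_zero.2 c3), sub_ne_zero.2 c2, sub_ne_zero.2 c3,
        Prod.ext ?_ (Prod.ext ?_ ?_), (x - E.e₁) * x, by ring⟩
      · exact (if_pos c1).trans (by rw [c1])
      · exact if_neg c2
      · exact if_neg c3
    by_cases c2 : x = E.e₁
    · have c3 : x ≠ 0 := c2 ▸ r3
      refine ⟨x - -(E.e₂ : ℚ), (x - -(E.e₂ : ℚ)) * (x - 0), x - 0,
        sub_ne_zero.2 c1, mul_ne_zero (sub_ne_zero.2 c1) (sub_ne_zero.2 c3), sub_ne_zero.2 c3,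
        Prod.ext ?_ (Prod.ext ?_ ?_), (x - -(E.e₂ : ℚ)) * x, by ring⟩
      · exact if_neg c1
      · exact (if_pos c2).trans (by rw [c2])
      · exact if_neg c3
    by_cases c3 : x = 0
    · refine ⟨x - -(E.e₂ : ℚ), x - E.e₁, (x - E.e₁) * (x - -(E.e₂ : ℚ)),
        sub_ne_zero.2 c1, sub_ne_zero.2 c2, mul_ne_zero (sub_ne_zero.2 c2) (sub_ne_zero.2 c1),
        Prod.ext ?_ (Prod.ext ?_ ?_), (x - E.e₁) * (x - -(E.e₂ : ℚ)), by ring⟩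
      · exact if_neg c1
      · exact if_neg c2
      · exact (if_pos c3).trans (by rw [c3])
    · refine ⟨x - -(E.e₂ : ℚ), x - E.e₁, x - 0,
        sub_ne_zero.2 c1, sub_ne_zero.2 c2, sub_ne_zero.2 c3,
        Prod.ext (if_neg c1) (Prod.ext (if_neg c2) (if_neg c3)), y, by linear_combination -hE⟩

/-- The Kummer map over `ℚ` takes its values in the Selmer group. -/
theorem kummer_mem_selmer (E : TwoTorsionTriple)
    (P : Multiplicative (E.curve ℚ).toAffine.Point) : E.kummer ℚ P ∈ E.selmer := by
  obtain ⟨a, b, c, ha, hb, hc, h, hs⟩ := E.exists_rep_of_mem_range_kummer P.toAdd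
  have hpt : E.HasPoint a b c := (E.hasPoint_iff ha hb hc hs).2 ⟨P, h⟩
  refine ⟨a, b, c, ha, hb, hc, h, hs, ?_, ?_⟩
  · simpa using hpt.map (Rat.castHom ℝ)
  · intro p _
    simpa using hpt.map (Rat.castHom ℚ_[p])

/-- The connecting map `E(ℚ) → Sel₂(E/ℚ)`, whose kernel is `2 E(ℚ)`. -/
noncomputable def kummerSelmer (E : TwoTorsionTriple) :
    Multiplicative (E.curve ℚ).toAffine.Point →* E.selmer :=
  (E.kummer ℚ).codRestrict E.selmer E.kummer_mem_selmer

/-- The image of `E(ℚ)_tors / 2 E(ℚ)_tors` in `Sel₂(E/ℚ)`. -/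
noncomputable def torsionImage (E : TwoTorsionTriple) : Subgroup E.selmer :=
  (CommGroup.torsion (Multiplicative (E.curve ℚ).toAffine.Point)).map E.kummerSelmer

/-- The pure `2`-Selmer group `Sel₂'(E) = Sel₂(E/ℚ) / (E(ℚ)_tors / 2 E(ℚ)_tors)`. -/
abbrev pureSelmer (E : TwoTorsionTriple) : Type :=
  E.selmer ⧸ E.torsionImage

/-- The class in `(ℚˣ/(ℚˣ)²)³` of a triple of positive integers. -/
noncomputable def classOf (d₁ d₂ d₃ : ℕ) : SqTriple ℚ :=
  (sqClass (d₁ : ℚ), sqClass (d₂ : ℚ), sqClass (d₃ : ℚ))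

end TwoTorsionTriple

/-! ### Hilbert symbols and the matrix -/

open Classical in
/-- The additive Hilbert symbol `[a, b]_p ∈ 𝔽₂` of `a, b ∈ ℚ_pˣ`: it is `0` if
`z² = a x² + b y²` has a nontrivial solution in `ℚ_p`, and `1` otherwise. -/
noncomputable def addHilbert (p : ℕ) [Fact p.Prime] (a b : ℚ_[p]) : ZMod 2 :=
  if ∃ x y z : ℚ_[p], ¬ (x = 0 ∧ y = 0 ∧ z = 0) ∧ z ^ 2 = a * x ^ 2 + b * y ^ 2 then 0 else 1

/-- The matrix `A_n = ([p_j, -n]_{p_i})_{i,j}` over `𝔽₂`, where `n = p_1 ⋯ p_k`. -/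
noncomputable def hilbertMatrix {k : ℕ} (p : Fin k → ℕ) [∀ i, Fact (p i).Prime] (n : ℕ) :
    Matrix (Fin k) (Fin k) (ZMod 2) :=
  Matrix.of fun i j => addHilbert (p i) (p j : ℚ_[p i]) (-(n : ℚ_[p i]))

/-- The vector `(v_{p_1}(d), …, v_{p_k}(d))` over `𝔽₂`. -/
def valuationVector {k : ℕ} (p : Fin k → ℕ) (d : ℕ) : Fin k → ZMod 2 :=
  fun i => (padicValNat (p i) d : ZMod 2)

/-! The Selmer conditions for `E` and for its twist by n are compared place by place. The
coprimality and residue conditions make the comparison almost trivial away from n. Over ℝ and at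
every prime q dividing e₁e₂e₃ (2 is always one of them) n and each p_i are squares, so the twist has
the same local condition as `E`, and divisors of n are locally trivial. At any other q not dividing
n both curves have good reduction, and the condition is that all valuations be even
(`HasPoint.even_valuation`, `hasPoint_of_even_valuation`).

At p_i, reciprocity makes e₁, e₂, e₃ and -1 local squares. The local Kummer image of the twist is
then the image of its 2-torsion, namely the triples of product one with entries in {1, n}
(`hasPoint_twist_ramified_iff`). Up to squares, {1, n} is also the kernel of [·, -n] at p_i
(`Padic.addHilbert_eq_zero_iff`). Since the symbol is additive, a triple of divisors of n with
square product and valuation vectors x, y, x + y is Selmer if and only if A_n x = 0 and A_n y = 0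
(`divisorClass_mem_selmer_iff`).

Every class modulo torsion arises in this way. Multiplying a Selmer class of the twist by a triple
of divisors that corrects its parities at the p_i gives a Selmer class of `E`
(`mul_divisorClass_mem_selmer`). As `E` has no point of order 4, its four 2-torsion classes are
distinct and fill the Selmer group of order 4. Torsion classes of the twist differ from those of `E`
only by triples with entries in {1, n}, which are again triples of divisors.

The representation is unique because the torsion classes of `E` are unramified at the p_i. If a
divisor triple is a torsion class of the twist, moving the factors n across makes a divisor triple
equal to a torsion class of `E`, which forces both to be trivial. -/

/-! ### Halving points on curves with full rational `2`-torsion -/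

/-- The curve `y² = (x - α) (x - β) (x - γ)`. -/
def cubicCurve {K : Type*} [Field K] (α β γ : K) : WeierstrassCurve K where
  a₁ := 0
  a₂ := -(α + β + γ)
  a₃ := 0
  a₄ := α * β + β * γ + γ * α
  a₆ := -(α * β * γ)

theorem TwoTorsionTriple.curve_eq_cubicCurve (E : TwoTorsionTriple) (K : Type*) [Field K] :
    E.curve K = cubicCurve (-(E.e₂ : K)) (E.e₁ : K) 0 := by
  simp only [TwoTorsionTriple.curve, cubicCurve, WeierstrassCurve.mk.injEq, true_and]
  refine ⟨?_, ?_, ?_⟩ <;> ring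

namespace cubicCurve

variable {K : Type*} [Field K] {α β γ : K}

theorem equation_iff {x y : K} : (cubicCurve α β γ).toAffine.Equation x y ↔
    y ^ 2 = (x - α) * (x - β) * (x - γ) := by
  rw [Affine.equation_iff]
  simp only [cubicCurve]
  constructor <;> intro h <;> linear_combination h

theorem nonsingular (h2 : (2 : K) ≠ 0) (hαβ : α ≠ β) (hαγ : α ≠ γ) (hβγ : β ≠ γ) {x y : K}
    (h : y ^ 2 = (x - α) * (x - β) * (x - γ)) : (cubicCurve α β γ).toAffine.Nonsingular x y := by
  refine (Affine.equation_iff_nonsingular_of_Δ_ne_zero ?_).1 (equation_iff.2 h)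
  have : (cubicCurve α β γ).Δ = 2 ^ 4 * ((α - β) * (α - γ) * (β - γ)) ^ 2 := by
    simp only [WeierstrassCurve.Δ, WeierstrassCurve.b₂, WeierstrassCurve.b₄,
      WeierstrassCurve.b₆, WeierstrassCurve.b₈, cubicCurve]
    ring
  rw [this]
  exact mul_ne_zero (pow_ne_zero _ h2) (pow_ne_zero _ (mul_ne_zero (mul_ne_zero (sub_ne_zero.2 hαβ)
    (sub_ne_zero.2 hαγ)) (sub_ne_zero.2 hβγ)))

/-- The classical halving formula. With X = x + ab + bc + ca the differences factor as X - α = (a +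
b)(a + c) and so on, and the tangent there has slope a + b + c. The sums a + b, a + c, b + c are
nonzero because the roots are distinct. -/
theorem exists_add_self_eq_some [DecidableEq K] (h2 : (2 : K) ≠ 0) (hαβ : α ≠ β) (hαγ : α ≠ γ)
    (hβγ : β ≠ γ) {x y a b c : K} (h : (cubicCurve α β γ).toAffine.Nonsingular x y)
    (ha : x - α = a ^ 2) (hb : x - β = b ^ 2) (hc : x - γ = c ^ 2) (hy : y = a * b * c) :
    ∃ Q : (cubicCurve α β γ).toAffine.Point, Q + Q = .some x y h := by
  have nab : a + b ≠ 0 := fun h0 => hαβ (by linear_combination hb - ha + (b - a) * h0)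
  have nac : a + c ≠ 0 := fun h0 => hαγ (by linear_combination hc - ha + (c - a) * h0)
  have nbc : b + c ≠ 0 := fun h0 => hβγ (by linear_combination hc - hb + (c - b) * h0)
  set X := x + a * b + b * c + c * a with hX
  set Y := (a + b) * (b + c) * (a + c) with hY
  have hY0 : Y ≠ 0 := mul_ne_zero (mul_ne_zero nab nbc) nac
  have A : X - α = (a + b) * (a + c) := by rw [hX]; linear_combination ha
  have B : X - β = (a + b) * (b + c) := by rw [hX]; linear_combination hb
  have C : X - γ = (a + c) * (b + c) := by rw [hX]; linear_combination hc
  have hXY : Y ^ 2 = (X - α) * (X - β) * (X - γ) := by rw [A, B, C]; ring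
  have hne : Y ≠ (cubicCurve α β γ).toAffine.negY X Y := by
    simp only [Affine.negY, cubicCurve]
    intro h0
    exact mul_ne_zero h2 hY0 (by linear_combination h0)
  have hs : (cubicCurve α β γ).toAffine.slope X X Y Y = a + b + c := by
    rw [Affine.slope_of_Y_ne rfl hne, div_eq_iff (sub_ne_zero.2 hne)]
    simp only [Affine.negY, cubicCurve]
    have hα : α = x - a ^ 2 := by linear_combination -ha
    have hβ : β = x - b ^ 2 := by linear_combination -hb
    have hγ : γ = x - c ^ 2 := by linear_combination -hc
    rw [hα, hβ, hγ, hY, hX]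
    ring
  have hx : (cubicCurve α β γ).toAffine.addX X X (a + b + c) = x := by
    simp only [Affine.addX, cubicCurve]
    rw [hX]
    linear_combination -ha - hb - hc
  refine ⟨.some X Y (nonsingular h2 hαβ hαγ hβγ hXY), ?_⟩
  rw [Affine.Point.add_self_of_Y_ne hne]
  simp only [hs, Affine.Point.some.injEq, Affine.addY, hx, true_and, Affine.negY, Affine.negAddY]
  simp only [cubicCurve]
  rw [hX, hY, hy]
  ring

theorem kummerComponent_add [DecidableEq K] (hαβ : α ≠ β) (hαγ : α ≠ γ) (hβγ : β ≠ γ)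
    (P Q : (cubicCurve α β γ).toAffine.Point) :
    kummerComponent (cubicCurve α β γ) α β γ (P + Q) =
        kummerComponent (cubicCurve α β γ) α β γ P * kummerComponent (cubicCurve α β γ) α β γ Q ∧
    kummerComponent (cubicCurve α β γ) β α γ (P + Q) =
        kummerComponent (cubicCurve α β γ) β α γ P * kummerComponent (cubicCurve α β γ) β α γ Q :=
  ⟨_root_.kummerComponent_add _ rfl rfl rfl rfl rfl hαβ hαγ _ _,
    _root_.kummerComponent_add _ rfl (by simp only [cubicCurve]; ring) rfl
      (by simp only [cubicCurve]; ring) (by simp only [cubicCurve]; ring) hαβ.symm hβγ _ _⟩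

/-- If two Kummer components have the classes of `d` and `d'`, then the coordinates of the point
have the expected shape. -/
theorem exists_sq_of_kummerComponent [DecidableEq K] (hαβ : α ≠ β) (hαγ : α ≠ γ) (hβγ : β ≠ γ)
    {x y d d' d'' s : K} (hd : d ≠ 0) (hd' : d' ≠ 0) (hd'' : d'' ≠ 0) (hs : d * d' * d'' = s ^ 2)
    (h : (cubicCurve α β γ).toAffine.Nonsingular x y)
    (h₁ : kummerComponent (cubicCurve α β γ) α β γ (.some x y h) = sqClass d)
    (h₂ : kummerComponent (cubicCurve α β γ) β α γ (.some x y h) = sqClass d') :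
    ∃ a b c : K, x - α = d * a ^ 2 ∧ x - β = d' * b ^ 2 ∧ x - γ = d'' * c ^ 2 := by
  obtain ⟨a, ha⟩ := kummer_eq_aux' (x := x) (α := α) hd (fun _ => h₁)
  obtain ⟨b, hb⟩ := kummer_eq_aux' (x := x) (α := β) hd' (fun _ => h₂)
  have hy := equation_iff.1 h.1
  refine ⟨a, b, ?_⟩
  simp only [ha, hb, true_and]
  have hsd : d * d' ≠ 0 := mul_ne_zero hd hd'
  simp only [kummerComponent] at h₁ h₂
  by_cases c1 : x = α
  · rw [if_pos c1, sqClass_eq_iff (mul_ne_zero (sub_ne_zero.2 hαβ) (sub_ne_zero.2 hαγ)) hd] at h₁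
    obtain ⟨e, he⟩ := h₁
    subst c1
    have hb0 : b ≠ 0 := by
      rintro rfl
      exact hαβ (by linear_combination hb)
    -- At the root, (α - β)(α - γ) = d e². Dividing by α - β = d' b² and using d d' d'' = s² gives α
    -- - γ = d'' c² for this c.
    refine ⟨e * d / (b * s), ?_⟩
    have hs0 : s ≠ 0 := by
      rintro rfl
      exact mul_ne_zero hsd hd'' (by simpa using hs)
    rw [hb] at he
    field_simp
    refine mul_left_cancel₀ hd' ?_
    linear_combination s ^ 2 * he - d * e ^ 2 * hs
  by_cases c2 : x = β
  · rw [if_pos c2, sqClass_eq_iff (mul_ne_zero (sub_ne_zero.2 hαβ.symm) (sub_ne_zero.2 hβγ)) hd']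
      at h₂
    obtain ⟨e, he⟩ := h₂
    subst c2
    have ha0 : a ≠ 0 := by
      rintro rfl
      exact hαβ (by linear_combination -ha)
    refine ⟨e * d' / (a * s), ?_⟩
    have hs0 : s ≠ 0 := by
      rintro rfl
      exact mul_ne_zero hsd hd'' (by simpa using hs)
    rw [ha] at he
    field_simp
    refine mul_left_cancel₀ hd ?_
    linear_combination s ^ 2 * he - d' * e ^ 2 * hs
  · have ha0 : a ≠ 0 := by
      rintro rfl
      exact c1 (by linear_combination ha)
    have hb0 : b ≠ 0 := by
      rintro rfl
      exact c2 (by linear_combination hb)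
    have hs0 : s ≠ 0 := by
      rintro rfl
      exact mul_ne_zero hsd hd'' (by simpa using hs)
    rw [ha, hb] at hy
    refine ⟨y / (a * b * s), ?_⟩
    field_simp
    linear_combination -d'' * hy - a ^ 2 * b ^ 2 * (x - γ) * hs

/-- Two trivial components suffice, since the equation of the curve supplies the third. The sign in
y = ± abc is absorbed by replacing c with -c. -/
theorem exists_add_self_eq [DecidableEq K] (h2 : (2 : K) ≠ 0) (hαβ : α ≠ β) (hαγ : α ≠ γ)
    (hβγ : β ≠ γ) (P : (cubicCurve α β γ).toAffine.Point)
    (h₁ : kummerComponent (cubicCurve α β γ) α β γ P = 1)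
    (h₂ : kummerComponent (cubicCurve α β γ) β α γ P = 1) :
    ∃ Q : (cubicCurve α β γ).toAffine.Point, Q + Q = P := by
  rcases P with _ | ⟨x, y, hP⟩
  · exact ⟨0, add_zero 0⟩
  rw [← sqClass_one] at h₁ h₂
  obtain ⟨a, b, c, ha, hb, hc⟩ := exists_sq_of_kummerComponent hαβ hαγ hβγ (d'' := 1) (s := 1)
    one_ne_zero one_ne_zero one_ne_zero (by simp) hP h₁ h₂
  rw [one_mul] at ha hb hc
  have hy := equation_iff.1 hP.1
  rw [ha, hb, hc, ← mul_pow, ← mul_pow, sq_eq_sq_iff_eq_or_eq_neg] at hy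
  rcases hy with hy | hy
  · exact exists_add_self_eq_some h2 hαβ hαγ hβγ hP ha hb hc hy
  · exact exists_add_self_eq_some h2 hαβ hαγ hβγ hP (a := a) (b := b) (c := -c) ha hb
      (by rw [hc]; ring) (by rw [hy]; ring)

end cubicCurve

/-! ### Curves over finite fields -/

theorem SqClass.finite_of_finite (F : Type*) [Field F] [Finite F] : Finite (SqClass F) :=
  inferInstanceAs (Finite (Fˣ ⧸ (powMonoidHom 2 : Fˣ →* Fˣ).range))

theorem SqClass.card_le_two (F : Type*) [Field F] [Finite F] : Nat.card (SqClass F) ≤ 2 := by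
  have h : (powMonoidHom 2 : Fˣ →* Fˣ).range.index = (Nat.card Fˣ).gcd 2 :=
    IsCyclic.index_powMonoidHom_range _ 2
  have : Nat.card (SqClass F) = (powMonoidHom 2 : Fˣ →* Fˣ).range.index := rfl
  rw [this, h]
  exact Nat.gcd_le_right _ two_pos

namespace cubicCurve

theorem finite_point {F : Type*} [Field F] [Finite F] (W : WeierstrassCurve F) :
    Finite W.toAffine.Point := by
  refine Finite.of_injective (β := Option (F × F))
    (fun P => match P with
      | .zero => none
      | .some x y _ => some (x, y)) ?_
  rintro (_ | ⟨x, y, h⟩) (_ | ⟨x', y', h'⟩) hPQ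
  · rfl
  · simp at hPQ
  · simp at hPQ
  · simp only [Option.some.injEq, Prod.mk.injEq] at hPQ
    obtain ⟨rfl, rfl⟩ := hPQ
    rfl

/-- For a finite abelian group `G` with at least four `2`-torsion elements and a homomorphism from
`G` to a group `H` of order at most four whose kernel consists of squares, that homomorphism is
surjective. -/
theorem _root_.MonoidHom.surjective_of_ker_le_sq {G H : Type*} [CommGroup G] [Finite G] [Group H]
    [Finite H] (f : G →* H) (hH : Nat.card H ≤ 4) (hf : ∀ g, f g = 1 → ∃ q, q * q = g)
    (h4 : 4 ≤ Nat.card (powMonoidHom 2 : G →* G).ker) : Function.Surjective f := by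
  -- |G| = |G[2]|·|G²| = |ker f|·|im f| and ker f ⊆ G², so |im f| ≥ |G[2]| ≥ 4 ≥ |H|.
  have h1 : Nat.card (powMonoidHom 2 : G →* G).ker * Nat.card (powMonoidHom 2 : G →* G).range
      = Nat.card G := by
    rw [← Subgroup.index_ker, Subgroup.card_mul_index]
  have h2 : Nat.card f.ker * Nat.card f.range = Nat.card G := by
    rw [← Subgroup.index_ker, Subgroup.card_mul_index]
  have h3 : Nat.card f.ker ≤ Nat.card (powMonoidHom 2 : G →* G).range := by
    refine Nat.card_le_card_of_injective (Subgroup.inclusion ?_) (Subgroup.inclusion_injective _)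
    intro g hg
    obtain ⟨q, hq⟩ := hf g hg
    exact ⟨q, by simpa [pow_two] using hq⟩
  have h5 : 4 ≤ Nat.card f.range := by
    have hpos : 0 < Nat.card f.ker := Nat.card_pos
    by_contra! hlt
    nlinarith
  rw [← MonoidHom.range_eq_top]
  refine Subgroup.eq_top_of_card_eq _ (le_antisymm (Subgroup.card_le_card_group _) (hH.trans h5))

variable {F : Type*} [Field F] {α β γ : F}

/-- Two components of the Kummer map, as a homomorphism. -/
noncomputable def kummerPair [DecidableEq F] (hαβ : α ≠ β) (hαγ : α ≠ γ) (hβγ : β ≠ γ) :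
    Multiplicative (cubicCurve α β γ).toAffine.Point →* SqClass F × SqClass F :=
  MonoidHom.mk' (fun P => (kummerComponent (cubicCurve α β γ) α β γ P.toAdd,
      kummerComponent (cubicCurve α β γ) β α γ P.toAdd)) fun P Q =>
    Prod.ext (kummerComponent_add hαβ hαγ hβγ P.toAdd Q.toAdd).1
      (kummerComponent_add hαβ hαγ hβγ P.toAdd Q.toAdd).2

theorem add_self_of_y_eq_zero [DecidableEq F] {x : F}
    (h : (cubicCurve α β γ).toAffine.Nonsingular x 0) :
    Affine.Point.some x 0 h + Affine.Point.some x 0 h = 0 :=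
  Affine.Point.add_self_of_Y_eq (by simp [Affine.negY, cubicCurve])

theorem four_le_card_two_torsion [Finite F] [DecidableEq F] (h2 : (2 : F) ≠ 0) (hαβ : α ≠ β)
    (hαγ : α ≠ γ) (hβγ : β ≠ γ) :
    4 ≤ Nat.card (powMonoidHom 2 : Multiplicative (cubicCurve α β γ).toAffine.Point →* _).ker := by
  have := finite_point (cubicCurve α β γ)
  have hns (x : F) (hx : (x - α) * (x - β) * (x - γ) = 0) :
      (cubicCurve α β γ).toAffine.Nonsingular x 0 :=
    nonsingular h2 hαβ hαγ hβγ (by rw [hx]; ring)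
  have hker (x : F) (h : (cubicCurve α β γ).toAffine.Nonsingular x 0) :
      Multiplicative.ofAdd (Affine.Point.some x 0 h) ∈
        (powMonoidHom 2 : Multiplicative (cubicCurve α β γ).toAffine.Point →* _).ker := by
    rw [MonoidHom.mem_ker, powMonoidHom_apply, pow_two, ← ofAdd_add, add_self_of_y_eq_zero h]
    rfl
  let f : Fin 4 → (powMonoidHom 2 : Multiplicative (cubicCurve α β γ).toAffine.Point →* _).ker :=
    ![1, ⟨_, hker α (hns α (by ring))⟩, ⟨_, hker β (hns β (by ring))⟩,
      ⟨_, hker γ (hns γ (by ring))⟩]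
  have hf : Function.Injective f := by
    have n0 (x : F) (h : (cubicCurve α β γ).toAffine.Nonsingular x 0) :
        (1 : Multiplicative (cubicCurve α β γ).toAffine.Point) ≠
          Multiplicative.ofAdd (Affine.Point.some x 0 h) :=
      fun h' => Affine.Point.some_ne_zero h (congrArg Multiplicative.toAdd h').symm
    have n1 (x x' : F) (hx : x ≠ x') (h : (cubicCurve α β γ).toAffine.Nonsingular x 0)
        (h' : (cubicCurve α β γ).toAffine.Nonsingular x' 0) :
        Multiplicative.ofAdd (Affine.Point.some x 0 h) ≠
          Multiplicative.ofAdd (Affine.Point.some x' 0 h') := by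
      intro h0
      have := congrArg Multiplicative.toAdd h0
      simp only [toAdd_ofAdd, Affine.Point.some.injEq] at this
      exact hx this.1
    intro i j hij
    have hij' := congrArg Subtype.val hij
    fin_cases i <;> fin_cases j <;> first | rfl | exfalso
    · exact n0 _ _ hij'
    · exact n0 _ _ hij'
    · exact n0 _ _ hij'
    · exact n0 _ _ hij'.symm
    · exact n1 _ _ hαβ _ _ hij'
    · exact n1 _ _ hαγ _ _ hij'
    · exact n0 _ _ hij'.symm
    · exact n1 _ _ hαβ.symm _ _ hij'
    · exact n1 _ _ hβγ _ _ hij'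
    · exact n0 _ _ hij'.symm
    · exact n1 _ _ hαγ.symm _ _ hij'
    · exact n1 _ _ hβγ.symm _ _ hij'
  simpa using Nat.card_le_card_of_injective f hf

/-- Every `2`-covering of a curve with full rational `2`-torsion over a finite field of odd
characteristic has a rational point. -/
theorem exists_point_of_finite [Finite F] (h2 : (2 : F) ≠ 0) (hαβ : α ≠ β) (hαγ : α ≠ γ)
    (hβγ : β ≠ γ) {d₁ d₂ d₃ : F} (h₁ : d₁ ≠ 0) (h₂ : d₂ ≠ 0) (h₃ : d₃ ≠ 0)
    (hd : IsSquare (d₁ * d₂ * d₃)) :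
    (IsSquare d₁ ∧ IsSquare d₂ ∧ IsSquare d₃) ∨ ∃ x a b c : F,
      x - α = d₁ * a ^ 2 ∧ x - β = d₂ * b ^ 2 ∧ x - γ = d₃ * c ^ 2 := by
  classical
  have := finite_point (cubicCurve α β γ)
  have := SqClass.finite_of_finite F
  -- The kernel of the Kummer map consists of doubles and its target has order at most 4, so the
  -- count of 2-torsion makes it surjective. A preimage at infinity accounts for the alternative
  -- that all dᵢ are squares.
  have hsurj := (kummerPair hαβ hαγ hβγ).surjective_of_ker_le_sq (by
    rw [Nat.card_prod]
    exact Nat.mul_le_mul (SqClass.card_le_two F) (SqClass.card_le_two F)) (by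
    intro P hP
    obtain ⟨Q, hQ⟩ := exists_add_self_eq h2 hαβ hαγ hβγ P.toAdd (congrArg Prod.fst hP)
      (congrArg Prod.snd hP)
    exact ⟨Multiplicative.ofAdd Q, by rw [← ofAdd_add, hQ]; rfl⟩)
    (four_le_card_two_torsion h2 hαβ hαγ hβγ)
  obtain ⟨s, hs⟩ := hd
  obtain ⟨P, hP⟩ := hsurj (sqClass d₁, sqClass d₂)
  obtain ⟨P, rfl⟩ := Multiplicative.ofAdd.surjective P
  have hP1 := congrArg Prod.fst hP
  have hP2 := congrArg Prod.snd hP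
  rcases P with _ | ⟨x, y, h⟩
  · left
    obtain ⟨a, ha⟩ := (sqClass_eq_one_iff h₁).1 hP1.symm
    obtain ⟨b, hb⟩ := (sqClass_eq_one_iff h₂).1 hP2.symm
    refine ⟨⟨a, by rw [ha, pow_two]⟩, ⟨b, by rw [hb, pow_two]⟩, s / (a * b), ?_⟩
    have ha0 : a ≠ 0 := by rintro rfl; simp at ha; exact h₁ ha
    have hb0 : b ≠ 0 := by rintro rfl; simp at hb; exact h₂ hb
    rw [ha, hb] at hs
    field_simp
    linear_combination hs
  · right
    obtain ⟨a, b, c, h⟩ := exists_sq_of_kummerComponent hαβ hαγ hβγ h₁ h₂ h₃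
      (by rw [hs, pow_two]) h hP1 hP2
    exact ⟨x, a, b, c, h⟩

end cubicCurve

/-! ### Squares and square classes in `ℚ_p` -/

namespace PadicInt

variable {p : ℕ} [Fact p.Prime]

theorem toZMod_surjective : Function.Surjective (toZMod : ℤ_[p] →+* ZMod p) := fun a =>
  ⟨(a.val : ℤ_[p]), by simp⟩

theorem toZMod_eq_zero_iff {x : ℤ_[p]} : toZMod x = 0 ↔ (p : ℤ_[p]) ∣ x := by
  rw [← RingHom.mem_ker, ker_toZMod, maximalIdeal_eq_span_p, Ideal.mem_span_singleton]

theorem exists_coe_eq {x : ℚ_[p]} (h : ‖x‖ ≤ 1) : ∃ u : ℤ_[p], (u : ℚ_[p]) = x :=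
  ⟨⟨x, h⟩, rfl⟩

theorem not_dvd_of_norm_coe {u : ℤ_[p]} (h : ‖(u : ℚ_[p])‖ = 1) : ¬ (p : ℤ_[p]) ∣ u := by
  rw [← norm_lt_one_iff_dvd, norm_def]
  exact h.not_lt

theorem dvd_of_dvd_sq {x : ℤ_[p]} (h : (p : ℤ_[p]) ∣ x ^ 2) : (p : ℤ_[p]) ∣ x :=
  prime_p.dvd_of_dvd_pow h

theorem dvd_of_dvd_mul_sq {a x : ℤ_[p]} (ha : ¬ (p : ℤ_[p]) ∣ a) (h : (p : ℤ_[p]) ∣ a * x ^ 2) :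
    (p : ℤ_[p]) ∣ x :=
  dvd_of_dvd_sq ((prime_p.dvd_or_dvd h).resolve_left ha)

theorem norm_eq_one_of_not_dvd {x : ℤ_[p]} (h : ¬ (p : ℤ_[p]) ∣ x) : ‖x‖ = 1 :=
  le_antisymm x.norm_le_one (not_lt.1 fun h' => h ((norm_lt_one_iff_dvd x).1 h'))

theorem ne_zero_of_not_dvd {x : ℤ_[p]} (h : ¬ (p : ℤ_[p]) ∣ x) : x ≠ 0 := by
  rintro rfl
  exact h (dvd_zero _)

theorem not_dvd_intCast {a : ℤ} (h : ¬ (p : ℤ) ∣ a) : ¬ (p : ℤ_[p]) ∣ (a : ℤ_[p]) := by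
  rw [← norm_lt_one_iff_dvd, norm_int_lt_one_iff_dvd]
  exact h

/-- A `p`-adic unit with square residue is a square, for `p` odd. -/
theorem isSquare_of_toZMod (hp : p ≠ 2) {u : ℤ_[p]} (hu : ¬ (p : ℤ_[p]) ∣ u)
    (h : IsSquare (toZMod u)) : IsSquare u := by
  obtain ⟨b, hb⟩ := h
  obtain ⟨a, rfl⟩ := toZMod_surjective b
  have ha : ¬ (p : ℤ_[p]) ∣ a := by
    rw [← toZMod_eq_zero_iff] at hu ⊢
    intro h0
    exact hu (by rw [hb, h0, mul_zero])
  have h2 : ¬ (p : ℤ_[p]) ∣ 2 := by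
    have := not_dvd_intCast (p := p) (a := 2) (by
      intro h
      have := (Nat.prime_dvd_prime_iff_eq Fact.out Nat.prime_two).1 (by exact_mod_cast h)
      exact hp this)
    simpa using this
  have h2a : ‖(2 : ℤ_[p]) * a‖ = 1 :=
    norm_eq_one_of_not_dvd fun h => (prime_p.dvd_or_dvd h).elim h2 ha
  have hF : ‖a ^ 2 - u‖ < 1 := by
    rw [norm_lt_one_iff_dvd, ← toZMod_eq_zero_iff, map_sub, map_pow, hb, pow_two, sub_self]
  obtain ⟨z, hz, -⟩ := hensels_lemma (p := p) (F := (Polynomial.X ^ 2 - Polynomial.C u :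
    Polynomial ℤ_[p])) (a := a) (by simpa [h2a, one_add_one_eq_two] using hF)
  refine ⟨z, ?_⟩
  simp only [map_sub, map_pow, Polynomial.aeval_X, Polynomial.aeval_C, Algebra.algebraMap_self,
    RingHom.id_apply] at hz
  linear_combination -hz

/-- Hensel's lemma for X² - n at 1: |1 - n| ≤ 1/8 is smaller than |2|² = 1/4. -/
theorem isSquare_natCast_two {n : ℕ} (hn : n ≡ 1 [MOD 8]) : IsSquare (n : ℤ_[2]) := by
  have hF : ‖(1 : ℤ_[2]) - n‖ ≤ (2 : ℝ) ^ (-(3 : ℕ) : ℤ) := by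
    have : ((2 : ℤ) ^ 3) ∣ 1 - n := (Nat.modEq_iff_dvd.1 hn)
    have := (norm_int_le_pow_iff_dvd (p := 2) (k := 1 - n) (n := 3)).2 this
    push_cast at this ⊢
    exact this
  have h2 : ‖(2 : ℤ_[2])‖ = 2⁻¹ := by simpa using norm_p (p := 2)
  obtain ⟨z, hz, -⟩ := hensels_lemma (p := 2) (F := (Polynomial.X ^ 2 - Polynomial.C (n : ℤ_[2]) :
    Polynomial ℤ_[2])) (a := 1) (by
      have : ‖(1 : ℤ_[2]) - n‖ < ‖(2 : ℤ_[2])‖ ^ 2 := by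
        rw [h2]
        refine hF.trans_lt ?_
        norm_num
      simpa [one_add_one_eq_two] using this)
  refine ⟨z, ?_⟩
  simp only [map_sub, map_pow, Polynomial.aeval_X, Polynomial.aeval_C, Algebra.algebraMap_self,
    RingHom.id_apply] at hz
  linear_combination -hz

/-- The product u d has residue (d a)², so it is a square z², and u = d (z / d)². -/
theorem exists_eq_mul_sq (hp : p ≠ 2) {u d : ℤ_[p]} (hu : ¬ (p : ℤ_[p]) ∣ u)
    (hd : ¬ (p : ℤ_[p]) ∣ d) {a : ZMod p} (h : toZMod u = toZMod d * a ^ 2) :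
    ∃ v : ℚ_[p], (u : ℚ_[p]) = d * v ^ 2 := by
  obtain ⟨z, hz⟩ := isSquare_of_toZMod hp (u := u * d)
    (fun h => (prime_p.dvd_or_dvd h).elim hu hd) ⟨toZMod d * a, by rw [map_mul, h]; ring⟩
  have hd0 : (d : ℚ_[p]) ≠ 0 := coe_ne_zero.2 (ne_zero_of_not_dvd hd)
  refine ⟨z / d, ?_⟩
  have := congrArg ((↑) : ℤ_[p] → ℚ_[p]) hz
  simp only [coe_mul] at this
  field_simp
  linear_combination this

theorem isSquare_of_isSquare_coe {u : ℤ_[p]} (h : IsSquare (u : ℚ_[p])) : IsSquare u := by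
  obtain ⟨s, hs⟩ := h
  have h1 : ‖s‖ ≤ 1 := by
    have := congrArg norm hs
    rw [norm_mul] at this
    have h2 : ‖(u : ℚ_[p])‖ ≤ 1 := u.2
    nlinarith [norm_nonneg s]
  exact ⟨⟨s, h1⟩, PadicInt.ext hs⟩

/-- A nonzero vector over `ℚ_p` is proportional to a primitive integral one. -/
theorem exists_primitive {ι : Type*} [Finite ι] (f : ι → ℚ_[p]) (hf : ∃ i, f i ≠ 0) :
    ∃ (c : ℚ_[p]) (g : ι → ℤ_[p]), c ≠ 0 ∧ (∀ i, (g i : ℚ_[p]) = c * f i) ∧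
      ∃ i, ¬ (p : ℤ_[p]) ∣ g i := by
  obtain ⟨i₀, hi₀⟩ := hf
  have : Nonempty ι := ⟨i₀⟩
  obtain ⟨j, hj⟩ := Finite.exists_max fun i => ‖f i‖
  have hj0 : f j ≠ 0 := by
    intro h0
    have := hj i₀
    rw [h0, norm_zero] at this
    exact hi₀ (norm_le_zero_iff.1 this)
  have hle (i : ι) : ‖(f j)⁻¹ * f i‖ ≤ 1 := by
    rw [norm_mul, norm_inv, inv_mul_le_iff₀ (norm_pos_iff.2 hj0), mul_one]
    exact hj i
  choose g hg using fun i => exists_coe_eq (hle i)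
  refine ⟨(f j)⁻¹, g, inv_ne_zero hj0, hg, j, not_dvd_of_norm_coe ?_⟩
  rw [hg, inv_mul_cancel₀ hj0, norm_one]

end PadicInt

namespace Padic

variable {p : ℕ} [Fact p.Prime]

/-- Every nonzero `p`-adic number is `u` or `p u` up to squares, for a `p`-adic unit `u`. -/
theorem exists_unit_mul_sq {d : ℚ_[p]} (hd : d ≠ 0) : ∃ (u : ℤ_[p]) (c : ℚ_[p]), c ≠ 0 ∧
    ¬ (p : ℤ_[p]) ∣ u ∧ (Even d.valuation ∧ d = u * c ^ 2 ∨
      ¬ Even d.valuation ∧ d = p * u * c ^ 2) := by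
  have hp0 : (p : ℚ_[p]) ≠ 0 := by exact_mod_cast (Fact.out : p.Prime).ne_zero
  have hp0' : (p : ℝ) ≠ 0 := by exact_mod_cast (Fact.out : p.Prime).ne_zero
  have hnorm : ‖d * (p : ℚ_[p]) ^ (-d.valuation)‖ = 1 := by
    rw [norm_mul, norm_p_zpow, norm_eq_zpow_neg_valuation hd, ← zpow_add₀ hp0']
    simp
  obtain ⟨u, hu⟩ := PadicInt.exists_coe_eq hnorm.le
  have hu' : ¬ (p : ℤ_[p]) ∣ u := PadicInt.not_dvd_of_norm_coe (hu ▸ hnorm)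
  rcases Int.even_or_odd d.valuation with h | h
  · obtain ⟨k, hk⟩ := h
    refine ⟨u, (p : ℚ_[p]) ^ k, zpow_ne_zero _ hp0, hu', Or.inl ⟨⟨k, hk⟩, ?_⟩⟩
    rw [hu, pow_two, ← zpow_add₀ hp0, ← hk, mul_assoc, ← zpow_add₀ hp0]
    simp
  · obtain ⟨k, hk⟩ := id h
    refine ⟨u, (p : ℚ_[p]) ^ k, zpow_ne_zero _ hp0, hu', Or.inr ⟨Int.not_even_iff_odd.2 h, ?_⟩⟩
    rw [hu, pow_two, ← zpow_add₀ hp0, mul_comm (p : ℚ_[p]), mul_assoc, mul_assoc,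
      ← zpow_one_add₀ hp0, show 1 + (k + k) = d.valuation by lia, ← zpow_add₀ hp0]
    simp

theorem even_valuation_of_isSquare {d : ℚ_[p]} (h : IsSquare d) : Even d.valuation := by
  obtain ⟨c, rfl⟩ := h
  by_cases hc : c = 0
  · simp [hc]
  · rw [valuation_mul hc hc]
    exact ⟨_, rfl⟩

theorem isSquare_intCast (hp : p ≠ 2) {a : ℤ} (ha : ¬ (p : ℤ) ∣ a) (h : IsSquare (a : ZMod p)) :
    IsSquare (a : ℚ_[p]) := by
  have := PadicInt.isSquare_of_toZMod hp (u := (a : ℤ_[p])) (PadicInt.not_dvd_intCast ha)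
    (by rwa [map_intCast])
  simpa using this.map (PadicInt.Coe.ringHom (p := p))

end Padic

/-! ### Local solubility of the homogeneous spaces -/

theorem isSquare_iff_sqClass {K : Type*} [Field K] {a : K} (ha : a ≠ 0) :
    IsSquare a ↔ sqClass a = 1 := by
  rw [sqClass_eq_one_iff ha, isSquare_iff_exists_sq]

theorem sqClass_sq {K : Type*} [Field K] (c : K) : sqClass (c ^ 2) = 1 := by
  by_cases hc : c = 0
  · simp [hc, sqClass]
  · exact (sqClass_eq_one_iff (pow_ne_zero _ hc)).2 ⟨c, rfl⟩

theorem sqClass_mul_sq {K : Type*} [Field K] {a c : K} (ha : a ≠ 0) (hc : c ≠ 0) :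
    sqClass (a * c ^ 2) = sqClass a := by
  rw [sqClass_mul ha (pow_ne_zero _ hc), sqClass_sq, mul_one]

theorem sqClass_mul_isSquare {K : Type*} [Field K] {a b : K} (ha : a ≠ 0) (hb : b ≠ 0)
    (h : IsSquare b) : sqClass (a * b) = sqClass a := by
  rw [sqClass_mul ha hb, (isSquare_iff_sqClass hb).1 h, mul_one]

theorem sqClass_map {K L : Type*} [Field K] [Field L] (f : K →+* L) {a b : K} (ha : a ≠ 0)
    (hb : b ≠ 0) (h : sqClass a = sqClass b) : sqClass (f a) = sqClass (f b) := by
  obtain ⟨c, hc⟩ := (sqClass_eq_iff ha hb).1 h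
  exact (sqClass_eq_iff (by simpa using ha) (by simpa using hb)).2 ⟨f c, by rw [hc]; simp⟩

namespace TwoTorsionTriple

variable (E : TwoTorsionTriple)

theorem HasPoint.congr {E : TwoTorsionTriple} {K : Type*} [Field K] {a₁ a₂ a₃ b₁ b₂ b₃ : K}
    (ha₁ : a₁ ≠ 0) (ha₂ : a₂ ≠ 0) (ha₃ : a₃ ≠ 0) (hb₁ : b₁ ≠ 0) (hb₂ : b₂ ≠ 0) (hb₃ : b₃ ≠ 0)
    (h₁ : sqClass a₁ = sqClass b₁) (h₂ : sqClass a₂ = sqClass b₂) (h₃ : sqClass a₃ = sqClass b₃)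
    (H : E.HasPoint a₁ a₂ a₃) : E.HasPoint b₁ b₂ b₃ := by
  obtain ⟨c₁, rfl⟩ := (sqClass_eq_iff ha₁ hb₁).1 h₁
  obtain ⟨c₂, rfl⟩ := (sqClass_eq_iff ha₂ hb₂).1 h₂
  obtain ⟨c₃, rfl⟩ := (sqClass_eq_iff ha₃ hb₃).1 h₃
  have hc₁ : c₁ ≠ 0 := by rintro rfl; simp at ha₁
  have hc₂ : c₂ ≠ 0 := by rintro rfl; simp at ha₂
  have hc₃ : c₃ ≠ 0 := by rintro rfl; simp at ha₃
  obtain ⟨t, u₁, u₂, u₃, hne, H1, H2, H3⟩ := H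
  refine ⟨t, c₁ * u₁, c₂ * u₂, c₃ * u₃, by simpa [hc₁, hc₂, hc₃] using hne, ?_, ?_, ?_⟩
  · linear_combination H1
  · linear_combination H2
  · linear_combination H3

theorem hasPoint_one (K : Type*) [Field K] : E.HasPoint (1 : K) 1 1 :=
  ⟨0, 1, 1, 1, by simp, by simp, by simp, by simp⟩

theorem hasPoint_of_isSquare {K : Type*} [Field K] {d₁ d₂ d₃ : K} (h₁ : d₁ ≠ 0) (h₂ : d₂ ≠ 0)
    (h₃ : d₃ ≠ 0) (hs₁ : IsSquare d₁) (hs₂ : IsSquare d₂) (hs₃ : IsSquare d₃) :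
    E.HasPoint d₁ d₂ d₃ := by
  refine (E.hasPoint_one K).congr one_ne_zero one_ne_zero one_ne_zero h₁ h₂ h₃ ?_ ?_ ?_ <;>
  rw [sqClass_one, eq_comm, ← isSquare_iff_sqClass] <;> assumption

/-- Twisting by a square does not change solubility. -/
theorem hasPoint_twist_iff {K : Type*} [Field K] (n : ℕ) (hn : n ≠ 0) (hK : (n : K) ≠ 0)
    (hs : IsSquare (n : K)) {d₁ d₂ d₃ : K} :
    (E.twist n hn).HasPoint d₁ d₂ d₃ ↔ E.HasPoint d₁ d₂ d₃ := by
  obtain ⟨r, hr⟩ := hs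
  have hr0 : r ≠ 0 := by rintro rfl; simp at hr; exact hK hr
  constructor
  · rintro ⟨t, u₁, u₂, u₃, hne, H1, H2, H3⟩
    simp only [twist, Int.cast_mul, Int.cast_natCast, hr] at H1 H2 H3
    refine ⟨r * t, u₁, u₂, u₃, by simpa [hr0] using hne, ?_, ?_, ?_⟩
    · linear_combination H1
    · linear_combination H2
    · linear_combination H3
  · rintro ⟨t, u₁, u₂, u₃, hne, H1, H2, H3⟩
    refine ⟨t / r, u₁, u₂, u₃, by simpa [hr0] using hne, ?_, ?_, ?_⟩ <;>
      simp only [twist, Int.cast_mul, Int.cast_natCast, hr]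
    · field_simp
      linear_combination H1
    · field_simp
      linear_combination H2
    · field_simp
      linear_combination H3

/-! ### Primes not dividing e₁e₂e₃: soluble means unramified -/

section Padic

variable {p : ℕ} [Fact p.Prime]

/-- A point on `D_Λ` over `ℚ_p`, for integral `Λ`, has primitive integral coordinates. -/
theorem HasPoint.exists_primitive {E : TwoTorsionTriple} {d₁ d₂ d₃ : ℤ_[p]}
    (H : E.HasPoint (d₁ : ℚ_[p]) d₂ d₃) : ∃ t u₁ u₂ u₃ : ℤ_[p],
      ¬ ((p : ℤ_[p]) ∣ t ∧ (p : ℤ_[p]) ∣ u₁ ∧ (p : ℤ_[p]) ∣ u₂ ∧ (p : ℤ_[p]) ∣ u₃) ∧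
      E.e₁ * t ^ 2 + d₂ * u₂ ^ 2 - d₃ * u₃ ^ 2 = 0 ∧
      E.e₂ * t ^ 2 + d₃ * u₃ ^ 2 - d₁ * u₁ ^ 2 = 0 ∧
      E.e₃ * t ^ 2 + d₁ * u₁ ^ 2 - d₂ * u₂ ^ 2 = 0 := by
  obtain ⟨t, u₁, u₂, u₃, hne, H1, H2, H3⟩ := H
  obtain ⟨c, g, hc, hg, hi⟩ := PadicInt.exists_primitive ![t, u₁, u₂, u₃] (by
    by_contra! h
    exact hne ⟨h 0, h 1, h 2, h 3⟩)
  have h0 : (g 0 : ℚ_[p]) = c * t := hg 0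
  have h1 : (g 1 : ℚ_[p]) = c * u₁ := hg 1
  have h2 : (g 2 : ℚ_[p]) = c * u₂ := hg 2
  have h3 : (g 3 : ℚ_[p]) = c * u₃ := hg 3
  refine ⟨g 0, g 1, g 2, g 3, ?_, ?_, ?_, ?_⟩
  · rintro ⟨i0, i1, i2, i3⟩
    obtain ⟨i, hi⟩ := hi
    fin_cases i
    exacts [hi i0, hi i1, hi i2, hi i3]
  · refine PadicInt.ext ?_
    push_cast
    rw [h0, h2, h3]
    linear_combination c ^ 2 * H1
  · refine PadicInt.ext ?_
    push_cast
    rw [h0, h1, h3]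
    linear_combination c ^ 2 * H2
  · refine PadicInt.ext ?_
    push_cast
    rw [h0, h1, h2]
    linear_combination c ^ 2 * H3

/-- A `p`-adic lift of a point on the reduction, away from the roots or exactly at a root. -/
theorem exists_lift_of_residue {ι : Type*} (f : ι → ℤ_[p])
    (hf : Function.Injective fun i => PadicInt.toZMod (f i)) (x : ZMod p) :
    ∃ X : ℤ_[p], PadicInt.toZMod X = x ∧ ∀ i, x = PadicInt.toZMod (f i) → X = f i := by
  by_cases h : ∃ i, x = PadicInt.toZMod (f i)
  · obtain ⟨i, rfl⟩ := h
    exact ⟨f i, rfl, fun j hj => congrArg f (hf hj)⟩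
  · obtain ⟨X, rfl⟩ := PadicInt.toZMod_surjective x
    exact ⟨X, rfl, fun i hi => (h ⟨i, hi⟩).elim⟩

/-- The reduction still has three distinct roots, so the 2-covering has a point over the residue
field (`exists_point_of_finite`), and Hensel's lemma lifts it. -/
theorem hasPoint_of_units (hp : p ≠ 2) (h₁ : ¬ (p : ℤ) ∣ E.e₁) (h₂ : ¬ (p : ℤ) ∣ E.e₂)
    (h₃ : ¬ (p : ℤ) ∣ E.e₃) {d₁ d₂ d₃ : ℤ_[p]} (hd₁ : ¬ (p : ℤ_[p]) ∣ d₁)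
    (hd₂ : ¬ (p : ℤ_[p]) ∣ d₂) (hd₃ : ¬ (p : ℤ_[p]) ∣ d₃)
    (hs : IsSquare ((d₁ : ℚ_[p]) * d₂ * d₃)) : E.HasPoint (d₁ : ℚ_[p]) d₂ d₃ := by
  have hs' : IsSquare (d₁ * d₂ * d₃) := PadicInt.isSquare_of_isSquare_coe (by exact_mod_cast hs)
  have n₁ : (E.e₁ : ZMod p) ≠ 0 := by rwa [Ne, ZMod.intCast_zmod_eq_zero_iff_dvd]
  have n₂ : (E.e₂ : ZMod p) ≠ 0 := by rwa [Ne, ZMod.intCast_zmod_eq_zero_iff_dvd]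
  have n₃ : (E.e₃ : ZMod p) ≠ 0 := by rwa [Ne, ZMod.intCast_zmod_eq_zero_iff_dvd]
  have hsum : (E.e₁ : ZMod p) + E.e₂ + E.e₃ = 0 := by
    exact_mod_cast congrArg (Int.cast : ℤ → ZMod p) E.sum_eq_zero
  have h2 : (2 : ZMod p) ≠ 0 := by
    intro h
    have : (p : ℕ) ∣ 2 := (ZMod.natCast_eq_zero_iff 2 p).1 (by exact_mod_cast h)
    exact hp ((Nat.prime_dvd_prime_iff_eq Fact.out Nat.prime_two).1 this)
  have hαβ : -(E.e₂ : ZMod p) ≠ E.e₁ := fun h => n₃ (by linear_combination hsum + h)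
  have hαγ : -(E.e₂ : ZMod p) ≠ 0 := neg_ne_zero.2 n₂
  rw [← PadicInt.toZMod_eq_zero_iff] at hd₁ hd₂ hd₃
  rcases cubicCurve.exists_point_of_finite h2 hαβ hαγ n₁ hd₁ hd₂ hd₃
    (by simpa using hs'.map (PadicInt.toZMod (p := p))) with ⟨a₁, a₂, a₃⟩ | ⟨x, a, b, c, ha, hb, hc⟩
  · rw [PadicInt.toZMod_eq_zero_iff] at hd₁ hd₂ hd₃
    have key (d : ℤ_[p]) (hd : ¬ (p : ℤ_[p]) ∣ d) (h : IsSquare (PadicInt.toZMod d)) :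
        IsSquare (d : ℚ_[p]) :=
      (PadicInt.isSquare_of_toZMod hp hd h).map (PadicInt.Coe.ringHom (p := p))
    exact E.hasPoint_of_isSquare (PadicInt.coe_ne_zero.2 (PadicInt.ne_zero_of_not_dvd hd₁))
      (PadicInt.coe_ne_zero.2 (PadicInt.ne_zero_of_not_dvd hd₂))
      (PadicInt.coe_ne_zero.2 (PadicInt.ne_zero_of_not_dvd hd₃))
      (key _ hd₁ a₁) (key _ hd₂ a₂) (key _ hd₃ a₃)
  -- If the residue is a root, X must be that root itself. Each X minus a root is then either zero
  -- or a unit, and in the unit case its square class is read off the residue.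
  · obtain ⟨X, rfl, hX⟩ := exists_lift_of_residue
      (![-(E.e₂ : ℤ_[p]), (E.e₁ : ℤ_[p]), 0]) (by
        intro i j hij
        fin_cases i <;> fin_cases j <;> first | rfl | (exfalso; simp at hij)
        · exact hαβ hij
        · exact n₂ hij
        · exact hαβ hij.symm
        · exact n₁ hij
        · exact n₂ hij
        · exact n₁ hij.symm) x
    have key (r d : ℤ_[p]) (hd : PadicInt.toZMod d ≠ 0) (a : ZMod p)
        (h : PadicInt.toZMod X - PadicInt.toZMod r = PadicInt.toZMod d * a ^ 2)
        (hr : PadicInt.toZMod X = PadicInt.toZMod r → X = r) :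
        ∃ v : ℚ_[p], (X : ℚ_[p]) - r = d * v ^ 2 := by
      by_cases h0 : PadicInt.toZMod X = PadicInt.toZMod r
      · exact ⟨0, by rw [hr h0]; simp⟩
      · have := PadicInt.exists_eq_mul_sq hp (u := X - r) (d := d)
          (by rwa [← PadicInt.toZMod_eq_zero_iff, map_sub, sub_eq_zero])
          (by rwa [← PadicInt.toZMod_eq_zero_iff]) (a := a) (by rwa [map_sub])
        simpa using this
    obtain ⟨v₁, w₁⟩ := key (-(E.e₂ : ℤ_[p])) d₁ hd₁ a (by simpa using ha) (hX 0)
    obtain ⟨v₂, w₂⟩ := key (E.e₁ : ℤ_[p]) d₂ hd₂ b (by simpa using hb) (hX 1)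
    obtain ⟨v₃, w₃⟩ := key 0 d₃ hd₃ c (by simpa using hc) (hX 2)
    have hsum' : (E.e₁ : ℚ_[p]) + E.e₂ + E.e₃ = 0 := (E.cast_facts ℚ_[p]).2.2.2
    push_cast at w₁ w₂ w₃
    refine ⟨1, v₁, v₂, v₃, by simp, ?_, ?_, ?_⟩
    · linear_combination w₃ - w₂
    · linear_combination w₁ - w₃
    · linear_combination w₂ - w₁ + hsum'

/-- At an odd prime of good reduction, unramified classes are soluble. -/
theorem hasPoint_of_even_valuation (hp : p ≠ 2) (h₁ : ¬ (p : ℤ) ∣ E.e₁) (h₂ : ¬ (p : ℤ) ∣ E.e₂)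
    (h₃ : ¬ (p : ℤ) ∣ E.e₃) {d₁ d₂ d₃ : ℚ_[p]} (hd₁ : d₁ ≠ 0) (hd₂ : d₂ ≠ 0) (hd₃ : d₃ ≠ 0)
    (hv₁ : Even d₁.valuation) (hv₂ : Even d₂.valuation) (hv₃ : Even d₃.valuation)
    (hs : IsSquare (d₁ * d₂ * d₃)) : E.HasPoint d₁ d₂ d₃ := by
  obtain ⟨u₁, c₁, hc₁, hu₁, ⟨-, w₁⟩ | ⟨hv, -⟩⟩ := Padic.exists_unit_mul_sq hd₁
  swap
  · exact (hv hv₁).elim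
  obtain ⟨u₂, c₂, hc₂, hu₂, ⟨-, w₂⟩ | ⟨hv, -⟩⟩ := Padic.exists_unit_mul_sq hd₂
  swap
  · exact (hv hv₂).elim
  obtain ⟨u₃, c₃, hc₃, hu₃, ⟨-, w₃⟩ | ⟨hv, -⟩⟩ := Padic.exists_unit_mul_sq hd₃
  swap
  · exact (hv hv₃).elim
  have z₁ := PadicInt.coe_ne_zero.2 (PadicInt.ne_zero_of_not_dvd hu₁)
  have z₂ := PadicInt.coe_ne_zero.2 (PadicInt.ne_zero_of_not_dvd hu₂)
  have z₃ := PadicInt.coe_ne_zero.2 (PadicInt.ne_zero_of_not_dvd hu₃)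
  refine (E.hasPoint_of_units hp h₁ h₂ h₃ hu₁ hu₂ hu₃ ?_).congr z₁ z₂ z₃ hd₁ hd₂ hd₃
    (by rw [w₁, sqClass_mul_sq z₁ hc₁]) (by rw [w₂, sqClass_mul_sq z₂ hc₂])
    (by rw [w₃, sqClass_mul_sq z₃ hc₃])
  obtain ⟨s, hs⟩ := hs
  refine ⟨s / (c₁ * c₂ * c₃), ?_⟩
  rw [w₁, w₂, w₃] at hs
  field_simp
  linear_combination hs

/-- The case where exactly two of the three classes have odd valuation, written for one position of
the even one. Divisibility by p passes from t to u₃, then u₂, then u₁, which no primitive solution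
allows. Only B has to be a unit among the coefficients of t². -/
theorem dvd_of_ramified {A B a₁ a₂ a₃ t u₁ u₂ u₃ : ℤ_[p]} (hB : ¬ (p : ℤ_[p]) ∣ B)
    (ha₁ : ¬ (p : ℤ_[p]) ∣ a₁) (ha₂ : ¬ (p : ℤ_[p]) ∣ a₂) (ha₃ : ¬ (p : ℤ_[p]) ∣ a₃)
    (hA : A * t ^ 2 + p * a₂ * u₂ ^ 2 = a₃ * u₃ ^ 2)
    (hB' : B * t ^ 2 + p * a₁ * u₁ ^ 2 = p * a₂ * u₂ ^ 2) :
    (p : ℤ_[p]) ∣ t ∧ (p : ℤ_[p]) ∣ u₁ ∧ (p : ℤ_[p]) ∣ u₂ ∧ (p : ℤ_[p]) ∣ u₃ := by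
  have hp0 : (p : ℤ_[p]) ≠ 0 := PadicInt.prime_p.ne_zero
  have ht : (p : ℤ_[p]) ∣ t := PadicInt.dvd_of_dvd_mul_sq hB
    ⟨a₂ * u₂ ^ 2 - a₁ * u₁ ^ 2, by linear_combination hB'⟩
  obtain ⟨t, rfl⟩ := ht
  have h3 : (p : ℤ_[p]) ∣ u₃ := PadicInt.dvd_of_dvd_mul_sq ha₃
    ⟨A * p * t ^ 2 + a₂ * u₂ ^ 2, by linear_combination -hA⟩
  obtain ⟨u₃, rfl⟩ := h3
  have h2 : (p : ℤ_[p]) ∣ u₂ := PadicInt.dvd_of_dvd_mul_sq ha₂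
    ⟨a₃ * u₃ ^ 2 - A * t ^ 2, mul_left_cancel₀ hp0 (by linear_combination hA)⟩
  obtain ⟨u₂, rfl⟩ := h2
  have h1 : (p : ℤ_[p]) ∣ u₁ := PadicInt.dvd_of_dvd_mul_sq ha₁
    ⟨a₂ * p * u₂ ^ 2 - B * t ^ 2, mul_left_cancel₀ hp0 (by linear_combination hB')⟩
  exact ⟨dvd_mul_right _ _, h1, dvd_mul_right _ _, dvd_mul_right _ _⟩

/-- At a prime not dividing `e₁ e₂ e₃`, soluble classes are unramified. -/
theorem HasPoint.even_valuation {E : TwoTorsionTriple} (h₁ : ¬ (p : ℤ) ∣ E.e₁)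
    (h₂ : ¬ (p : ℤ) ∣ E.e₂) (h₃ : ¬ (p : ℤ) ∣ E.e₃) {d₁ d₂ d₃ : ℚ_[p]} (hd₁ : d₁ ≠ 0)
    (hd₂ : d₂ ≠ 0) (hd₃ : d₃ ≠ 0) (hs : IsSquare (d₁ * d₂ * d₃)) (H : E.HasPoint d₁ d₂ d₃) :
    Even d₁.valuation ∧ Even d₂.valuation ∧ Even d₃.valuation := by
  have hv := Padic.even_valuation_of_isSquare hs
  rw [Padic.valuation_mul (mul_ne_zero hd₁ hd₂) hd₃, Padic.valuation_mul hd₁ hd₂, Int.even_add,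
    Int.even_add] at hv
  have hp0 : (p : ℚ_[p]) ≠ 0 := by exact_mod_cast (Fact.out : p.Prime).ne_zero
  replace h₁ := PadicInt.not_dvd_intCast h₁
  replace h₂ := PadicInt.not_dvd_intCast h₂
  replace h₃ := PadicInt.not_dvd_intCast h₃
  have key (a : ℤ_[p]) (ha : ¬ (p : ℤ_[p]) ∣ a) (c : ℚ_[p]) (hc : c ≠ 0) :
      ((a : ℤ_[p]) : ℚ_[p]) ≠ 0 ∧ ((p * a : ℤ_[p]) : ℚ_[p]) ≠ 0 ∧
      sqClass ((a : ℚ_[p]) * c ^ 2) = sqClass (a : ℚ_[p]) ∧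
      sqClass ((p : ℚ_[p]) * a * c ^ 2) = sqClass ((p * a : ℤ_[p]) : ℚ_[p]) := by
    have z := PadicInt.coe_ne_zero.2 (PadicInt.ne_zero_of_not_dvd ha)
    refine ⟨z, by push_cast; exact mul_ne_zero hp0 z, sqClass_mul_sq z hc, ?_⟩
    rw [sqClass_mul_sq (mul_ne_zero hp0 z) hc]
    push_cast
    rfl
  obtain ⟨u₁, c₁, hc₁, hu₁, w₁⟩ := Padic.exists_unit_mul_sq hd₁
  obtain ⟨u₂, c₂, hc₂, hu₂, w₂⟩ := Padic.exists_unit_mul_sq hd₂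
  obtain ⟨u₃, c₃, hc₃, hu₃, w₃⟩ := Padic.exists_unit_mul_sq hd₃
  obtain ⟨k₁, l₁, m₁, n₁⟩ := key u₁ hu₁ c₁ hc₁
  obtain ⟨k₂, l₂, m₂, n₂⟩ := key u₂ hu₂ c₂ hc₂
  obtain ⟨k₃, l₃, m₃, n₃⟩ := key u₃ hu₃ c₃ hc₃
  -- The product is a square, so the number of odd valuations is 0 or 2. The three cases with two
  -- odd ones are cyclic permutations of `dvd_of_ramified`.
  rcases w₁ with ⟨v₁, w₁⟩ | ⟨v₁, w₁⟩ <;> rcases w₂ with ⟨v₂, w₂⟩ | ⟨v₂, w₂⟩ <;>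
    rcases w₃ with ⟨v₃, w₃⟩ | ⟨v₃, w₃⟩ <;> simp [v₁, v₂, v₃] at hv ⊢
  · obtain ⟨t, x₁, x₂, x₃, hne, H1, H2, H3⟩ := (H.congr hd₁ hd₂ hd₃ k₁ l₂ l₃
      (by rw [w₁, m₁]) (by rw [w₂, n₂]) (by rw [w₃, n₃])).exists_primitive
    have := dvd_of_ramified h₁ hu₂ hu₃ hu₁ (A := E.e₂) (t := t) (u₁ := x₂) (u₂ := x₃) (u₃ := x₁)
      (by linear_combination H2) (by linear_combination H1)
    exact hne ⟨this.1, this.2.2.2, this.2.1, this.2.2.1⟩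
  · obtain ⟨t, x₁, x₂, x₃, hne, H1, H2, H3⟩ := (H.congr hd₁ hd₂ hd₃ l₁ k₂ l₃
      (by rw [w₁, n₁]) (by rw [w₂, m₂]) (by rw [w₃, n₃])).exists_primitive
    have := dvd_of_ramified h₂ hu₃ hu₁ hu₂ (A := E.e₃) (t := t) (u₁ := x₃) (u₂ := x₁) (u₃ := x₂)
      (by linear_combination H3) (by linear_combination H2)
    exact hne ⟨this.1, this.2.2.1, this.2.2.2, this.2.1⟩
  · obtain ⟨t, x₁, x₂, x₃, hne, H1, H2, H3⟩ := (H.congr hd₁ hd₂ hd₃ l₁ l₂ k₃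
      (by rw [w₁, n₁]) (by rw [w₂, n₂]) (by rw [w₃, m₃])).exists_primitive
    have := dvd_of_ramified h₃ hu₁ hu₂ hu₃ (A := E.e₁) (t := t) (u₁ := x₁) (u₂ := x₂) (u₃ := x₃)
      (by linear_combination H1) (by linear_combination H3)
    exact hne this

end Padic

end TwoTorsionTriple

/-! ### Primes dividing the twisting parameter -/

theorem FiniteField.isSquare_mul_of_not_isSquare {F : Type*} [Field F] [Finite F] {a b : F}
    (ha : ¬ IsSquare a) (hb : ¬ IsSquare b) : IsSquare (a * b) := by
  classical
  have := Fintype.ofFinite F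
  have hF : ringChar F ≠ 2 := fun h => ha (FiniteField.isSquare_of_char_two h a)
  have ha0 : a ≠ 0 := by rintro rfl; exact ha (by simp)
  have hb0 : b ≠ 0 := by rintro rfl; exact hb (by simp)
  rw [← quadraticChar_one_iff_isSquare (mul_ne_zero ha0 hb0), map_mul,
    quadraticChar_neg_one_iff_not_isSquare.2 ha, quadraticChar_neg_one_iff_not_isSquare.2 hb]
  norm_num

theorem sqClass_prod_of_isSquare {K : Type*} [Field K] {d₁ d₂ d₃ : K} (h₁ : d₁ ≠ 0) (h₂ : d₂ ≠ 0)
    (h₃ : d₃ ≠ 0) (hs : IsSquare (d₁ * d₂ * d₃)) : sqClass d₃ = sqClass d₁ * sqClass d₂ := by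
  rw [isSquare_iff_sqClass (mul_ne_zero (mul_ne_zero h₁ h₂) h₃), sqClass_mul (mul_ne_zero h₁ h₂) h₃,
    sqClass_mul h₁ h₂] at hs
  rw [← mul_one (sqClass d₁ * sqClass d₂), ← SqClass.mul_self (sqClass d₃), ← mul_assoc, hs, one_mul]

theorem isSquare_of_sqClass_prod {K : Type*} [Field K] {d₁ d₂ d₃ : K} (h₁ : d₁ ≠ 0) (h₂ : d₂ ≠ 0)
    (h₃ : d₃ ≠ 0) (hs : sqClass d₃ = sqClass d₁ * sqClass d₂) : IsSquare (d₁ * d₂ * d₃) := by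
  rw [isSquare_iff_sqClass (mul_ne_zero (mul_ne_zero h₁ h₂) h₃), sqClass_mul (mul_ne_zero h₁ h₂) h₃,
    sqClass_mul h₁ h₂, hs, SqClass.mul_self]

namespace TwoTorsionTriple

variable (E : TwoTorsionTriple)

/-- In this and the next two results the point lies over a nonzero 2-torsion point: t = 1, and the
coordinate uᵢ belonging to its root vanishes. -/
theorem hasPoint_torsion₁ (K : Type*) [Field K] [CharZero K] :
    E.HasPoint (-E.e₃ : K) (-(E.e₁ * E.e₃)) E.e₁ :=
  ⟨1, 1, 0, 1, by simp, by ring, by linear_combination (E.cast_facts K).2.2.2, by ring⟩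

theorem hasPoint_torsion₂ (K : Type*) [Field K] [CharZero K] :
    E.HasPoint (-(E.e₂ * E.e₃) : K) E.e₃ (-E.e₂) :=
  ⟨1, 0, 1, 1, by simp, by linear_combination (E.cast_facts K).2.2.2, by ring, by ring⟩

theorem hasPoint_torsion₃ (K : Type*) [Field K] [CharZero K] :
    E.HasPoint (E.e₂ : K) (-E.e₁) (-(E.e₁ * E.e₂)) :=
  ⟨1, 1, 1, 0, by simp, by ring, by ring, by linear_combination (E.cast_facts K).2.2.2⟩

/-- If `e₁, e₂, e₃, -1` are squares, then the `2`-torsion points account for the classes with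
components in `{1, n}`. -/
theorem hasPoint_twist_of_sqClass {K : Type*} [Field K] [CharZero K] (hneg : IsSquare (-1 : K))
    (he₁ : IsSquare (E.e₁ : K)) (he₂ : IsSquare (E.e₂ : K)) (he₃ : IsSquare (E.e₃ : K))
    (n : ℕ) (hn : n ≠ 0) {d₁ d₂ d₃ : K} (h₁ : d₁ ≠ 0) (h₂ : d₂ ≠ 0) (h₃ : d₃ ≠ 0)
    (hs : IsSquare (d₁ * d₂ * d₃)) (H₁ : sqClass d₁ = 1 ∨ sqClass d₁ = sqClass (n : K))
    (H₂ : sqClass d₂ = 1 ∨ sqClass d₂ = sqClass (n : K)) : (E.twist n hn).HasPoint d₁ d₂ d₃ := by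
  have h12 := sqClass_prod_of_isSquare h₁ h₂ h₃ hs
  obtain ⟨z₁, z₂, z₃, -⟩ := E.cast_facts K
  obtain ⟨t₁, t₂, t₃, -⟩ := (E.twist n hn).cast_facts K
  have hnK : (n : K) ≠ 0 := Nat.cast_ne_zero.2 hn
  have q₁ : sqClass ((E.twist n hn).e₁ : K) = sqClass (n : K) := by
    simp only [twist, Int.cast_mul, Int.cast_natCast]
    rw [mul_comm, sqClass_mul_isSquare hnK z₁ he₁]
  have q₂ : sqClass ((E.twist n hn).e₂ : K) = sqClass (n : K) := by
    simp only [twist, Int.cast_mul, Int.cast_natCast]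
    rw [mul_comm, sqClass_mul_isSquare hnK z₂ he₂]
  have q₃ : sqClass ((E.twist n hn).e₃ : K) = sqClass (n : K) := by
    simp only [twist, Int.cast_mul, Int.cast_natCast]
    rw [mul_comm, sqClass_mul_isSquare hnK z₃ he₃]
  have hneg' (a : K) (ha : a ≠ 0) : sqClass (-a) = sqClass a := by
    rw [← mul_neg_one, sqClass_mul_isSquare ha (neg_ne_zero.2 one_ne_zero) hneg]
  -- Each eᵢ n has the class of n and signs do not matter, so the nontrivial torsion classes are (n,
  -- 1, n), (1, n, n) and (n, n, 1). With the trivial class they cover all four cases.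
  rcases H₁ with H₁ | H₁ <;> rcases H₂ with H₂ | H₂ <;> rw [H₁, H₂] at h12
  · rw [one_mul] at h12
    exact hasPoint_of_isSquare _ h₁ h₂ h₃ ((isSquare_iff_sqClass h₁).2 H₁)
      ((isSquare_iff_sqClass h₂).2 H₂) ((isSquare_iff_sqClass h₃).2 h12)
  · refine ((E.twist n hn).hasPoint_torsion₂ K).congr (neg_ne_zero.2 (mul_ne_zero t₂ t₃)) t₃
      (neg_ne_zero.2 t₂) h₁ h₂ h₃ ?_ ?_ ?_
    · rw [hneg' _ (mul_ne_zero t₂ t₃), sqClass_mul t₂ t₃, q₂, q₃, SqClass.mul_self, H₁]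
    · rw [q₃, H₂]
    · rw [hneg' _ t₂, q₂, h12, one_mul]
  · refine ((E.twist n hn).hasPoint_torsion₁ K).congr (neg_ne_zero.2 t₃)
      (neg_ne_zero.2 (mul_ne_zero t₁ t₃)) t₁ h₁ h₂ h₃ ?_ ?_ ?_
    · rw [hneg' _ t₃, q₃, H₁]
    · rw [hneg' _ (mul_ne_zero t₁ t₃), sqClass_mul t₁ t₃, q₁, q₃, SqClass.mul_self, H₂]
    · rw [q₁, h12, mul_one]
  · refine ((E.twist n hn).hasPoint_torsion₃ K).congr t₂ (neg_ne_zero.2 t₁)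
      (neg_ne_zero.2 (mul_ne_zero t₁ t₂)) h₁ h₂ h₃ ?_ ?_ ?_
    · rw [q₂, H₁]
    · rw [hneg' _ t₁, q₁, H₂]
    · rw [hneg' _ (mul_ne_zero t₁ t₂), sqClass_mul t₁ t₂, q₁, q₂, h12]

variable {p : ℕ} [Fact p.Prime]

/-- Modulo p the terms in t² disappear, leaving a₁u₁² = a₂u₂² = a₃u₃². Once these are nonzero, the
three units share one square class. Their product is a square, so that class is trivial. -/
theorem isSquare_of_hasPoint_twist (hp : p ≠ 2) (h₁ : ¬ (p : ℤ) ∣ E.e₁) {n m : ℕ} (hn : n ≠ 0)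
    (hnm : n = p * m) (hm : ¬ p ∣ m) {a₁ a₂ a₃ : ℤ_[p]} (ha₁ : ¬ (p : ℤ_[p]) ∣ a₁)
    (ha₂ : ¬ (p : ℤ_[p]) ∣ a₂) (ha₃ : ¬ (p : ℤ_[p]) ∣ a₃) (hs : IsSquare (a₁ * a₂ * a₃))
    (H : (E.twist n hn).HasPoint (a₁ : ℚ_[p]) a₂ a₃) : IsSquare a₁ ∧ IsSquare a₂ := by
  obtain ⟨t, u₁, u₂, u₃, hne, H1, H2, H3⟩ := H.exists_primitive
  have hp0 : (p : ℤ_[p]) ≠ 0 := PadicInt.prime_p.ne_zero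
  have hnp : (n : ℤ_[p]) = p * m := by rw [hnm]; push_cast; rfl
  simp only [twist, Int.cast_mul, Int.cast_natCast, hnp] at H1 H2 H3
  have hem : ¬ (p : ℤ_[p]) ∣ E.e₁ * m := by
    refine fun h => (PadicInt.prime_p.dvd_or_dvd h).elim (PadicInt.not_dvd_intCast h₁) ?_
    exact_mod_cast PadicInt.not_dvd_intCast (p := p) (a := (m : ℤ)) (by exact_mod_cast hm)
  -- If p divides u₃ it divides u₂ and u₁. Then p² divides e₁ n t², and since n has valuation
  -- exactly one, p divides t, against primitivity.
  have hu₃ : ¬ (p : ℤ_[p]) ∣ u₃ := by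
    rintro ⟨u₃, rfl⟩
    have h2 : (p : ℤ_[p]) ∣ u₂ := PadicInt.dvd_of_dvd_mul_sq ha₂
      ⟨a₃ * p * u₃ ^ 2 - E.e₁ * m * t ^ 2, by linear_combination H1⟩
    obtain ⟨u₂, rfl⟩ := h2
    have h1 : (p : ℤ_[p]) ∣ u₁ := PadicInt.dvd_of_dvd_mul_sq ha₁
      ⟨a₃ * p * u₃ ^ 2 + E.e₂ * m * t ^ 2, by linear_combination -H2⟩
    refine hne ⟨PadicInt.dvd_of_dvd_mul_sq hem ⟨a₃ * u₃ ^ 2 - a₂ * u₂ ^ 2, ?_⟩, h1,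
      dvd_mul_right _ _, dvd_mul_right _ _⟩
    exact mul_left_cancel₀ hp0 (by linear_combination H1)
  obtain ⟨s, hs⟩ := hs
  have K1 := congrArg PadicInt.toZMod H1
  have K2 := congrArg PadicInt.toZMod H2
  have Ks := congrArg PadicInt.toZMod hs
  have hp' : PadicInt.toZMod (p : ℤ_[p]) = 0 := PadicInt.toZMod_eq_zero_iff.2 dvd_rfl
  simp only [map_add, map_sub, map_mul, map_pow, hp', map_zero] at K1 K2 Ks
  rw [← PadicInt.toZMod_eq_zero_iff] at ha₁ ha₂ ha₃ hu₃
  generalize hA₁ : PadicInt.toZMod a₁ = A₁ at *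
  generalize hA₂ : PadicInt.toZMod a₂ = A₂ at *
  generalize PadicInt.toZMod a₃ = A₃ at *
  generalize PadicInt.toZMod u₁ = U₁ at *
  generalize PadicInt.toZMod u₂ = U₂ at *
  generalize PadicInt.toZMod u₃ = U₃ at *
  generalize PadicInt.toZMod s = S at *
  have e2 : A₂ * U₂ ^ 2 = A₃ * U₃ ^ 2 := by linear_combination K1
  have e1 : A₁ * U₁ ^ 2 = A₃ * U₃ ^ 2 := by linear_combination -K2
  have n3 : A₃ * U₃ ^ 2 ≠ 0 := mul_ne_zero ha₃ (pow_ne_zero _ hu₃)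
  have hU₁ : U₁ ≠ 0 := by rintro rfl; exact n3 (by rw [← e1]; ring)
  have hU₂ : U₂ ≠ 0 := by rintro rfl; exact n3 (by rw [← e2]; ring)
  constructor
  · refine PadicInt.isSquare_of_toZMod hp (by rwa [← PadicInt.toZMod_eq_zero_iff, hA₁]) ?_
    rw [hA₁]
    refine ⟨S * U₃ / (A₂ * U₂), ?_⟩
    field_simp
    linear_combination A₁ * A₂ * e2 + U₃ ^ 2 * Ks
  · refine PadicInt.isSquare_of_toZMod hp (by rwa [← PadicInt.toZMod_eq_zero_iff, hA₂]) ?_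
    rw [hA₂]
    refine ⟨S * U₃ / (A₁ * U₁), ?_⟩
    field_simp
    linear_combination A₁ * A₂ * e1 + U₃ ^ 2 * Ks

end TwoTorsionTriple

/-! ### Square classes at a prime dividing n once, and the symbol against -n -/

namespace Padic

variable {p : ℕ} [Fact p.Prime]

/-- n = p m serves as uniformizer in place of p: p u c² = n (u m) (c / m)². -/
theorem exists_unit_sqClass {n m : ℕ} (hn : n ≠ 0) (hnm : n = p * m) (hm : ¬ p ∣ m) {d : ℚ_[p]}
    (hd : d ≠ 0) : ∃ u : ℤ_[p], ¬ (p : ℤ_[p]) ∣ u ∧ (sqClass d = sqClass (u : ℚ_[p]) ∨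
      sqClass d = sqClass (n : ℚ_[p]) * sqClass (u : ℚ_[p])) := by
  obtain ⟨u, c, hc, hu, ⟨-, w⟩ | ⟨-, w⟩⟩ := exists_unit_mul_sq hd
  · exact ⟨u, hu, Or.inl (by
      rw [w, sqClass_mul_sq (PadicInt.coe_ne_zero.2 (PadicInt.ne_zero_of_not_dvd hu)) hc])⟩
  · have hm' : ¬ (p : ℤ_[p]) ∣ (m : ℤ_[p]) := by
      exact_mod_cast PadicInt.not_dvd_intCast (p := p) (a := (m : ℤ)) (by exact_mod_cast hm)
    have hum : ¬ (p : ℤ_[p]) ∣ u * m := fun h => (PadicInt.prime_p.dvd_or_dvd h).elim hu hm'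
    have z := PadicInt.coe_ne_zero.2 (PadicInt.ne_zero_of_not_dvd hum)
    have hm0 : (m : ℚ_[p]) ≠ 0 := by
      rintro h
      rw [Nat.cast_eq_zero] at h
      exact hm (h ▸ dvd_zero p)
    have hn0 : (n : ℚ_[p]) ≠ 0 := Nat.cast_ne_zero.2 hn
    refine ⟨u * m, hum, Or.inr ?_⟩
    rw [← sqClass_mul hn0 z, sqClass_eq_iff hd (mul_ne_zero hn0 z)]
    refine ⟨c / m, ?_⟩
    rw [w, hnm]
    push_cast
    field_simp

theorem isSquare_mul_of_units (hp : p ≠ 2) {u w : ℤ_[p]} (hu : ¬ (p : ℤ_[p]) ∣ u)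
    (hw : ¬ (p : ℤ_[p]) ∣ w) (hu' : ¬ IsSquare u) (hw' : ¬ IsSquare w) : IsSquare (u * w) := by
  refine PadicInt.isSquare_of_toZMod hp (fun h => (PadicInt.prime_p.dvd_or_dvd h).elim hu hw) ?_
  rw [map_mul]
  exact FiniteField.isSquare_mul_of_not_isSquare
    (fun h => hu' (PadicInt.isSquare_of_toZMod hp hu h))
    (fun h => hw' (PadicInt.isSquare_of_toZMod hp hw h))

theorem sqClass_coe_eq_one_iff {u : ℤ_[p]} (hu : ¬ (p : ℤ_[p]) ∣ u) :
    sqClass (u : ℚ_[p]) = 1 ↔ IsSquare u := by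
  rw [← isSquare_iff_sqClass (PadicInt.coe_ne_zero.2 (PadicInt.ne_zero_of_not_dvd hu))]
  exact ⟨PadicInt.isSquare_of_isSquare_coe, fun h => h.map (PadicInt.Coe.ringHom (p := p))⟩

/-- For `n` of valuation one, the subgroup `{1, n}` has index two in the group generated by
the units and `n`. -/
theorem sqClass_mul_of_not_mem (hp : p ≠ 2) {n m : ℕ} (hn : n ≠ 0) (hnm : n = p * m) (hm : ¬ p ∣ m)
    {a b : ℚ_[p]} (ha : a ≠ 0) (hb : b ≠ 0)
    (ha' : ¬ (sqClass a = 1 ∨ sqClass a = sqClass (n : ℚ_[p])))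
    (hb' : ¬ (sqClass b = 1 ∨ sqClass b = sqClass (n : ℚ_[p]))) :
    sqClass (a * b) = 1 ∨ sqClass (a * b) = sqClass (n : ℚ_[p]) := by
  obtain ⟨u, hu, hau⟩ := exists_unit_sqClass hn hnm hm ha
  obtain ⟨w, hw, hbw⟩ := exists_unit_sqClass hn hnm hm hb
  have hu' : ¬ IsSquare u := by
    intro h
    rw [(sqClass_coe_eq_one_iff hu).2 h, mul_one] at hau
    exact ha' hau
  have hw' : ¬ IsSquare w := by
    intro h
    rw [(sqClass_coe_eq_one_iff hw).2 h, mul_one] at hbw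
    exact hb' hbw
  have huw : sqClass (u : ℚ_[p]) * sqClass (w : ℚ_[p]) = 1 := by
    rw [← sqClass_mul (PadicInt.coe_ne_zero.2 (PadicInt.ne_zero_of_not_dvd hu))
      (PadicInt.coe_ne_zero.2 (PadicInt.ne_zero_of_not_dvd hw)), ← PadicInt.coe_mul,
      sqClass_coe_eq_one_iff fun h => (PadicInt.prime_p.dvd_or_dvd h).elim hu hw]
    exact isSquare_mul_of_units hp hu hw hu' hw'
  rw [sqClass_mul ha hb]
  rcases hau with hau | hau <;> rcases hbw with hbw | hbw <;> rw [hau, hbw]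
  · exact Or.inl huw
  · exact Or.inr (by rw [mul_left_comm, huw, mul_one])
  · exact Or.inr (by rw [mul_assoc, huw, mul_one])
  · exact Or.inl (by rw [mul_mul_mul_comm, huw, SqClass.mul_self, mul_one])

/-- The symbol vanishes exactly when a is a norm from the ramified extension by √(-n), and the norm
group is generated by n and the squares. The argument is elementary: write a as u or n u with u a
unit, and reduce a primitive solution modulo p to see that u is a square. -/
theorem addHilbert_eq_zero_iff (hp : p ≠ 2) {n m : ℕ} (hn : n ≠ 0)
    (hnm : n = p * m) (hm : ¬ p ∣ m) {a : ℚ_[p]} (ha : a ≠ 0) :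
    addHilbert p a (-(n : ℚ_[p])) = 0 ↔ sqClass a = 1 ∨ sqClass a = sqClass (n : ℚ_[p]) := by
  have hn0 : (n : ℚ_[p]) ≠ 0 := Nat.cast_ne_zero.2 hn
  have hiff : addHilbert p a (-(n : ℚ_[p])) = 0 ↔ ∃ x y z : ℚ_[p], ¬ (x = 0 ∧ y = 0 ∧ z = 0) ∧
      z ^ 2 = a * x ^ 2 + -(n : ℚ_[p]) * y ^ 2 := by
    rw [addHilbert]
    split_ifs with h
    · exact ⟨fun _ => h, fun _ => rfl⟩
    · exact ⟨fun h' => absurd h' one_ne_zero, fun h' => (h h').elim⟩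
  rw [hiff]
  constructor
  · rintro ⟨x, y, z, hne, H⟩
    obtain ⟨u, hu, hau⟩ := exists_unit_sqClass hn hnm hm ha
    have zu := PadicInt.coe_ne_zero.2 (PadicInt.ne_zero_of_not_dvd hu)
    have hp0 : (p : ℤ_[p]) ≠ 0 := PadicInt.prime_p.ne_zero
    have hm' : ¬ (p : ℤ_[p]) ∣ (m : ℤ_[p]) := by
      exact_mod_cast PadicInt.not_dvd_intCast (p := p) (a := (m : ℤ)) (by exact_mod_cast hm)
    suffices IsSquare u by
      rwa [(sqClass_coe_eq_one_iff hu).2 this, mul_one] at hau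
    have conclude (x y : ℤ_[p]) (hx : ¬ (p : ℤ_[p]) ∣ x) (h : (p : ℤ_[p]) ∣ u * x ^ 2 - y ^ 2) :
        IsSquare u := by
      refine PadicInt.isSquare_of_toZMod hp hu
        ⟨PadicInt.toZMod y / PadicInt.toZMod x, ?_⟩
      rw [← PadicInt.toZMod_eq_zero_iff] at hx h
      rw [map_sub, map_mul, map_pow, map_pow] at h
      field_simp
      linear_combination h
    rcases hau with hau | hau
    -- a is a unit up to squares: modulo p the term in n vanishes, leaving u x² ≡ z². If p divided x
    -- it would divide z and then y.
    · obtain ⟨c, rfl⟩ := (sqClass_eq_iff ha zu).1 hau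
      have hc : c ≠ 0 := by rintro rfl; simp at ha
      obtain ⟨k, g, hk, hg, hi⟩ := PadicInt.exists_primitive ![c * x, y, z] (by
        by_contra! h
        exact hne ⟨(mul_eq_zero.1 (h 0)).resolve_left hc, h 1, h 2⟩)
      have h0 : (g 0 : ℚ_[p]) = k * (c * x) := hg 0
      have h1 : (g 1 : ℚ_[p]) = k * y := hg 1
      have h2 : (g 2 : ℚ_[p]) = k * z := hg 2
      have G : g 2 ^ 2 = u * g 0 ^ 2 - p * m * g 1 ^ 2 := by
        refine PadicInt.ext ?_
        push_cast
        rw [h0, h1, h2]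
        rw [hnm] at H
        push_cast at H
        linear_combination k ^ 2 * H
      refine conclude (g 0) (g 2) (fun hx => ?_) ⟨m * g 1 ^ 2, by linear_combination -G⟩
      obtain ⟨x', hx'⟩ := id hx
      have hz : (p : ℤ_[p]) ∣ g 2 := PadicInt.dvd_of_dvd_sq
        ⟨u * p * x' ^ 2 - m * g 1 ^ 2, by rw [G, hx']; ring⟩
      obtain ⟨z', hz'⟩ := id hz
      have hy : (p : ℤ_[p]) ∣ g 1 := PadicInt.dvd_of_dvd_mul_sq hm'
        ⟨u * x' ^ 2 - z' ^ 2, mul_left_cancel₀ hp0 (by rw [hx', hz'] at G; linear_combination G)⟩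
      obtain ⟨i, hi⟩ := hi
      fin_cases i
      exacts [hi hx, hi hy, hi hz]
    -- a is n u up to squares: p divides z, and cancelling one factor p leaves u x² ≡ y².
    · rw [← sqClass_mul hn0 zu] at hau
      obtain ⟨c, rfl⟩ := (sqClass_eq_iff ha (mul_ne_zero hn0 zu)).1 hau
      have hc : c ≠ 0 := by rintro rfl; simp at ha
      obtain ⟨k, g, hk, hg, hi⟩ := PadicInt.exists_primitive ![c * x, y, z] (by
        by_contra! h
        exact hne ⟨(mul_eq_zero.1 (h 0)).resolve_left hc, h 1, h 2⟩)
      have h0 : (g 0 : ℚ_[p]) = k * (c * x) := hg 0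
      have h1 : (g 1 : ℚ_[p]) = k * y := hg 1
      have h2 : (g 2 : ℚ_[p]) = k * z := hg 2
      have G : g 2 ^ 2 = p * m * (u * g 0 ^ 2 - g 1 ^ 2) := by
        refine PadicInt.ext ?_
        push_cast
        rw [h0, h1, h2]
        rw [hnm] at H
        push_cast at H
        linear_combination k ^ 2 * H
      have hz : (p : ℤ_[p]) ∣ g 2 := PadicInt.dvd_of_dvd_sq
        ⟨m * (u * g 0 ^ 2 - g 1 ^ 2), by rw [G]; ring⟩
      obtain ⟨z', hz'⟩ := id hz
      have hd : (p : ℤ_[p]) ∣ u * g 0 ^ 2 - g 1 ^ 2 := (PadicInt.prime_p.dvd_or_dvd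
        ⟨z' ^ 2, mul_left_cancel₀ hp0 (by rw [hz'] at G; linear_combination -G)⟩).resolve_left hm'
      refine conclude (g 0) (g 1) (fun hx => ?_) hd
      obtain ⟨x', hx'⟩ := id hx
      obtain ⟨d', hd'⟩ := id hd
      have hy : (p : ℤ_[p]) ∣ g 1 := PadicInt.dvd_of_dvd_sq
        ⟨u * p * x' ^ 2 - d', by rw [hx'] at hd'; linear_combination -hd'⟩
      obtain ⟨i, hi⟩ := hi
      fin_cases i
      exacts [hi hx, hi hy, hi hz]
  · rintro (h | h)
    · obtain ⟨c, rfl⟩ := (sqClass_eq_one_iff ha).1 h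
      exact ⟨1, 0, c, by simp, by ring⟩
    · obtain ⟨c, rfl⟩ := (sqClass_eq_iff ha hn0).1 h
      -- For a = n c² the form is isotropic because n c² - n c² = 0.
      exact ⟨1, c, 0, by simp, by ring⟩

/-- The kernel {1, n} is a subgroup, and `sqClass_mul_of_not_mem` says that its index is at most
two. The indicator of its complement, with values in 𝔽₂, is therefore additive. -/
theorem addHilbert_mul (hp : p ≠ 2) {n m : ℕ} (hn : n ≠ 0)
    (hnm : n = p * m) (hm : ¬ p ∣ m) {a b : ℚ_[p]} (ha : a ≠ 0) (hb : b ≠ 0) :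
    addHilbert p (a * b) (-(n : ℚ_[p])) =
      addHilbert p a (-(n : ℚ_[p])) + addHilbert p b (-(n : ℚ_[p])) := by
  have hval (z : ZMod 2) (hz : z ≠ 0) : z = 1 := by
    revert z
    decide
  have ia := addHilbert_eq_zero_iff hp hn hnm hm ha
  have ib := addHilbert_eq_zero_iff hp hn hnm hm hb
  have iab := addHilbert_eq_zero_iff hp hn hnm hm (mul_ne_zero ha hb)
  have hN := SqClass.mul_self (sqClass (n : ℚ_[p]))
  by_cases h1 : sqClass a = 1 ∨ sqClass a = sqClass (n : ℚ_[p])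
  · rw [ia.2 h1, zero_add]
    have : (sqClass (a * b) = 1 ∨ sqClass (a * b) = sqClass (n : ℚ_[p])) ↔
        (sqClass b = 1 ∨ sqClass b = sqClass (n : ℚ_[p])) := by
      rw [sqClass_mul ha hb]
      rcases h1 with h1 | h1 <;> rw [h1]
      · rw [one_mul]
      · rw [mul_eq_left, or_comm, ← hN, mul_right_inj]
    rw [← iab, ← ib] at this
    by_cases hz : addHilbert p b (-(n : ℚ_[p])) = 0
    · rw [hz, this.2 hz]
    · rw [hval _ hz, hval _ fun h => hz (this.1 h)]
  · rw [hval _ (fun h => h1 (ia.1 h))]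
    by_cases h2 : sqClass b = 1 ∨ sqClass b = sqClass (n : ℚ_[p])
    · rw [ib.2 h2, add_zero]
      refine hval _ fun h => h1 ?_
      have := iab.1 h
      rw [sqClass_mul ha hb] at this
      rcases h2 with h2 | h2 <;> rw [h2] at this
      · rwa [mul_one] at this
      · rwa [mul_eq_right, or_comm, ← hN, mul_left_inj, hN] at this
    · rw [hval _ (fun h => h2 (ib.1 h)), iab.2 (sqClass_mul_of_not_mem hp hn hnm hm ha hb h1 h2)]
      rfl

end Padic

/-- Solubility at a prime dividing `n` exactly once, when `e₁, e₂, e₃, -1` are local squares. -/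
theorem TwoTorsionTriple.hasPoint_twist_ramified_iff (E : TwoTorsionTriple) {p : ℕ} [Fact p.Prime]
    (hp : p ≠ 2) (hneg : IsSquare (-1 : ℚ_[p])) (h₁ : ¬ (p : ℤ) ∣ E.e₁)
    (he₁ : IsSquare (E.e₁ : ℚ_[p])) (he₂ : IsSquare (E.e₂ : ℚ_[p]))
    (he₃ : IsSquare (E.e₃ : ℚ_[p])) {n m : ℕ} (hn : n ≠ 0) (hnm : n = p * m) (hm : ¬ p ∣ m)
    {d₁ d₂ d₃ : ℚ_[p]} (hd₁ : d₁ ≠ 0) (hd₂ : d₂ ≠ 0) (hd₃ : d₃ ≠ 0)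
    (hs : IsSquare (d₁ * d₂ * d₃)) :
    (E.twist n hn).HasPoint d₁ d₂ d₃ ↔
      (sqClass d₁ = 1 ∨ sqClass d₁ = sqClass (n : ℚ_[p])) ∧
      (sqClass d₂ = 1 ∨ sqClass d₂ = sqClass (n : ℚ_[p])) := by
  refine ⟨fun H => ?_, fun ⟨H₁, H₂⟩ =>
    E.hasPoint_twist_of_sqClass hneg he₁ he₂ he₃ n hn hd₁ hd₂ hd₃ hs H₁ H₂⟩
  have hn0 : (n : ℚ_[p]) ≠ 0 := Nat.cast_ne_zero.2 hn
  obtain ⟨u₁, hu₁, w₁⟩ := Padic.exists_unit_sqClass hn hnm hm hd₁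
  obtain ⟨u₂, hu₂, w₂⟩ := Padic.exists_unit_sqClass hn hnm hm hd₂
  have z₁ := PadicInt.coe_ne_zero.2 (PadicInt.ne_zero_of_not_dvd hu₁)
  have z₂ := PadicInt.coe_ne_zero.2 (PadicInt.ne_zero_of_not_dvd hu₂)
  have split {d u : ℚ_[p]} (w : sqClass d = sqClass u ∨ sqClass d = sqClass (n : ℚ_[p]) * sqClass u) :
      ∃ k : ℚ_[p], k ≠ 0 ∧ (sqClass k = 1 ∨ sqClass k = sqClass (n : ℚ_[p])) ∧
        sqClass d = sqClass k * sqClass u := by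
    rcases w with w | w
    · exact ⟨1, one_ne_zero, Or.inl sqClass_one, by rw [w, sqClass_one, one_mul]⟩
    · exact ⟨n, hn0, Or.inr rfl, w⟩
  -- Write dᵢ = kᵢ uᵢ up to squares for i = 1, 2, with kᵢ in {1, n} and uᵢ a unit. The triple (k₁,
  -- k₂, k₁k₂) is a soluble torsion class. Dividing by it leaves a soluble unit triple, whose
  -- entries must be squares.
  obtain ⟨k₁, hk₁, K₁, x₁⟩ := split w₁
  obtain ⟨k₂, hk₂, K₂, x₂⟩ := split w₂
  have x₃ := sqClass_prod_of_isSquare hd₁ hd₂ hd₃ hs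
  have hks : IsSquare (k₁ * k₂ * (k₁ * k₂)) := ⟨_, rfl⟩
  have T := E.hasPoint_twist_of_sqClass hneg he₁ he₂ he₃ n hn hk₁ hk₂ (mul_ne_zero hk₁ hk₂) hks K₁ K₂
  have z₃ : ((u₁ * u₂ : ℤ_[p]) : ℚ_[p]) ≠ 0 := by push_cast; exact mul_ne_zero z₁ z₂
  have M := (H.mul hd₁ hd₂ hd₃ hs hk₁ hk₂ (mul_ne_zero hk₁ hk₂) hks T).congr
    (mul_ne_zero hd₁ hk₁) (mul_ne_zero hd₂ hk₂) (mul_ne_zero hd₃ (mul_ne_zero hk₁ hk₂)) z₁ z₂ z₃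
    (by rw [sqClass_mul hd₁ hk₁, x₁, mul_right_comm, SqClass.mul_self, one_mul])
    (by rw [sqClass_mul hd₂ hk₂, x₂, mul_right_comm, SqClass.mul_self, one_mul])
    (by
      push_cast
      rw [sqClass_mul hd₃ (mul_ne_zero hk₁ hk₂), x₃, x₁, x₂, sqClass_mul hk₁ hk₂, sqClass_mul z₁ z₂,
        mul_mul_mul_comm (sqClass k₁), mul_right_comm, SqClass.mul_self, one_mul])
  obtain ⟨s₁, s₂⟩ := E.isSquare_of_hasPoint_twist hp h₁ hn hnm hm hu₁ hu₂
    (fun h => (PadicInt.prime_p.dvd_or_dvd h).elim hu₁ hu₂) ⟨_, rfl⟩ M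
  rw [x₁, x₂, (Padic.sqClass_coe_eq_one_iff hu₁).2 s₁, (Padic.sqClass_coe_eq_one_iff hu₂).2 s₂,
    mul_one, mul_one]
  exact ⟨K₁, K₂⟩

/-! ### Selmer groups and torsion classes -/

namespace TwoTorsionTriple

variable (E : TwoTorsionTriple)

theorem EverywhereLocallySolvable.congr {E : TwoTorsionTriple} {a₁ a₂ a₃ b₁ b₂ b₃ : ℚ}
    (ha₁ : a₁ ≠ 0) (ha₂ : a₂ ≠ 0) (ha₃ : a₃ ≠ 0) (hb₁ : b₁ ≠ 0) (hb₂ : b₂ ≠ 0) (hb₃ : b₃ ≠ 0)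
    (h₁ : sqClass a₁ = sqClass b₁) (h₂ : sqClass a₂ = sqClass b₂) (h₃ : sqClass a₃ = sqClass b₃)
    (H : E.EverywhereLocallySolvable a₁ a₂ a₃) : E.EverywhereLocallySolvable b₁ b₂ b₃ := by
  have key {L : Type} [Field L] [CharZero L] (h : E.HasPoint (a₁ : L) a₂ a₃) :
      E.HasPoint (b₁ : L) b₂ b₃ :=
    h.congr (Rat.cast_ne_zero.2 ha₁) (Rat.cast_ne_zero.2 ha₂) (Rat.cast_ne_zero.2 ha₃)
      (Rat.cast_ne_zero.2 hb₁) (Rat.cast_ne_zero.2 hb₂) (Rat.cast_ne_zero.2 hb₃)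
      (sqClass_map (Rat.castHom L) ha₁ hb₁ h₁) (sqClass_map (Rat.castHom L) ha₂ hb₂ h₂)
      (sqClass_map (Rat.castHom L) ha₃ hb₃ h₃)
  exact ⟨key H.1, fun p _ => key (H.2 p)⟩

/-- Membership in the Selmer group can be tested on any representatives. -/
theorem mem_selmer_iff {d₁ d₂ d₃ : ℚ} (h₁ : d₁ ≠ 0) (h₂ : d₂ ≠ 0) (h₃ : d₃ ≠ 0) :
    (sqClass d₁, sqClass d₂, sqClass d₃) ∈ E.selmer ↔
      IsSquare (d₁ * d₂ * d₃) ∧ E.EverywhereLocallySolvable d₁ d₂ d₃ := by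
  constructor
  · rintro ⟨a₁, a₂, a₃, ha₁, ha₂, ha₃, h, hs, H⟩
    simp only [Prod.mk.injEq] at h
    obtain ⟨e₁, e₂, e₃⟩ := h
    refine ⟨isSquare_of_sqClass_prod h₁ h₂ h₃ ?_,
      H.congr ha₁ ha₂ ha₃ h₁ h₂ h₃ e₁.symm e₂.symm e₃.symm⟩
    rw [e₁, e₂, e₃, sqClass_prod_of_isSquare ha₁ ha₂ ha₃ hs]
  · rintro ⟨hs, H⟩
    exact ⟨d₁, d₂, d₃, h₁, h₂, h₃, rfl, hs, H⟩

/-! ### The rational 2-torsion and its Kummer classes -/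

/-- The four rational points of order dividing two. -/
noncomputable def twoTorsionPoint : Fin 4 → (E.curve ℚ).toAffine.Point :=
  ![0, .some (E.e₁ : ℚ) 0 (E.nonsingular (by ring)), .some (-E.e₂ : ℚ) 0 (E.nonsingular (by ring)),
    .some 0 0 (E.nonsingular (by ring))]

/-- Representatives of the images of the `2`-torsion points under the Kummer map. -/
def torsionRep : Fin 4 → ℤ × ℤ × ℤ :=
  ![(1, 1, 1), (-E.e₃, -(E.e₁ * E.e₃), E.e₁), (-(E.e₂ * E.e₃), E.e₃, -E.e₂),
    (E.e₂, -E.e₁, -(E.e₁ * E.e₂))]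

/-- The images of the `2`-torsion points under the Kummer map. -/
noncomputable def torsionClass (i : Fin 4) : SqTriple ℚ :=
  (sqClass ((E.torsionRep i).1 : ℚ), sqClass ((E.torsionRep i).2.1 : ℚ),
    sqClass ((E.torsionRep i).2.2 : ℚ))

theorem torsionRep_ne_zero (i : Fin 4) :
    (E.torsionRep i).1 ≠ 0 ∧ (E.torsionRep i).2.1 ≠ 0 ∧ (E.torsionRep i).2.2 ≠ 0 := by
  have h1 := E.ne₁
  have h2 := E.ne₂
  have h3 := E.ne₃
  fin_cases i <;> simp [torsionRep, h1, h2, h3]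

theorem torsionClass_zero : E.torsionClass 0 = 1 := by
  simp [torsionClass, torsionRep, sqClass_one]

theorem add_self_eq_zero_iff {x y : ℚ} (h : (E.curve ℚ).toAffine.Nonsingular x y) :
    Affine.Point.some x y h + Affine.Point.some x y h = 0 ↔ y = 0 := by
  constructor
  · intro h0
    by_contra hy
    have hne : y ≠ (E.curve ℚ).toAffine.negY x y := by
      simp only [Affine.negY, curve]
      intro h1
      exact hy (by linarith)
    rw [Affine.Point.add_self_of_Y_ne hne] at h0
    exact Affine.Point.some_ne_zero _ h0
  · rintro rfl
    exact Affine.Point.add_self_of_Y_eq (by simp [Affine.negY, curve])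

theorem twoTorsionPoint_add_self (i : Fin 4) :
    E.twoTorsionPoint i + E.twoTorsionPoint i = 0 := by
  fin_cases i
  · exact add_zero 0
  all_goals exact (E.add_self_eq_zero_iff _).2 rfl

theorem exists_eq_twoTorsionPoint {P : (E.curve ℚ).toAffine.Point} (h : P + P = 0) :
    ∃ i, P = E.twoTorsionPoint i := by
  rcases P with _ | ⟨x, y, hP⟩
  · exact ⟨0, rfl⟩
  obtain rfl := (E.add_self_eq_zero_iff hP).1 h
  have hx := (Affine.equation_iff _ _).1 hP.1
  simp only [curve] at hx
  have : x * (x - E.e₁) * (x + E.e₂) = 0 := by linear_combination -hx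
  rcases mul_eq_zero.1 this with h1 | h1
  · rcases mul_eq_zero.1 h1 with rfl | h1
    · exact ⟨3, rfl⟩
    · obtain rfl : x = E.e₁ := by linear_combination h1
      exact ⟨1, rfl⟩
  · obtain rfl : x = -(E.e₂ : ℚ) := by linear_combination h1
    exact ⟨2, rfl⟩

theorem twoTorsionPoint_injective : Function.Injective E.twoTorsionPoint := by
  obtain ⟨r1, r2, r3⟩ := E.roots_ne ℚ
  intro i j hij
  fin_cases i <;> fin_cases j <;> first
    | rfl
    | exact (Affine.Point.some_ne_zero _ hij).elim
    | exact (Affine.Point.some_ne_zero _ hij.symm).elim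
    | (exfalso; simp [twoTorsionPoint] at hij)
  · exact r1 hij.symm
  · exact r3 (by exact_mod_cast hij)
  · exact r1 hij
  · exact r2 (by simpa using hij)
  · exact r3 (by exact_mod_cast hij.symm)
  · exact r2 (by simpa using hij)

theorem kummer_twoTorsionPoint (i : Fin 4) :
    E.kummer ℚ (Multiplicative.ofAdd (E.twoTorsionPoint i)) = E.torsionClass i := by
  obtain ⟨r1, r2, r3⟩ := E.roots_ne ℚ
  have hs : (E.e₃ : ℚ) = -(E.e₁ + E.e₂) := by linear_combination (E.cast_facts ℚ).2.2.2
  fin_cases i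
  · exact (map_one _).trans E.torsionClass_zero.symm
  · refine Prod.ext ?_ (Prod.ext ?_ ?_)
    · refine (if_neg r1.symm).trans (congrArg sqClass ?_)
      simp [torsionRep, hs]
    · refine (if_pos rfl).trans (congrArg sqClass ?_)
      simp [torsionRep, hs]
      ring
    · refine (if_neg r3).trans (congrArg sqClass ?_)
      simp [torsionRep]
  · refine Prod.ext ?_ (Prod.ext ?_ ?_)
    · refine (if_pos rfl).trans (congrArg sqClass ?_)
      simp [torsionRep, hs]
      ring
    · refine (if_neg r1).trans (congrArg sqClass ?_)
      simp [torsionRep, hs]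
      ring
    · refine (if_neg r2).trans (congrArg sqClass ?_)
      simp [torsionRep]
  · refine Prod.ext ?_ (Prod.ext ?_ ?_)
    · refine (if_neg r2.symm).trans (congrArg sqClass ?_)
      simp [torsionRep]
    · refine (if_neg r3.symm).trans (congrArg sqClass ?_)
      simp [torsionRep]
    · change (if (0 : ℚ) = 0 then sqClass ((0 - (E.e₁ : ℚ)) * (0 - -(E.e₂ : ℚ)))
        else sqClass ((0 : ℚ) - 0)) = _
      rw [if_pos rfl]
      refine congrArg sqClass ?_
      simp [torsionRep]

/-- The kernel of the Kummer map consists of doubles. -/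
theorem exists_add_self_of_kummer_eq_one {P : (E.curve ℚ).toAffine.Point}
    (h : E.kummer ℚ (Multiplicative.ofAdd P) = 1) : ∃ Q, Q + Q = P := by
  obtain ⟨r1, r2, r3⟩ := E.roots_ne ℚ
  -- The two Weierstrass equations agree only propositionally, so the curve is made a variable
  -- before substituting; this carries the point along.
  have key (W : WeierstrassCurve ℚ) (hW : W = cubicCurve (-(E.e₂ : ℚ)) (E.e₁ : ℚ) 0)
      (P : W.toAffine.Point) (h₁ : kummerComponent W (-(E.e₂ : ℚ)) E.e₁ 0 P = 1)
      (h₂ : kummerComponent W (E.e₁ : ℚ) (-(E.e₂ : ℚ)) 0 P = 1) : ∃ Q, Q + Q = P := by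
    subst hW
    exact cubicCurve.exists_add_self_eq two_ne_zero r1 r2 r3 P h₁ h₂
  exact key _ (E.curve_eq_cubicCurve ℚ) P (congrArg Prod.fst h) (congrArg (fun z => z.2.1) h)

/-! ### Consequences of having no rational point of order 4 -/

section NoFourTorsion

variable {E} (hE : ∀ P : (E.curve ℚ).toAffine.Point, addOrderOf P ≠ 4)
include hE

/-- A trivial Kummer class means P = 2Q. If P were nonzero of order 2, then Q would have order 4. -/
theorem eq_zero_of_kummer_eq_one {P : (E.curve ℚ).toAffine.Point} (hP : P + P = 0)
    (h : E.kummer ℚ (Multiplicative.ofAdd P) = 1) : P = 0 := by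
  obtain ⟨Q, rfl⟩ := E.exists_add_self_of_kummer_eq_one h
  by_contra h0
  refine hE Q (addOrderOf_eq_prime_pow (p := 2) (n := 1) ?_ ?_)
  · rwa [pow_one, two_nsmul]
  · rw [show 2 ^ (1 + 1) = 2 + 2 from rfl, add_nsmul, two_nsmul]
    exact hP

theorem torsionClass_injective : Function.Injective E.torsionClass := by
  intro i j hij
  rw [← kummer_twoTorsionPoint, ← kummer_twoTorsionPoint] at hij
  refine E.twoTorsionPoint_injective (sub_eq_zero.1 (eq_zero_of_kummer_eq_one hE ?_ ?_))
  · rw [sub_add_sub_comm, twoTorsionPoint_add_self, twoTorsionPoint_add_self, sub_zero]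
  · rw [ofAdd_sub, map_div, hij, div_self']

/-- Four distinct torsion classes inside a group of order four exhaust it. -/
theorem eq_torsionClass_of_mem_selmer (hSel : Nonempty (E.selmer ≃* Multiplicative (ZMod 2 × ZMod 2)))
    {Λ : SqTriple ℚ} (h : Λ ∈ E.selmer) : ∃ i, Λ = E.torsionClass i := by
  obtain ⟨φ⟩ := hSel
  have : Finite E.selmer := Finite.of_equiv _ φ.symm.toEquiv
  have hcard : Nat.card E.selmer = 4 := by
    rw [Nat.card_congr φ.toEquiv]
    simp
  let f : Fin 4 → E.selmer := fun i =>
    ⟨E.torsionClass i, E.kummer_twoTorsionPoint i ▸ E.kummer_mem_selmer _⟩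
  have hf : Function.Injective f := fun i j hij =>
    torsionClass_injective hE (congrArg Subtype.val hij)
  obtain ⟨i, hi⟩ := (hf.bijective_of_nat_card_le (by simp [hcard])).2 ⟨Λ, h⟩
  exact ⟨i, (congrArg Subtype.val hi).symm⟩

/-- The order of a torsion point P is not divisible by 4, so some odd multiple of P is killed by 2.
Kummer classes have exponent 2, hence an odd multiple has the same class as P. -/
theorem mem_torsionImage_iff {Λ : E.selmer} :
    Λ ∈ E.torsionImage ↔ ∃ i, (Λ : SqTriple ℚ) = E.torsionClass i := by
  constructor
  · rintro ⟨P, hP, rfl⟩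
    obtain ⟨P, rfl⟩ := Multiplicative.ofAdd.surjective P
    have hfin : IsOfFinAddOrder P := isOfFinOrder_ofAdd_iff.1 hP
    -- Otherwise a suitable multiple of P would have order exactly 4.
    have h4 : ¬ 4 ∣ addOrderOf P := fun h4 =>
      hE ((addOrderOf P / 4) • P) (addOrderOf_nsmul_addOrderOf_sub hfin.addOrderOf_pos.ne' h4)
    obtain ⟨m, hm, hodd⟩ : ∃ m, addOrderOf P ∣ 2 * m ∧ Odd m := by
      rcases Nat.even_or_odd (addOrderOf P) with ⟨k, hk⟩ | h
      · refine ⟨k, by rw [hk, two_mul], Nat.not_even_iff_odd.1 ?_⟩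
        rintro ⟨l, hl⟩
        exact h4 ⟨l, by lia⟩
      · exact ⟨_, dvd_mul_left _ _, h⟩
    have h2 : m • P + m • P = 0 := by
      rw [← two_nsmul, ← mul_nsmul', addOrderOf_dvd_iff_nsmul_eq_zero.1 hm]
    obtain ⟨i, hi⟩ := E.exists_eq_twoTorsionPoint h2
    refine ⟨i, ?_⟩
    rw [← kummer_twoTorsionPoint, ← hi]
    obtain ⟨k, rfl⟩ := hodd
    rw [add_nsmul, one_nsmul, mul_nsmul', two_nsmul, ofAdd_add, ofAdd_add, map_mul, map_mul]
    have hsq (c : SqTriple ℚ) : c * c = 1 :=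
      Prod.ext (SqClass.mul_self _) (Prod.ext (SqClass.mul_self _) (SqClass.mul_self _))
    rw [hsq, one_mul]
    rfl
  · rintro ⟨i, hi⟩
    refine ⟨Multiplicative.ofAdd (E.twoTorsionPoint i), ?_, ?_⟩
    · refine isOfFinOrder_ofAdd_iff.2 (isOfFinAddOrder_iff_nsmul_eq_zero.2 ⟨2, two_pos, ?_⟩)
      rw [two_nsmul, twoTorsionPoint_add_self]
    · exact Subtype.ext ((E.kummer_twoTorsionPoint i).trans hi.symm)

end NoFourTorsion

/-- The square classes by which the torsion classes change under twisting. -/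
noncomputable def twistClass (n : ℕ) : Fin 4 → SqTriple ℚ :=
  ![(1, 1, 1), (sqClass (n : ℚ), 1, sqClass (n : ℚ)), (1, sqClass (n : ℚ), sqClass (n : ℚ)),
    (sqClass (n : ℚ), sqClass (n : ℚ), 1)]

/-- An entry ± eᵢ acquires one factor n, while an entry -eᵢeⱼ acquires n², which its square class
does not see. -/
theorem torsionClass_twist (n : ℕ) (hn : n ≠ 0) (i : Fin 4) :
    (E.twist n hn).torsionClass i = E.torsionClass i * twistClass n i := by
  obtain ⟨h1, h2, h3, -⟩ := E.cast_facts ℚ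
  have hn' : (n : ℚ) ≠ 0 := Nat.cast_ne_zero.2 hn
  have s1 (a : ℚ) (ha : a ≠ 0) : sqClass (a * n) = sqClass a * sqClass (n : ℚ) := sqClass_mul ha hn'
  have s2 (a b : ℚ) (ha : a ≠ 0) (hb : b ≠ 0) : sqClass (-(a * n * (b * n))) = sqClass (-(a * b)) := by
    rw [show -(a * n * (b * n)) = -(a * b) * (n : ℚ) ^ 2 by ring,
      sqClass_mul_sq (neg_ne_zero.2 (mul_ne_zero ha hb)) hn']
  have s3 (a : ℚ) (ha : a ≠ 0) : sqClass (-(a * n)) = sqClass (-a) * sqClass (n : ℚ) := by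
    rw [← neg_mul, s1 _ (neg_ne_zero.2 ha)]
  fin_cases i <;> refine Prod.ext ?_ (Prod.ext ?_ ?_) <;>
    simp [torsionClass, torsionRep, twistClass, twist, sqClass_one, s1 _ h1, s1 _ h2, s1 _ h3,
      s2 _ _ h1 h2, s2 _ _ h1 h3, s2 _ _ h2 h3, s3 _ h1, s3 _ h2, s3 _ h3]

end TwoTorsionTriple

/-! ### Divisors of a product of distinct primes -/

/-- The divisor `∏ p_i ^ x_i` attached to a vector `x` over `𝔽₂`. -/
def primeProd {k : ℕ} (p : Fin k → ℕ) (x : Fin k → ZMod 2) : ℕ :=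
  ∏ i, p i ^ (x i).val

section PrimeProd

variable {k : ℕ} {p : Fin k → ℕ}

theorem primeProd_one : primeProd p 1 = ∏ i, p i :=
  Finset.prod_congr rfl fun i _ => pow_one (p i)

theorem primeProd_zero : primeProd p 0 = 1 :=
  Finset.prod_eq_one fun i _ => pow_zero (p i)

theorem primeProd_dvd (x : Fin k → ZMod 2) : primeProd p x ∣ ∏ i, p i :=
  Finset.prod_dvd_prod_of_dvd _ _ fun i _ =>
    (pow_dvd_pow (p i) (Nat.le_of_lt_succ (ZMod.val_lt (x i)))).trans (by rw [pow_one])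

theorem isSquare_primeProd {R : Type*} [CommSemiring R] (h : ∀ i, IsSquare (p i : R))
    (x : Fin k → ZMod 2) : IsSquare (primeProd p x : R) := by
  rw [primeProd, Nat.cast_prod]
  refine Finset.isSquare_prod _ fun i _ => ?_
  rw [Nat.cast_pow]
  exact (h i).pow _

/-- The class of the triple of divisors attached to a pair of vectors over `𝔽₂`. -/
noncomputable def divisorClass (p : Fin k → ℕ) (x y : Fin k → ZMod 2) : SqTriple ℚ :=
  TwoTorsionTriple.classOf (primeProd p x) (primeProd p y) (primeProd p (x + y))

theorem divisorClass_zero : divisorClass p 0 0 = 1 := by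
  simp [divisorClass, TwoTorsionTriple.classOf, primeProd_zero, sqClass_one]

/-- The all-ones vector gives n and the zero vector gives 1. The third entry of the last class comes
from 1 + 1 = 0 in 𝔽₂. -/
theorem exists_twistClass_eq {n : ℕ} (hn : n = ∏ i, p i) (i : Fin 4) :
    ∃ x y, TwoTorsionTriple.twistClass n i = divisorClass p x y := by
  have h11 : (1 : Fin k → ZMod 2) + 1 = 0 := by
    funext i
    exact CharTwo.add_self_eq_zero 1
  have key (x y) : divisorClass p x y = (sqClass (primeProd p x : ℚ), sqClass (primeProd p y : ℚ),
    sqClass (primeProd p (x + y) : ℚ)) := rfl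
  fin_cases i
  · exact ⟨0, 0, divisorClass_zero.symm⟩
  · refine ⟨1, 0, ?_⟩
    rw [key, add_zero, primeProd_one, primeProd_zero, ← hn, Nat.cast_one, sqClass_one]
    rfl
  · refine ⟨0, 1, ?_⟩
    rw [key, zero_add, primeProd_one, primeProd_zero, ← hn, Nat.cast_one, sqClass_one]
    rfl
  · refine ⟨1, 1, ?_⟩
    rw [key, h11, primeProd_one, primeProd_zero, ← hn, Nat.cast_one, sqClass_one]
    rfl

variable [hp : ∀ i, Fact (p i).Prime]

theorem primeProd_ne_zero (x : Fin k → ZMod 2) : primeProd p x ≠ 0 :=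
  Finset.prod_ne_zero_iff.2 fun i _ => pow_ne_zero _ (hp i).out.ne_zero

theorem padicValNat_primeProd_of_forall_ne {q : ℕ} [Fact q.Prime] (hq : ∀ i, q ≠ p i)
    (x : Fin k → ZMod 2) : padicValNat q (primeProd p x) = 0 := by
  refine padicValNat.eq_zero_of_not_dvd fun h => ?_
  obtain ⟨i, -, hi⟩ := (Prime.dvd_finsetProd_iff (Fact.out : q.Prime).prime _).1 h
  exact hq i ((Nat.prime_dvd_prime_iff_eq Fact.out (hp i).out).1
    ((Fact.out : q.Prime).dvd_of_dvd_pow hi))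

theorem padicValNat_primeProd (hinj : Function.Injective p) (x : Fin k → ZMod 2) (i : Fin k) :
    padicValNat (p i) (primeProd p x) = (x i).val := by
  have h0 (j : Fin k) : p j ^ (x j).val ≠ 0 := pow_ne_zero _ (hp j).out.ne_zero
  rw [← Nat.factorization_def _ (hp i).out, primeProd, Nat.factorization_prod fun j _ => h0 j,
    Finsupp.finsetSum_apply, Finset.sum_eq_single i]
  · rw [(hp i).out.factorization_pow, Finsupp.single_eq_same]
  · intro j _ hj
    rw [(hp j).out.factorization_pow, Finsupp.single_eq_of_ne fun h => hj (hinj h).symm]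
  · simp

/-- All valuations of a divisor of n are 0 or 1, so reducing them modulo 2 loses nothing. -/
theorem primeProd_valuationVector (hinj : Function.Injective p) {d : ℕ} (hd : d ∣ ∏ i, p i) :
    primeProd p (valuationVector p d) = d := by
  have hN : ∏ i, p i ≠ 0 := Finset.prod_ne_zero_iff.2 fun i _ => (hp i).out.ne_zero
  have hd0 : d ≠ 0 := ne_zero_of_dvd_ne_zero hN hd
  refine Nat.eq_of_factorization_eq (primeProd_ne_zero _) hd0 fun q => ?_
  by_cases hq : q.Prime
  swap
  · rw [Nat.factorization_eq_zero_of_not_prime _ hq, Nat.factorization_eq_zero_of_not_prime _ hq]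
  have := Fact.mk hq
  rw [Nat.factorization_def _ hq, Nat.factorization_def _ hq]
  have hle := (padicValNat_dvd_iff_le hN).1 ((pow_padicValNat_dvd (p := q) (n := d)).trans hd)
  rw [← primeProd_one] at hle
  by_cases h : ∃ i, q = p i
  · obtain ⟨i, rfl⟩ := h
    rw [padicValNat_primeProd hinj] at hle ⊢
    rw [valuationVector, ZMod.val_natCast, Nat.mod_eq_of_lt]
    exact Nat.lt_succ_of_le hle
  · push Not at h
    rw [padicValNat_primeProd_of_forall_ne h] at hle ⊢
    exact (Nat.le_zero.1 hle).symm

theorem SqClass.pow_val_add {K : Type*} [Field K] (c : SqClass K) (a b : ZMod 2) :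
    c ^ (a + b).val = c ^ a.val * c ^ b.val := by
  have h : c ^ 2 = 1 := by rw [pow_two, SqClass.mul_self]
  rw [← pow_add, ZMod.val_add, ← pow_eq_pow_mod _ h]

theorem sqClass_primeProd {K : Type*} [Field K] [CharZero K] (x : Fin k → ZMod 2) :
    sqClass (primeProd p x : K) = ∏ i, sqClass (p i : K) ^ (x i).val := by
  have h0 (j : Fin k) : (p j : K) ≠ 0 := Nat.cast_ne_zero.2 (hp j).out.ne_zero
  have hpow (a : K) (ha : a ≠ 0) (m : ℕ) : sqClass (a ^ m) = sqClass a ^ m := by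
    induction m with
    | zero => rw [pow_zero, pow_zero, sqClass_one]
    | succ m ih => rw [pow_succ, pow_succ, sqClass_mul (pow_ne_zero _ ha) ha, ih]
  have key (s : Finset (Fin k)) : sqClass (∏ i ∈ s, (p i : K) ^ (x i).val) =
      ∏ i ∈ s, sqClass (p i : K) ^ (x i).val := by
    classical
    induction s using Finset.induction_on with
    | empty => simp [sqClass_one]
    | insert j s hj ih =>
      rw [Finset.prod_insert hj, Finset.prod_insert hj, sqClass_mul (pow_ne_zero _ (h0 j))
        (Finset.prod_ne_zero_iff.2 fun i _ => pow_ne_zero _ (h0 i)), ih, hpow _ (h0 j)]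
  rw [← key, primeProd]
  push_cast
  rfl

/-- As an integer `primeProd` is not multiplicative: where both vectors have a 1, the sum drops
p_i². Square classes ignore the difference. -/
theorem sqClass_primeProd_add {K : Type*} [Field K] [CharZero K] (x y : Fin k → ZMod 2) :
    sqClass (primeProd p (x + y) : K) = sqClass (primeProd p x : K) * sqClass (primeProd p y : K) := by
  simp only [sqClass_primeProd, Pi.add_apply, SqClass.pow_val_add, Finset.prod_mul_distrib]

/-- Compare valuations at p_i: since a contributes nothing, the exponent in {0, 1} is even and hence
0. -/
theorem eq_zero_of_sqClass_primeProd (hinj : Function.Injective p) {a : ℤ} (ha : a ≠ 0)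
    (hpa : ∀ i, ¬ (p i : ℤ) ∣ a) {x : Fin k → ZMod 2}
    (h : sqClass (primeProd p x : ℚ) = sqClass (a : ℚ)) : x = 0 := by
  have hD : (primeProd p x : ℚ) ≠ 0 := Nat.cast_ne_zero.2 (primeProd_ne_zero x)
  have ha' : (a : ℚ) ≠ 0 := Int.cast_ne_zero.2 ha
  obtain ⟨c, hc⟩ := (sqClass_eq_iff hD ha').1 h
  have hc0 : c ≠ 0 := by
    rintro rfl
    simp at hc
    exact primeProd_ne_zero x (by exact_mod_cast hc)
  funext i
  have hv := congrArg (padicValRat (p i)) hc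
  rw [padicValRat.mul ha' (pow_ne_zero _ hc0), padicValRat.pow, padicValRat.of_nat,
    padicValNat_primeProd hinj, padicValRat.of_int, padicValInt.eq_zero_of_not_dvd (hpa i)] at hv
  have hlt := ZMod.val_lt (x i)
  have : (x i).val = 0 := by
    push_cast at hv
    omega
  exact (ZMod.val_eq_zero _).1 this

theorem primeProd_sqClass_injective (hinj : Function.Injective p) {x y : Fin k → ZMod 2}
    (h : sqClass (primeProd p x : ℚ) = sqClass (primeProd p y : ℚ)) : x = y := by
  have : x + y = 0 := by
    refine eq_zero_of_sqClass_primeProd hinj (a := 1) one_ne_zero (fun i hi => ?_) ?_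
    · exact (hp i).out.one_lt.ne' (by exact_mod_cast Int.eq_one_of_dvd_one (by simp) hi)
    · rw [sqClass_primeProd_add, h, SqClass.mul_self, Int.cast_one, sqClass_one]
  have hy : y + y = 0 := by
    funext i
    exact CharTwo.add_self_eq_zero (y i)
  exact add_right_cancel (this.trans hy.symm)

theorem divisorClass_add (x y x' y' : Fin k → ZMod 2) :
    divisorClass p (x + x') (y + y') = divisorClass p x y * divisorClass p x' y' := by
  refine Prod.ext (sqClass_primeProd_add x x') (Prod.ext (sqClass_primeProd_add y y') ?_)
  change sqClass _ = sqClass _ * sqClass _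
  rw [add_add_add_comm, sqClass_primeProd_add]

end PrimeProd

/-! ### The Selmer group of the twist -/

/-- `n` is a product of distinct primes `p_i ≡ 1 mod 8` not dividing `e₁ e₂ e₃`, each a quadratic
residue modulo every odd prime factor of `e₁ e₂ e₃`. -/
structure AdmissibleTwist (E : TwoTorsionTriple) {k : ℕ} (p : Fin k → ℕ) (n : ℕ) : Prop where
  ne_zero : n ≠ 0
  eq_prod : n = ∏ i, p i
  injective : Function.Injective p
  not_dvd : ∀ i, ¬ (p i : ℤ) ∣ E.e₁ * E.e₂ * E.e₃
  residue : ∀ i, ∀ q : ℕ, q.Prime → Odd q → (q : ℤ) ∣ E.e₁ * E.e₂ * E.e₃ → IsSquare (p i : ZMod q)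
  mod_eight : ∀ i, p i ≡ 1 [MOD 8]

namespace AdmissibleTwist

variable {E : TwoTorsionTriple} {k : ℕ} {p : Fin k → ℕ} {n : ℕ}

theorem ne_two (h : AdmissibleTwist E p n) (i : Fin k) : p i ≠ 2 := by
  intro h2
  have := h.mod_eight i
  rw [h2] at this
  exact absurd this (by decide)

theorem not_dvd_e (h : AdmissibleTwist E p n) (i : Fin k) :
    ¬ (p i : ℤ) ∣ E.e₁ ∧ ¬ (p i : ℤ) ∣ E.e₂ ∧ ¬ (p i : ℤ) ∣ E.e₃ :=
  ⟨fun h' => h.not_dvd i ((h'.mul_right _).mul_right _),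
    fun h' => h.not_dvd i ((h'.mul_left _).mul_right _), fun h' => h.not_dvd i (h'.mul_left _)⟩

/-- Three integers with sum zero cannot all be odd. The prime 2 is therefore always among the bad
primes, and any prime not dividing e₁e₂e₃ is odd. -/
theorem _root_.TwoTorsionTriple.two_dvd (E : TwoTorsionTriple) : (2 : ℤ) ∣ E.e₁ * E.e₂ * E.e₃ := by
  have hs := E.sum_eq_zero
  rcases Int.even_or_odd E.e₁ with h1 | h1
  · exact (h1.two_dvd.mul_right _).mul_right _
  rcases Int.even_or_odd E.e₂ with h2 | h2
  · exact (h2.two_dvd.mul_left _).mul_right _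
  · obtain ⟨a, ha⟩ := h1
    obtain ⟨b, hb⟩ := h2
    exact Dvd.dvd.mul_left ⟨-a - b - 1, by linarith⟩ _

variable [hp : ∀ i, Fact (p i).Prime]

theorem exists_cofactor (h : AdmissibleTwist E p n) (i : Fin k) :
    ∃ m, n = p i * m ∧ ¬ p i ∣ m := by
  classical
  refine ⟨∏ j ∈ Finset.univ.erase i, p j, ?_, fun hd => ?_⟩
  · rw [h.eq_prod, Finset.mul_prod_erase _ _ (Finset.mem_univ i)]
  · obtain ⟨j, hj, hij⟩ := (Prime.dvd_finsetProd_iff (hp i).out.prime _).1 hd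
    exact (Finset.ne_of_mem_erase hj)
      (h.injective ((Nat.prime_dvd_prime_iff_eq (hp i).out (hp j).out).1 hij).symm)

/-- At q = 2 this is p_i ≡ 1 mod 8; at odd q the residue condition lifts by Hensel's lemma, p_i
being a unit there. -/
theorem isSquare_prime (h : AdmissibleTwist E p n) {q : ℕ} [hq : Fact q.Prime]
    (hqe : (q : ℤ) ∣ E.e₁ * E.e₂ * E.e₃) (i : Fin k) : IsSquare (p i : ℚ_[q]) := by
  rcases hq.out.eq_two_or_odd' with rfl | hodd
  · simpa using (PadicInt.isSquare_natCast_two (h.mod_eight i)).map (PadicInt.Coe.ringHom (p := 2))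
  · have := Padic.isSquare_intCast (p := q) (fun h2 => by simp [h2] at hodd; exact absurd hodd (by decide))
      (a := (p i : ℤ)) (fun hd => h.not_dvd i ?_) (by simpa using h.residue i q hq.out hodd hqe)
    · simpa using this
    · rwa [← (Nat.prime_dvd_prime_iff_eq hq.out (hp i).out).1 (Int.natCast_dvd_natCast.1 hd)]

theorem isSquare_neg_one (h : AdmissibleTwist E p n) (i : Fin k) : IsSquare (-1 : ZMod (p i)) := by
  rw [ZMod.exists_sq_eq_neg_one_iff]
  have := h.mod_eight i
  unfold Nat.ModEq at this
  omega

/-- Quadratic reciprocity with p_i ≡ 1 mod 4 reverses the residue condition for odd prime factors.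
The factor 2 and the sign are covered by p_i ≡ 1 mod 8, and the general divisor follows
multiplicatively. -/
theorem isSquare_zmod_of_dvd (h : AdmissibleTwist E p n) (i : Fin k) {a : ℤ}
    (ha : a ∣ E.e₁ * E.e₂ * E.e₃) : IsSquare (a : ZMod (p i)) := by
  have h8 := h.mod_eight i
  unfold Nat.ModEq at h8
  have key (m : ℕ) (hm : (m : ℤ) ∣ E.e₁ * E.e₂ * E.e₃) : IsSquare (m : ZMod (p i)) := by
    induction m using Nat.recOnMul with
    | zero => simp
    | one => simp
    | prime q hq =>
      rcases hq.eq_two_or_odd' with rfl | hodd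
      · exact_mod_cast (ZMod.exists_sq_eq_two_iff (h.ne_two i)).2 (Or.inl h8)
      · have := Fact.mk hq
        exact (ZMod.exists_sq_eq_prime_iff_of_mod_four_eq_one (by omega)
          (fun h2 => by rw [h2] at hodd; exact absurd hodd (by decide))).2 (h.residue i q hq hodd hm)
    | mul a b iha ihb =>
      push_cast at hm ⊢
      exact (iha (dvd_of_mul_right_dvd hm)).mul (ihb (dvd_of_mul_left_dvd hm))
  have hnat := key a.natAbs ((Int.natAbs_dvd).2 ha)
  rcases Int.natAbs_eq a with h' | h' <;> rw [h']
  · rwa [Int.cast_natCast]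
  · rw [Int.cast_neg, Int.cast_natCast, ← neg_one_mul]
    exact (h.isSquare_neg_one i).mul hnat

theorem isSquare_padic_of_dvd (h : AdmissibleTwist E p n) (i : Fin k) {a : ℤ}
    (ha : a ∣ E.e₁ * E.e₂ * E.e₃) : IsSquare (a : ℚ_[p i]) :=
  Padic.isSquare_intCast (h.ne_two i) (fun h' => h.not_dvd i (h'.trans ha))
    (h.isSquare_zmod_of_dvd i ha)

theorem isSquare_neg_one_padic (h : AdmissibleTwist E p n) (i : Fin k) :
    IsSquare (-1 : ℚ_[p i]) := by
  have := Padic.isSquare_intCast (h.ne_two i) (a := -1) (fun h' => (hp i).out.one_lt.ne' ?_)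
    (by simpa using h.isSquare_neg_one i)
  · simpa using this
  · exact Nat.dvd_one.1 (by exact_mod_cast (dvd_neg.1 h'))

/-- By additivity of the symbol, row i of A_n applied to x is the symbol of the divisor ∏ p_j ^ x_j
itself. -/
theorem hilbertMatrix_mulVec (h : AdmissibleTwist E p n) (x : Fin k → ZMod 2) (i : Fin k) :
    (hilbertMatrix p n).mulVec x i = addHilbert (p i) (primeProd p x : ℚ_[p i]) (-(n : ℚ_[p i])) := by
  classical
  obtain ⟨m, hnm, hm⟩ := h.exists_cofactor i
  have h0 (j : Fin k) : (p j : ℚ_[p i]) ≠ 0 := Nat.cast_ne_zero.2 (hp j).out.ne_zero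
  have hone : addHilbert (p i) (1 : ℚ_[p i]) (-(n : ℚ_[p i])) = 0 :=
    (Padic.addHilbert_eq_zero_iff (h.ne_two i) h.ne_zero hnm hm one_ne_zero).2 (Or.inl sqClass_one)
  have hpow (j : Fin k) (a : ZMod 2) : addHilbert (p i) ((p j : ℚ_[p i]) ^ a.val) (-(n : ℚ_[p i])) =
      addHilbert (p i) (p j : ℚ_[p i]) (-(n : ℚ_[p i])) * a := by
    have : a = 0 ∨ a = 1 := by
      revert a
      decide
    rcases this with rfl | rfl
    · rw [ZMod.val_zero, pow_zero, hone, mul_zero]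
    · rw [ZMod.val_one, pow_one, mul_one]
  have key (s : Finset (Fin k)) :
      addHilbert (p i) (∏ j ∈ s, (p j : ℚ_[p i]) ^ (x j).val) (-(n : ℚ_[p i])) =
        ∑ j ∈ s, hilbertMatrix p n i j * x j := by
    induction s using Finset.induction_on with
    | empty => rw [Finset.prod_empty, Finset.sum_empty, hone]
    | insert j s hj ih =>
      rw [Finset.prod_insert hj, Finset.sum_insert hj, Padic.addHilbert_mul (h.ne_two i) h.ne_zero
        hnm hm (pow_ne_zero _ (h0 j)) (Finset.prod_ne_zero_iff.2 fun l _ => pow_ne_zero _ (h0 l)),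
        ih, hpow]
      rfl
  rw [Matrix.mulVec, dotProduct, ← key, primeProd]
  push_cast
  rfl

/-- `A_n x = 0` if and only if `D(x)` is `1` or `n` up to squares in each `ℚ_{p_i}`. -/
theorem hilbertMatrix_mulVec_eq_zero_iff (h : AdmissibleTwist E p n) (x : Fin k → ZMod 2) :
    (hilbertMatrix p n).mulVec x = 0 ↔ ∀ i, sqClass (primeProd p x : ℚ_[p i]) = 1 ∨
      sqClass (primeProd p x : ℚ_[p i]) = sqClass (n : ℚ_[p i]) := by
  rw [funext_iff]
  refine forall_congr' fun i => ?_
  obtain ⟨m, hnm, hm⟩ := h.exists_cofactor i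
  rw [h.hilbertMatrix_mulVec, ← Padic.addHilbert_eq_zero_iff (h.ne_two i) h.ne_zero hnm hm
    (Nat.cast_ne_zero.2 (primeProd_ne_zero x))]
  rfl

theorem not_dvd_twist (h : AdmissibleTwist E p n) {q : ℕ} (hq : q.Prime) (hqp : ∀ i, q ≠ p i)
    (hqe : ¬ (q : ℤ) ∣ E.e₁ * E.e₂ * E.e₃) : ¬ (q : ℤ) ∣ (E.twist n h.ne_zero).e₁ ∧
      ¬ (q : ℤ) ∣ (E.twist n h.ne_zero).e₂ ∧ ¬ (q : ℤ) ∣ (E.twist n h.ne_zero).e₃ := by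
  have hqn : ¬ (q : ℤ) ∣ n := by
    rw [Int.natCast_dvd_natCast, h.eq_prod]
    intro hd
    obtain ⟨i, -, hi⟩ := (Prime.dvd_finsetProd_iff hq.prime _).1 hd
    exact hqp i ((Nat.prime_dvd_prime_iff_eq hq (hp i).out).1 hi)
  have hprime : Prime (q : ℤ) := Nat.prime_iff_prime_int.1 hq
  exact ⟨fun h' => (hprime.dvd_or_dvd h').elim (fun h1 => hqe ((h1.mul_right _).mul_right _)) hqn,
    fun h' => (hprime.dvd_or_dvd h').elim (fun h1 => hqe ((h1.mul_left _).mul_right _)) hqn,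
    fun h' => (hprime.dvd_or_dvd h').elim (fun h1 => hqe (h1.mul_left _)) hqn⟩

theorem _root_.TwoTorsionTriple.ne_two_of_not_dvd (E : TwoTorsionTriple) {q : ℕ}
    (hqe : ¬ (q : ℤ) ∣ E.e₁ * E.e₂ * E.e₃) : q ≠ 2 := by
  rintro rfl
  exact hqe E.two_dvd

theorem isSquare_real (a : ℕ) : IsSquare (a : ℝ) :=
  ⟨Real.sqrt a, (Real.mul_self_sqrt (Nat.cast_nonneg a)).symm⟩

theorem isSquare_triple (x y : Fin k → ZMod 2) :
    IsSquare ((primeProd p x : ℚ) * primeProd p y * primeProd p (x + y)) :=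
  isSquare_of_sqClass_prod (Nat.cast_ne_zero.2 (primeProd_ne_zero x))
    (Nat.cast_ne_zero.2 (primeProd_ne_zero y)) (Nat.cast_ne_zero.2 (primeProd_ne_zero (x + y)))
    (sqClass_primeProd_add x y)

/-- The Selmer condition on classes of divisors of `n`. -/
theorem divisorClass_mem_selmer_iff (h : AdmissibleTwist E p n) (x y : Fin k → ZMod 2) :
    divisorClass p x y ∈ (E.twist n h.ne_zero).selmer ↔
      (hilbertMatrix p n).mulVec x = 0 ∧ (hilbertMatrix p n).mulVec y = 0 := by
  have n0 {K : Type} [Field K] [CharZero K] (x : Fin k → ZMod 2) : (primeProd p x : K) ≠ 0 :=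
    Nat.cast_ne_zero.2 (primeProd_ne_zero x)
  have hsq := isSquare_triple (p := p) x y
  have hram (i : Fin k) :
      (E.twist n h.ne_zero).HasPoint (primeProd p x : ℚ_[p i]) (primeProd p y)
        (primeProd p (x + y)) ↔
      (sqClass (primeProd p x : ℚ_[p i]) = 1 ∨
        sqClass (primeProd p x : ℚ_[p i]) = sqClass (n : ℚ_[p i])) ∧
      (sqClass (primeProd p y : ℚ_[p i]) = 1 ∨
        sqClass (primeProd p y : ℚ_[p i]) = sqClass (n : ℚ_[p i])) := by
    obtain ⟨m, hnm, hm⟩ := h.exists_cofactor i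
    exact E.hasPoint_twist_ramified_iff (h.ne_two i) (h.isSquare_neg_one_padic i) (h.not_dvd_e i).1
      (h.isSquare_padic_of_dvd i ((dvd_mul_right _ _).mul_right _))
      (h.isSquare_padic_of_dvd i ((dvd_mul_left _ _).mul_right _))
      (h.isSquare_padic_of_dvd i (dvd_mul_left _ _)) h.ne_zero hnm hm (n0 x) (n0 y) (n0 (x + y))
      (by simpa using hsq.map (Rat.castHom ℚ_[p i]))
  rw [h.hilbertMatrix_mulVec_eq_zero_iff, h.hilbertMatrix_mulVec_eq_zero_iff, ← forall_and]
  refine (TwoTorsionTriple.mem_selmer_iff _ (n0 x) (n0 y) (n0 (x + y))).trans ?_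
  constructor
  · rintro ⟨-, -, H⟩ i
    refine (hram i).1 ?_
    simpa using H (p i)
  -- Only the p_i impose a condition. Over ℝ and at primes dividing e₁e₂e₃ all three divisors are
  -- squares; at the remaining primes the twist has good reduction and the divisors are units.
  · intro H
    refine ⟨hsq, ?_, fun q hq => ?_⟩
    · simp only [Rat.cast_natCast]
      exact TwoTorsionTriple.hasPoint_of_isSquare _ (n0 x) (n0 y) (n0 (x + y)) (isSquare_real _)
        (isSquare_real _) (isSquare_real _)
    · simp only [Rat.cast_natCast]
      by_cases hqe : (q : ℤ) ∣ E.e₁ * E.e₂ * E.e₃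
      · exact TwoTorsionTriple.hasPoint_of_isSquare _ (n0 x) (n0 y) (n0 (x + y))
          (isSquare_primeProd (h.isSquare_prime hqe) x) (isSquare_primeProd (h.isSquare_prime hqe) y)
          (isSquare_primeProd (h.isSquare_prime hqe) (x + y))
      by_cases hqp : ∃ i, q = p i
      · obtain ⟨i, rfl⟩ := hqp
        exact (hram i).2 (H i)
      · push Not at hqp
        obtain ⟨h1, h2, h3⟩ := h.not_dvd_twist hq.out hqp hqe
        have hev (z : Fin k → ZMod 2) : Even (primeProd p z : ℚ_[q]).valuation := by
          rw [Padic.valuation_natCast, padicValNat_primeProd_of_forall_ne hqp]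
          simp
        exact TwoTorsionTriple.hasPoint_of_even_valuation _ (E.ne_two_of_not_dvd hqe) h1 h2 h3
          (n0 x) (n0 y) (n0 (x + y)) (hev x) (hev y) (hev (x + y))
          (by simpa using hsq.map (Rat.castHom ℚ_[q]))

/-- The vector of parities of the valuations of a rational number at the `p_i`. -/
def ratValuationVector (p : Fin k → ℕ) (d : ℚ) : Fin k → ZMod 2 :=
  fun i => (padicValRat (p i) d : ZMod 2)

theorem even_valuation_mul_primeProd (h : AdmissibleTwist E p n) {d : ℚ} (hd : d ≠ 0) (i : Fin k) :
    Even (padicValRat (p i) (d * primeProd p (ratValuationVector p d))) := by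
  rw [padicValRat.mul hd (Nat.cast_ne_zero.2 (primeProd_ne_zero _)), padicValRat.of_nat,
    padicValNat_primeProd h.injective, ← ZMod.intCast_eq_zero_iff_even]
  push_cast
  rw [ZMod.natCast_val, ZMod.cast_id, ratValuationVector]
  exact CharTwo.add_self_eq_zero _

/-- Removing the part supported on `n` from a Selmer class of the twist gives a Selmer class of
the original curve. -/
theorem mul_divisorClass_mem_selmer (h : AdmissibleTwist E p n) {Λ : SqTriple ℚ}
    (hΛ : Λ ∈ (E.twist n h.ne_zero).selmer) : ∃ x y, Λ * divisorClass p x y ∈ E.selmer := by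
  obtain ⟨d₁, d₂, d₃, hd₁, hd₂, hd₃, rfl, hs, HR, HQ⟩ := hΛ
  set x := ratValuationVector p d₁ with hx
  set y := ratValuationVector p d₂ with hy
  have n0 {K : Type} [Field K] [CharZero K] (x : Fin k → ZMod 2) : (primeProd p x : K) ≠ 0 :=
    Nat.cast_ne_zero.2 (primeProd_ne_zero x)
  have m₁ := mul_ne_zero hd₁ (n0 (K := ℚ) x)
  have m₂ := mul_ne_zero hd₂ (n0 (K := ℚ) y)
  have m₃ := mul_ne_zero hd₃ (n0 (K := ℚ) (x + y))
  have hsq : IsSquare (d₁ * primeProd p x * (d₂ * primeProd p y) * (d₃ * primeProd p (x + y))) := by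
    have := hs.mul (isSquare_triple (p := p) x y)
    rwa [show d₁ * d₂ * d₃ * ((primeProd p x : ℚ) * primeProd p y * primeProd p (x + y)) =
      d₁ * primeProd p x * (d₂ * primeProd p y) * (d₃ * primeProd p (x + y)) by ring] at this
  refine ⟨x, y, ?_⟩
  have hΛ : ((sqClass d₁, sqClass d₂, sqClass d₃) : SqTriple ℚ) * divisorClass p x y =
      (sqClass (d₁ * primeProd p x), sqClass (d₂ * primeProd p y),
        sqClass (d₃ * primeProd p (x + y))) := by
    rw [sqClass_mul hd₁ (n0 x), sqClass_mul hd₂ (n0 y), sqClass_mul hd₃ (n0 (x + y))]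
    rfl
  rw [hΛ, E.mem_selmer_iff m₁ m₂ m₃]
  -- Where n and all its divisors in question are squares, neither twisting nor multiplying by a
  -- divisor triple changes the local condition.
  have transfer {K : Type} [Field K] [CharZero K] (hnK : IsSquare (n : K))
      (hsqK : ∀ z, IsSquare (primeProd p z : K))
      (H : (E.twist n h.ne_zero).HasPoint (d₁ : K) d₂ d₃) :
      E.HasPoint ((d₁ * primeProd p x : ℚ) : K) ((d₂ * primeProd p y : ℚ) : K)
        ((d₃ * primeProd p (x + y) : ℚ) : K) := by
    rw [E.hasPoint_twist_iff n h.ne_zero (Nat.cast_ne_zero.2 h.ne_zero) hnK] at H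
    have c (d : ℚ) (hd : d ≠ 0) (z : Fin k → ZMod 2) :
        sqClass (d : K) = sqClass ((d * primeProd p z : ℚ) : K) := by
      push_cast
      rw [sqClass_mul_isSquare (Rat.cast_ne_zero.2 hd) (n0 z) (hsqK z)]
    exact H.congr (Rat.cast_ne_zero.2 hd₁) (Rat.cast_ne_zero.2 hd₂) (Rat.cast_ne_zero.2 hd₃)
      (Rat.cast_ne_zero.2 m₁) (Rat.cast_ne_zero.2 m₂) (Rat.cast_ne_zero.2 m₃)
      (c _ hd₁ _) (c _ hd₂ _) (c _ hd₃ _)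
  refine ⟨hsq, transfer (isSquare_real n) (fun z => isSquare_real _) HR, fun q hq => ?_⟩
  by_cases hqe : (q : ℤ) ∣ E.e₁ * E.e₂ * E.e₃
  · refine transfer ?_ (isSquare_primeProd (h.isSquare_prime hqe)) (HQ q)
    rw [h.eq_prod, ← primeProd_one]
    exact isSquare_primeProd (h.isSquare_prime hqe) 1
  -- At the remaining primes `E` has good reduction, so even valuations suffice. At p_i the choice
  -- of x and y makes them even; elsewhere the local condition of the twist does.
  have key : Even (padicValRat q (d₁ * primeProd p x)) ∧
      Even (padicValRat q (d₂ * primeProd p y)) := by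
    by_cases hqp : ∃ i, q = p i
    · obtain ⟨i, rfl⟩ := hqp
      exact ⟨h.even_valuation_mul_primeProd hd₁ i, h.even_valuation_mul_primeProd hd₂ i⟩
    · push Not at hqp
      obtain ⟨h1, h2, h3⟩ := h.not_dvd_twist hq.out hqp hqe
      have hev := (HQ q).even_valuation h1 h2 h3 (Rat.cast_ne_zero.2 hd₁) (Rat.cast_ne_zero.2 hd₂)
        (Rat.cast_ne_zero.2 hd₃) (by simpa using hs.map (Rat.castHom ℚ_[q]))
      rw [Padic.valuation_ratCast, Padic.valuation_ratCast, Padic.valuation_ratCast] at hev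
      rw [padicValRat.mul hd₁ (n0 x), padicValRat.mul hd₂ (n0 y), padicValRat.of_nat,
        padicValRat.of_nat, padicValNat_primeProd_of_forall_ne hqp,
        padicValNat_primeProd_of_forall_ne hqp]
      simpa using ⟨hev.1, hev.2.1⟩
  -- The parity of the third entry follows from the square product.
  have key₃ : Even (padicValRat q (d₃ * primeProd p (x + y))) := by
    have := Padic.even_valuation_of_isSquare (hsq.map (Rat.castHom ℚ_[q]))
    rw [eq_ratCast, Padic.valuation_ratCast, padicValRat.mul (mul_ne_zero m₁ m₂) m₃,
      padicValRat.mul m₁ m₂] at this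
    exact (Int.even_add.1 this).1 (key.1.add key.2)
  have hE := E.ne_two_of_not_dvd hqe
  refine E.hasPoint_of_even_valuation hE (fun h' => hqe ((h'.mul_right _).mul_right _))
    (fun h' => hqe ((h'.mul_left _).mul_right _)) (fun h' => hqe (h'.mul_left _))
    (Rat.cast_ne_zero.2 m₁) (Rat.cast_ne_zero.2 m₂) (Rat.cast_ne_zero.2 m₃) ?_ ?_ ?_ ?_
  · rw [Padic.valuation_ratCast]
    exact key.1
  · rw [Padic.valuation_ratCast]
    exact key.2
  · rw [Padic.valuation_ratCast]
    exact key₃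
  · rw [← Rat.cast_mul, ← Rat.cast_mul]
    exact hsq.map (Rat.castHom ℚ_[q])

end AdmissibleTwist

/-! ### The pure Selmer group of the twist -/

namespace AdmissibleTwist

variable {E : TwoTorsionTriple} {k : ℕ} {p : Fin k → ℕ} {n : ℕ} [hp : ∀ i, Fact (p i).Prime]

theorem torsionRep_not_dvd (h : AdmissibleTwist E p n) (j : Fin k) (i : Fin 4) :
    ¬ (p j : ℤ) ∣ (E.torsionRep i).1 ∧ ¬ (p j : ℤ) ∣ (E.torsionRep i).2.1 := by
  obtain ⟨h1, h2, h3⟩ := h.not_dvd_e j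
  have hprime : Prime (p j : ℤ) := Nat.prime_iff_prime_int.1 (hp j).out
  fin_cases i <;>
    simp [TwoTorsionTriple.torsionRep, h1, h2, h3, hprime.dvd_mul, ← isUnit_iff_dvd_one,
      hprime.not_isUnit]

/-- The torsion classes of `E` are represented by products of ± eᵢ, which are prime to every p_i. -/
theorem eq_zero_of_divisorClass_eq_torsionClass (h : AdmissibleTwist E p n) {x y : Fin k → ZMod 2}
    {i : Fin 4} (hi : divisorClass p x y = E.torsionClass i) : x = 0 ∧ y = 0 :=
  ⟨eq_zero_of_sqClass_primeProd h.injective (E.torsionRep_ne_zero i).1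
    (fun j => (h.torsionRep_not_dvd j i).1) (congrArg Prod.fst hi),
    eq_zero_of_sqClass_primeProd h.injective (E.torsionRep_ne_zero i).2.1
    (fun j => (h.torsionRep_not_dvd j i).2) (congrArg (fun z => z.2.1) hi)⟩

theorem sqTriple_mul_self (c : SqTriple ℚ) : c * c = 1 :=
  Prod.ext (SqClass.mul_self _) (Prod.ext (SqClass.mul_self _) (SqClass.mul_self _))

/-- A class of divisors of `n` that comes from torsion of the twist is trivial. -/
theorem eq_zero_of_divisorClass_eq_torsionClass_twist (h : AdmissibleTwist E p n)
    (hE : ∀ P : (E.curve ℚ).toAffine.Point, addOrderOf P ≠ 4) {x y : Fin k → ZMod 2}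
    {i : Fin 4} (hi : divisorClass p x y = (E.twist n h.ne_zero).torsionClass i) :
    x = 0 ∧ y = 0 := by
  obtain ⟨x', y', hxy⟩ := exists_twistClass_eq h.eq_prod i
  rw [TwoTorsionTriple.torsionClass_twist, hxy] at hi
  have hE' : divisorClass p (x + x') (y + y') = E.torsionClass i := by
    rw [divisorClass_add, hi, mul_assoc, sqTriple_mul_self, mul_one]
  obtain ⟨h1, h2⟩ := h.eq_zero_of_divisorClass_eq_torsionClass hE'
  rw [h1, h2, divisorClass_zero, ← E.torsionClass_zero] at hE'
  -- The torsion class of `E` with index i is now trivial. Distinctness of the four classes gives i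
  -- = 0, so the torsion class of the twist is trivial as well.
  have hi0 := TwoTorsionTriple.torsionClass_injective hE hE'
  rw [← hxy, ← hi0, E.torsionClass_zero, one_mul] at hi
  exact h.eq_zero_of_divisorClass_eq_torsionClass (i := 0) (by rw [hi, E.torsionClass_zero]; rfl)

/-- Up to torsion, every Selmer class of the twist is a class of divisors of `n`. -/
theorem exists_eq_torsionClass_mul_divisorClass (h : AdmissibleTwist E p n)
    (hE : ∀ P : (E.curve ℚ).toAffine.Point, addOrderOf P ≠ 4)
    (hSel : Nonempty (E.selmer ≃* Multiplicative (ZMod 2 × ZMod 2))) {Λ : SqTriple ℚ}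
    (hΛ : Λ ∈ (E.twist n h.ne_zero).selmer) :
    ∃ i x y, Λ = (E.twist n h.ne_zero).torsionClass i * divisorClass p x y := by
  obtain ⟨x, y, hxy⟩ := h.mul_divisorClass_mem_selmer hΛ
  obtain ⟨i, hi⟩ := TwoTorsionTriple.eq_torsionClass_of_mem_selmer hE hSel hxy
  obtain ⟨x', y', hxy'⟩ := exists_twistClass_eq h.eq_prod i
  refine ⟨i, x' + x, y' + y, ?_⟩
  rw [TwoTorsionTriple.torsionClass_twist, ← hi, divisorClass_add, hxy']
  -- All classes have exponent two, so the squares of both divisor classes may be inserted and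
  -- regrouped.
  calc Λ = Λ * (divisorClass p x y * divisorClass p x y) *
        (divisorClass p x' y' * divisorClass p x' y') := by
          rw [sqTriple_mul_self, sqTriple_mul_self, mul_one, mul_one]
    _ = _ := by ac_rfl

theorem mem_ker_iff {v : Fin k ⊕ Fin k → ZMod 2} :
    v ∈ LinearMap.ker (Matrix.fromBlocks (hilbertMatrix p n) 0 0 (hilbertMatrix p n)).mulVecLin ↔
      (hilbertMatrix p n).mulVec (v ∘ Sum.inl) = 0 ∧
      (hilbertMatrix p n).mulVec (v ∘ Sum.inr) = 0 := by
  rw [LinearMap.mem_ker, Matrix.mulVecLin_apply, Matrix.fromBlocks_mulVec, Matrix.zero_mulVec,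
    Matrix.zero_mulVec, add_zero, zero_add]
  constructor
  · intro h
    exact ⟨funext fun i => congrFun h (Sum.inl i), funext fun i => congrFun h (Sum.inr i)⟩
  · rintro ⟨h1, h2⟩
    rw [h1, h2]
    funext i
    cases i <;> rfl

/-- The homomorphism from the kernel of the matrix to the pure Selmer group of the twist. -/
noncomputable def kerToPureSelmer (h : AdmissibleTwist E p n) :
    Multiplicative (LinearMap.ker (Matrix.fromBlocks (hilbertMatrix p n) 0 0
      (hilbertMatrix p n)).mulVecLin) →* (E.twist n h.ne_zero).pureSelmer :=
  (QuotientGroup.mk' (E.twist n h.ne_zero).torsionImage).comp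
    (MonoidHom.mk' (fun v => ⟨divisorClass p (v.toAdd.1 ∘ Sum.inl) (v.toAdd.1 ∘ Sum.inr),
        (h.divisorClass_mem_selmer_iff _ _).2 (mem_ker_iff.1 v.toAdd.2)⟩)
      fun _ _ => Subtype.ext (divisorClass_add _ _ _ _))

/-- The absence of 4-torsion on the twist identifies the subgroup divided out with its four torsion
classes. Injectivity says that only the trivial divisor class is among them; surjectivity is the
decomposition of a Selmer class into torsion and divisors. -/
theorem kerToPureSelmer_bijective (h : AdmissibleTwist E p n)
    (hE : ∀ P : (E.curve ℚ).toAffine.Point, addOrderOf P ≠ 4)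
    (hEn : ∀ P : ((E.twist n h.ne_zero).curve ℚ).toAffine.Point, addOrderOf P ≠ 4)
    (hSel : Nonempty (E.selmer ≃* Multiplicative (ZMod 2 × ZMod 2))) :
    Function.Bijective h.kerToPureSelmer := by
  constructor
  · rw [injective_iff_map_eq_one]
    intro v hv
    obtain ⟨i, hi⟩ := (TwoTorsionTriple.mem_torsionImage_iff hEn).1
      ((QuotientGroup.eq_one_iff _).1 hv)
    obtain ⟨h1, h2⟩ := h.eq_zero_of_divisorClass_eq_torsionClass_twist hE hi
    refine Multiplicative.toAdd.injective (Subtype.ext (funext fun i => ?_))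
    rcases i with i | i
    · exact congrFun h1 i
    · exact congrFun h2 i
  · intro c
    obtain ⟨⟨Λ, hΛ⟩, rfl⟩ := QuotientGroup.mk_surjective c
    obtain ⟨i, x, y, hxy⟩ := h.exists_eq_torsionClass_mul_divisorClass hE hSel hΛ
    have hτ : (E.twist n h.ne_zero).torsionClass i ∈ (E.twist n h.ne_zero).selmer :=
      TwoTorsionTriple.kummer_twoTorsionPoint _ i ▸ TwoTorsionTriple.kummer_mem_selmer _ _
    have hxy' : divisorClass p x y = ((E.twist n h.ne_zero).torsionClass i)⁻¹ * Λ := by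
      rw [hxy, inv_mul_cancel_left]
    -- The divisor factor is a quotient of two Selmer classes, hence Selmer, so its vectors lie in
    -- the kernel.
    have hmem : divisorClass p x y ∈ (E.twist n h.ne_zero).selmer :=
      hxy' ▸ mul_mem (inv_mem hτ) hΛ
    refine ⟨Multiplicative.ofAdd ⟨Sum.elim x y, mem_ker_iff.2 ?_⟩, ?_⟩
    · exact (h.divisorClass_mem_selmer_iff x y).1 hmem
    · refine QuotientGroup.eq.2 ((TwoTorsionTriple.mem_torsionImage_iff hEn).2 ⟨i, ?_⟩)
      change (divisorClass p x y)⁻¹ * Λ = _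
      rw [hxy, mul_comm _ (divisorClass p x y), inv_mul_cancel_left]

/-- A Selmer class of divisors of `n` is determined by the valuations of the first two. -/
theorem eq_primeProd_of_classOf_mem_selmer (h : AdmissibleTwist E p n) {d₁ d₂ d₃ : ℕ} (h₁ : d₁ ∣ n)
    (h₂ : d₂ ∣ n) (h₃ : d₃ ∣ n)
    (hd : TwoTorsionTriple.classOf d₁ d₂ d₃ ∈ (E.twist n h.ne_zero).selmer) :
    d₁ = primeProd p (valuationVector p d₁) ∧ d₂ = primeProd p (valuationVector p d₂) ∧
      d₃ = primeProd p (valuationVector p d₁ + valuationVector p d₂) := by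
  have n0 {d : ℕ} (hd : d ∣ n) : (d : ℚ) ≠ 0 :=
    Nat.cast_ne_zero.2 (ne_zero_of_dvd_ne_zero h.ne_zero hd)
  have hs := ((TwoTorsionTriple.mem_selmer_iff _ (n0 h₁) (n0 h₂) (n0 h₃)).1 hd).1
  have hc := sqClass_prod_of_isSquare (n0 h₁) (n0 h₂) (n0 h₃) hs
  rw [h.eq_prod] at h₁ h₂ h₃
  have e₁ := primeProd_valuationVector h.injective h₁
  have e₂ := primeProd_valuationVector h.injective h₂
  have e₃ := primeProd_valuationVector h.injective h₃
  refine ⟨e₁.symm, e₂.symm, ?_⟩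
  have : valuationVector p d₃ = valuationVector p d₁ + valuationVector p d₂ := by
    refine primeProd_sqClass_injective h.injective ?_
    rw [sqClass_primeProd_add, e₁, e₂, e₃, hc]
  rw [← this, e₃]

/-- Names the preimage of an explicit triple of divisors. This gives both the uniqueness of
representatives and the formula for the isomorphism, which is the inverse of `kerToPureSelmer`. -/
theorem exists_kerToPureSelmer_eq (h : AdmissibleTwist E p n) {d₁ d₂ d₃ : ℕ} (h₁ : d₁ ∣ n)
    (h₂ : d₂ ∣ n) (h₃ : d₃ ∣ n)
    (hd : TwoTorsionTriple.classOf d₁ d₂ d₃ ∈ (E.twist n h.ne_zero).selmer) :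
    ∃ v, h.kerToPureSelmer v = QuotientGroup.mk ⟨_, hd⟩ ∧
      (v.toAdd : Fin k ⊕ Fin k → ZMod 2) =
        Sum.elim (valuationVector p d₁) (valuationVector p d₂) := by
  obtain ⟨e₁, e₂, e₃⟩ := h.eq_primeProd_of_classOf_mem_selmer h₁ h₂ h₃ hd
  have heq : divisorClass p (valuationVector p d₁) (valuationVector p d₂) =
      TwoTorsionTriple.classOf d₁ d₂ d₃ := by
    rw [divisorClass, ← e₁, ← e₂, ← e₃]
  refine ⟨Multiplicative.ofAdd ⟨Sum.elim (valuationVector p d₁) (valuationVector p d₂),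
    mem_ker_iff.2 ((h.divisorClass_mem_selmer_iff _ _).1 (heq ▸ hd))⟩, ?_, rfl⟩
  exact congrArg QuotientGroup.mk (Subtype.ext heq)

end AdmissibleTwist

theorem mainTheorem4 (E : TwoTorsionTriple) (n : ℕ) (hpos : n ≠ 0) (hodd : Odd n)
    (hsq : Squarefree n) (hcop : IsCoprime (n : ℤ) (E.e₁ * E.e₂ * E.e₃))
    {k : ℕ} (p : Fin k → ℕ) [∀ i, Fact (p i).Prime] (hn : n = ∏ i, p i)
    (hres : ∀ i, ∀ q : ℕ, q.Prime → Odd q → (q : ℤ) ∣ E.e₁ * E.e₂ * E.e₃ →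
      IsSquare (p i : ZMod q))
    (h8 : ∀ i, p i ≡ 1 [MOD 8])
    (hE : ∀ P : (E.curve ℚ).toAffine.Point, addOrderOf P ≠ 4)
    (hEn : ∀ P : ((E.twist n hpos).curve ℚ).toAffine.Point, addOrderOf P ≠ 4)
    (hSel : Nonempty (E.selmer ≃* Multiplicative (ZMod 2 × ZMod 2))) :
    (∀ c : (E.twist n hpos).pureSelmer, ∃! d : ℕ × ℕ × ℕ,
      d.1 ∣ n ∧ d.2.1 ∣ n ∧ d.2.2 ∣ n ∧
        ∃ h : TwoTorsionTriple.classOf d.1 d.2.1 d.2.2 ∈ (E.twist n hpos).selmer,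
          c = QuotientGroup.mk ⟨_, h⟩) ∧
    ∃ φ : (E.twist n hpos).pureSelmer ≃*
        Multiplicative (LinearMap.ker (Matrix.fromBlocks (hilbertMatrix p n) 0 0
          (hilbertMatrix p n)).mulVecLin),
      ∀ d₁ d₂ d₃ : ℕ, d₁ ∣ n → d₂ ∣ n → d₃ ∣ n →
        ∀ h : TwoTorsionTriple.classOf d₁ d₂ d₃ ∈ (E.twist n hpos).selmer,
          ((φ (QuotientGroup.mk ⟨_, h⟩)).toAdd : Fin k ⊕ Fin k → ZMod 2) =
            Sum.elim (valuationVector p d₁) (valuationVector p d₂) := by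
  have hinj : Function.Injective p := by
    intro i j hij
    by_contra hne
    refine (Fact.out : (p i).Prime).not_isUnit (hsq (p i) ?_)
    rw [hn, ← Finset.mul_prod_erase _ _ (Finset.mem_univ i)]
    refine mul_dvd_mul_left _ ?_
    nth_rw 1 [hij]
    exact Finset.dvd_prod_of_mem p (Finset.mem_erase.2 ⟨Ne.symm hne, Finset.mem_univ j⟩)
  have h : AdmissibleTwist E p n := by
    refine ⟨hpos, hn, hinj, fun i hi => ?_, hres, h8⟩
    have hin : (p i : ℤ) ∣ n := by
      rw [Int.natCast_dvd_natCast, hn]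
      exact Finset.dvd_prod_of_mem p (Finset.mem_univ i)
    exact (Nat.prime_iff_prime_int.1 (Fact.out : (p i).Prime)).not_isUnit
      (hcop.isUnit_of_dvd' hin hi)
  have hbij := h.kerToPureSelmer_bijective hE hEn hSel
  refine ⟨fun c => ?_, (MulEquiv.ofBijective h.kerToPureSelmer hbij).symm,
    fun d₁ d₂ d₃ h₁ h₂ h₃ hd => ?_⟩
  · obtain ⟨v, rfl⟩ := hbij.2 c
    have dvd (x : Fin k → ZMod 2) : primeProd p x ∣ n := hn ▸ primeProd_dvd x
    -- The representative is read off the kernel vector (x, y): the divisors attached to x, y and x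
    -- + y.
    refine ⟨(_, _, _), ⟨dvd (v.toAdd.1 ∘ Sum.inl), dvd (v.toAdd.1 ∘ Sum.inr), dvd _,
      (h.divisorClass_mem_selmer_iff _ _).2 (AdmissibleTwist.mem_ker_iff.1 v.toAdd.2), rfl⟩, ?_⟩
    rintro ⟨d₁, d₂, d₃⟩ ⟨h₁, h₂, h₃, hd, hc⟩
    obtain ⟨w, hw, hw'⟩ := h.exists_kerToPureSelmer_eq h₁ h₂ h₃ hd
    obtain rfl := hbij.1 (hc.trans hw.symm)
    obtain ⟨e₁, e₂, e₃⟩ := h.eq_primeProd_of_classOf_mem_selmer h₁ h₂ h₃ hd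
    refine Prod.ext ?_ (Prod.ext ?_ ?_)
    · change d₁ = primeProd p (v.toAdd.1 ∘ Sum.inl)
      rwa [hw']
    · change d₂ = primeProd p (v.toAdd.1 ∘ Sum.inr)
      rwa [hw']
    · change d₃ = primeProd p (v.toAdd.1 ∘ Sum.inl + v.toAdd.1 ∘ Sum.inr)
      rwa [hw']
  · obtain ⟨v, hv, hv'⟩ := h.exists_kerToPureSelmer_eq h₁ h₂ h₃ hd
    rw [← hv', ← hv]
    congr 2
    exact (MulEquiv.ofBijective h.kerToPureSelmer hbij).symm_apply_apply v
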